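/- Let $\Omega=(0,1)^2$, $\Gamma_1=(0,1)\times\{0\}$, $\Gamma_2=\{1\}\times(0,1)$, $\Gamma_3=(0,1)\times\{1\}$, $\Gamma_4=\{0\}\times(0,1)$; all functions are complex valued, $\nu$ is the outward unit normal, $\|\cdot\|_{0,\Omega}$ and $\|\cdot\|_{0,\Gamma_2}$ are $L^2$ norms. Fix $\mathcal B_1,\mathcal B_3\in\{\mathrm{id},\partial_\nu\}$. For $k>0$, $\mathcal B_2\in\{\mathrm{id},\partial_\nu,\partial_\nu-ik\,\mathrm{id}\}$ and $g_2\in L^2(\Gamma_2)$ consider $$\Delta u+k^2u=0\ \text{in }\Omega,\qquad \mathcal B_1u=0\ \text{on }\Gamma_1,\quad \mathcal B_3u=0\ \text{on }\Gamma_3,\quad \mathcal B_2u=g_2\ \text{on }\Gamma_2,\quad \partial_\nu u-iku=0\ \text{on }\Gamma_4 .$$ A (weak) solution is a $u\in H^1(\Omega)$ whose trace equals the datum ($g_2$ or $0$) on the Dirichlet sides, whose union is denoted $\Gamma_D$, such that for all $v\in H^1(\Omega)$ with $v=0$ on $\Gamma_D$ $$\int_\Omega(\nabla u\cdot\nabla\bar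 v-k^2u\bar v)-ik\int_{\Gamma_R}u\bar v=\int_{\Gamma_2\setminus\Gamma_D}g_2\bar v ,$$ where $\Gamma_R$ is the union of the sides with an impedance condition $\partial_\nu-ik\,\mathrm{id}$. For $n\in\mathbb N_0$ let $\mu_n=n\pi$ if $\mathcal B_1=\mathcal B_3$ and $\mu_n=(n+\frac12)\pi$ otherwise, and let $Y_n(y)$ be: $\sqrt2\sin(\mu_ny)$ if $\mathcal B_1=\mathrm{id}$; $\sqrt2\cos(\mu_ny)$ if $\mathcal B_1=\partial_\nu$, except that $Y_0=1$ if $\mathcal B_1=\mathcal B_3=\partial_\nu$. For $g\in L^2(\Gamma_2)$ put $\widehat g(n)=\int_0^1 g(y)Y_n(y)\,dy$; $g\in\mathcal Y^{1/2}(\Gamma_2)$ means $\|g\|^2_{\mathcal Y^{1/2}(\Gamma_2)}:=\sum_{n\ge0}|\widehat g(n)|^2\mu_n<\infty$. Theorem. (1) Let $\mathcal B_2=\partial_\nu-ik\,\mathrm{id}$. For all $k>0$ and $g_2\in L^2(\Gamma_2)$ there is a unique solution $u$, and $$\|\nabla u\|_{0,\Omega}+k\|u\|_{0,\Omega}\le\sqrt{12}\,\max\{k,1\}\,\|g_2\|_{0,\Gamma_2}.$$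 (2) Let $\mathcal B_2=\partial_\nu$. For all $k>0$ and $g_2\in L^2(\Gamma_2)$ there is a unique solution $u$, and $$\|\nabla u\|_{0,\Omega}+k\|u\|_{0,\Omega}\le\sqrt{20}\,\max\{k^2,1\}\,\|g_2\|_{0,\Gamma_2}.$$ (3) Let $\mathcal B_2=\mathrm{id}$. For all $k>0$ and $g_2\in\mathcal Y^{1/2}(\Gamma_2)$ there is a unique solution $u$, and $$\|\nabla u\|_{0,\Omega}+k\|u\|_{0,\Omega}\le\sqrt{14}\left(\max\{k^2,1\}\,\|g_2\|_{0,\Gamma_2}+\max\{k^{1/2},1\}\,\|g_2\|_{\mathcal Y^{1/2}(\Gamma_2)}\right).$$ These bounds are sharp, up to a constant independent of $k$ and $g_2$, along sequences of wavenumbers tending to infinity: for every integer $n\ge1$ there are a datum $g_2\neq0$ (in case (3), $g_2\in\mathcal Y^{1/2}(\Gamma_2)$) and a solution $u$ such that $\|\nabla u\|_{0,\Omega}+k\|u\|_{0,\Omega}$ is at least - $\frac{\sqrt2}{2\pi}\max\{k,1\}\|g_2\|_{0,\Gamma_2}$ in case (1) with $k=\sqrt{\mu_n^2+\pi^2}$;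 - $\frac{4\sqrt2}{\pi^2}\max\{k^2,1\}\|g_2\|_{0,\Gamma_2}$ in case (2) with $k=\sqrt{\mu_n^2+\pi^2/4}$; - $\frac1\pi\left(\max\{k^2,1\}\|g_2\|_{0,\Gamma_2}+\max\{k^{1/2},1\}\|g_2\|_{\mathcal Y^{1/2}(\Gamma_2)}\right)$ in case (3) with $k=\sqrt{\mu_n^2+\pi^2}$. -/

import Mathlib

open MeasureTheory
open scoped ContDiff ComplexConjugate

namespace Helmholtz

/-- The four sides of the unit square: `bottom = (0,1) × {0}`, `right = {1} × (0,1)`,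
`top = (0,1) × {1}`, `left = {0} × (0,1)`. -/
inductive Side where
  | bottom
  | right
  | top
  | left
deriving DecidableEq

instance : Fintype Side where
  elems := {Side.bottom, Side.right, Side.top, Side.left}
  complete := by intro s; cases s <;> simp

/-- The three kinds of boundary operators: `u`, `∂u/∂ν` and `∂u/∂ν - i k u`. -/
inductive BC where
  | dirichlet
  | neumann
  | impedance
deriving DecidableEq

/-- The open unit square `Ω = (0,1)²`. -/
def unitSquare : Set (ℝ × ℝ) := Set.Ioo (0 : ℝ) 1 ×ˢ Set.Ioo (0 : ℝ) 1

/-- `L²(Ω)`, complex valued. -/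
abbrev L2Square : Type := Lp ℂ 2 (volume.restrict unitSquare)

/-- `L²` of a side; every side is identified with `(0,1)` through its free coordinate. -/
abbrev L2Side : Type := Lp ℂ 2 (volume.restrict (Set.Ioo (0 : ℝ) 1))

/-- The partial derivative in the first variable of a differentiable function on the plane. -/
noncomputable def partialX (φ : ℝ × ℝ → ℂ) (z : ℝ × ℝ) : ℂ := fderiv ℝ φ z (1, 0)

/-- The partial derivative in the second variable of a differentiable function on the plane. -/
noncomputable def partialY (φ : ℝ × ℝ → ℂ) (z : ℝ × ℝ) : ℂ := fderiv ℝ φ z (0, 1)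

/-- `φ ∈ C_c^∞(Ω)`. -/
def IsTestFunction (φ : ℝ × ℝ → ℂ) : Prop :=
  ContDiff ℝ ∞ φ ∧ HasCompactSupport φ ∧ tsupport φ ⊆ unitSquare

/-- An element of the Sobolev space `H¹(Ω)`: a square integrable function together with its weak
partial derivatives, which are square integrable (and uniquely determined by the function). -/
@[ext]
structure H1 where
  /-- the function -/
  val : L2Square
  /-- its weak derivative in the first variable -/
  dx : L2Square
  /-- its weak derivative in the second variable -/
  dy : L2Square
  weak_dx : ∀ φ : ℝ × ℝ → ℂ, IsTestFunction φ →
    ∫ z in unitSquare, val z * partialX φ z = - ∫ z in unitSquare, dx z * φ z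
  weak_dy : ∀ φ : ℝ × ℝ → ℂ, IsTestFunction φ →
    ∫ z in unitSquare, val z * partialY φ z = - ∫ z in unitSquare, dy z * φ z

/-- `‖u‖_{0,Ω}`. -/
noncomputable def H1.normL2 (u : H1) : ℝ := ‖u.val‖

/-- `‖∇u‖_{0,Ω}`. -/
noncomputable def H1.normGrad (u : H1) : ℝ := Real.sqrt (‖u.dx‖ ^ 2 + ‖u.dy‖ ^ 2)

/-- `τ` is the family of boundary traces in `L²` of `u ∈ H¹(Ω)` on the four sides: the trace on
`∂Ω` is the unique square integrable boundary function for which Green's formula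
`∫_Ω (u ∂ⱼφ + (∂ⱼu) φ) = ∫_{∂Ω} τ φ νⱼ` holds for all `φ ∈ C^∞` of the closed square. -/
def HasTrace (u : H1) (τ : Side → L2Side) : Prop :=
  ∀ φ : ℝ × ℝ → ℂ, ContDiff ℝ ∞ φ →
    ((∫ z in unitSquare, u.val z * partialX φ z) + (∫ z in unitSquare, u.dx z * φ z) =
      (∫ y in Set.Ioo (0 : ℝ) 1, τ Side.right y * φ (1, y)) -
        ∫ y in Set.Ioo (0 : ℝ) 1, τ Side.left y * φ (0, y)) ∧
    ((∫ z in unitSquare, u.val z * partialY φ z) + (∫ z in unitSquare, u.dy z * φ z) =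
      (∫ x in Set.Ioo (0 : ℝ) 1, τ Side.top x * φ (x, 1)) -
        ∫ x in Set.Ioo (0 : ℝ) 1, τ Side.bottom x * φ (x, 0))

/-- `u ∈ H¹(Ω)` is a weak solution of `Δu + k² u = -f` in `Ω` with the boundary condition of kind
`B s` and with datum `g s` on each side `s`: the trace of `u` equals `g s` on the Dirichlet sides,
and for every `v ∈ H¹(Ω)` whose trace vanishes on the Dirichlet sides
`∫_Ω (∇u · ∇v̄ - k² u v̄) - i k ∫_{Γ_R} u v̄ = ∫_Ω f v̄ + ∫_{Γ_R ∪ Γ_N} g v̄`.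
The inner products are those of `L²`: `inner ℂ v u = ∫ u v̄`. -/
def IsWeakSolution (k : ℝ) (B : Side → BC) (f : L2Square) (g : Side → L2Side) (u : H1) : Prop :=
  ∃ τ : Side → L2Side, HasTrace u τ ∧
    (∀ s, B s = BC.dirichlet → τ s = g s) ∧
    ∀ (v : H1) (σ : Side → L2Side), HasTrace v σ → (∀ s, B s = BC.dirichlet → σ s = 0) →
      inner ℂ v.dx u.dx + inner ℂ v.dy u.dy - (k : ℂ) ^ 2 * inner ℂ v.val u.val
          - Complex.I * (k : ℂ) *
            (∑ s, if B s = BC.impedance then (inner ℂ (σ s) (τ s) : ℂ) else 0)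
        = inner ℂ v.val f
          + ∑ s, if B s = BC.dirichlet then (0 : ℂ) else inner ℂ (σ s) (g s)

/-- The kinds of boundary conditions: `B₁` at the bottom, `B₂` at the right, `B₃` at the top,
impedance at the left. -/
def boundaryOps (B₁ B₂ B₃ : BC) : Side → BC
  | Side.bottom => B₁
  | Side.right => B₂
  | Side.top => B₃
  | Side.left => BC.impedance

/-- The weak solutions for `f = 0`, impedance condition at the left, and homogeneous conditions on
all sides but the right one, where the datum is `g₂`. -/
def IsSolution (k : ℝ) (B₁ B₂ B₃ : BC) (g₂ : L2Side) (u : H1) : Prop :=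
  IsWeakSolution k (boundaryOps B₁ B₂ B₃) 0 (Pi.single Side.right g₂) u

/-- The frequencies `μ_n`, for horizontal conditions `B₁, B₃` of Dirichlet or Neumann kind. -/
noncomputable def freq (B₁ B₃ : BC) (n : ℕ) : ℝ :=
  if B₁ = B₃ then n * Real.pi else (n + 1 / 2) * Real.pi

/-- The functions `Y_n`, orthonormal in `L²(0,1)` (except that `Y_0 = 0` in the Dirichlet-Dirichlet
case). Only Dirichlet and Neumann conditions `B₁` (at `y = 0`) and `B₃` (at `y = 1`) matter. -/
noncomputable def eigenfun : BC → BC → ℕ → ℝ → ℝ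
  | BC.dirichlet, BC.dirichlet, n, y => Real.sqrt 2 * Real.sin (n * Real.pi * y)
  | BC.neumann, BC.neumann, n, y =>
      if n = 0 then 1 else Real.sqrt 2 * Real.cos (n * Real.pi * y)
  | BC.dirichlet, BC.neumann, n, y => Real.sqrt 2 * Real.sin ((n + 1 / 2) * Real.pi * y)
  | BC.neumann, BC.dirichlet, n, y => Real.sqrt 2 * Real.cos ((n + 1 / 2) * Real.pi * y)
  | _, _, _, _ => 0

/-- The coefficient `ĝ(n) = ∫₀¹ g Y_n`. -/
noncomputable def coeff (B₁ B₃ : BC) (g : L2Side) (n : ℕ) : ℂ :=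
  ∫ y in Set.Ioo (0 : ℝ) 1, g y * (eigenfun B₁ B₃ n y : ℂ)

/-- `g ∈ 𝒴^s`, that is, `∑ |ĝ(n)|² μ_n^{2s} < ∞`. -/
def MemY (B₁ B₃ : BC) (s : ℝ) (g : L2Side) : Prop :=
  Summable fun n : ℕ => ‖coeff B₁ B₃ g n‖ ^ 2 * freq B₁ B₃ n ^ (2 * s)

/-- `‖g‖_{𝒴^s} = (∑ |ĝ(n)|² μ_n^{2s})^{1/2}` for `g ∈ 𝒴^s`. -/
noncomputable def normY (B₁ B₃ : BC) (s : ℝ) (g : L2Side) : ℝ :=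
  Real.sqrt (∑' n : ℕ, ‖coeff B₁ B₃ g n‖ ^ 2 * freq B₁ B₃ n ^ (2 * s))

end Helmholtz

/-! The problem separates. Put a = k² - m². The vertical modes Y_n of frequency m = μ_n reduce the
equation to E'' + a E = 0 on (0,1). With C, S the fundamental system at 0, the function E = C - ikS
is, up to a factor, the only solution satisfying the left impedance condition (there ∂_ν = -d/dx).
If D_n denotes the right boundary operator applied to E (`modeBC`), the solution is the sum of
ĝ(n)/D_n · E(x) Y_n(y).

Everything is governed by the ratio of the energy of E, namely 2k² + m² + 2m⁴J with J = ∫S²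
(`modeEnergy`), to |D_n|². The identity C² + aS² = 1 gives |D_n|² in closed form: m⁴S(1)² + 4k² for
impedance, k² - a m² S(1)² for Neumann, 1 + m² S(1)² for Dirichlet. In the propagating range a ≥ 0
one has J ≤ 1, so the energy is at most of order k⁴ for k ≥ 1. There |D_n|² ≥ 4k² in the impedance
case, and it is only bounded below by a constant in the other two when m ≥ 3/2; this accounts for
the powers k and k². In the evanescent range a < 0, J is controlled by S(1)². For Dirichlet data
with m much larger than k the ratio still grows like m, which is why the 𝒴^{1/2} norm appears. The
three estimates are `modeEnergy_le_impedance`, `modeEnergy_le_neumann` and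
`modeEnergy_le_dirichlet`; they also show D_n ≠ 0.

Completeness of the modes rests on cos(πy) Y_n being a combination of two modes: a function
orthogonal to all modes is, after multiplication by one that does not vanish on (0,1), orthogonal to
all polynomials in cos(πy), and Weierstrass applies (`ae_eq_zero_of_integral_mul_eigenfun`).
Existence and the bound follow by summing orthogonal series in H¹ (`exists_isSolution`,
`existsUnique_and_bound`). Uniqueness is a duality argument: testing with separated solutions of the
inhomogeneous problem in x shows that every moment of u against w(x) Y_n(y) is determined by g
(`exists_inner_eq`).

For sharpness, one mode suffices: k is chosen with a = π² (so S(1) = 0) or a = π²/4 (so C(1) = 0),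
which makes J = 1/(2a) and the energy of order k⁴ (`sqrt_two_mul_le_modeSol`). -/

namespace Helmholtz

/-! ### The fundamental system of `y'' + a y = 0` -/

/-- The solution of `y'' + a y = 0` with `y 0 = 1`, `y' 0 = 0`. -/
noncomputable def oscC (a x : ℝ) : ℝ :=
  if 0 ≤ a then Real.cos (√a * x) else Real.cosh (√(-a) * x)

/-- The solution of `y'' + a y = 0` with `y 0 = 0`, `y' 0 = 1`. -/
noncomputable def oscS (a x : ℝ) : ℝ :=
  if a = 0 then x else if 0 ≤ a then Real.sin (√a * x) / √a else Real.sinh (√(-a) * x) / √(-a)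

lemma hasDerivAt_oscS (a x : ℝ) : HasDerivAt (oscS a) (oscC a x) x := by
  have hlin : ∀ c : ℝ, HasDerivAt (fun x : ℝ => c * x) c x := fun c => by
    simpa using (hasDerivAt_id x).const_mul c
  rcases lt_trichotomy a 0 with h | h | h
  · have hs : √(-a) ≠ 0 := (Real.sqrt_pos.2 (by linarith)).ne'
    have h1 : oscS a = fun x => Real.sinh (√(-a) * x) / √(-a) := by
      ext; simp [oscS, h.ne, not_le.2 h]
    rw [h1]
    simp only [oscC, not_le.2 h, if_false]
    have := ((hlin (√(-a))).sinh).div_const (√(-a))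
    rwa [mul_div_assoc, div_self hs, mul_one] at this
  · subst h
    have h1 : oscS 0 = fun x => x := by ext; simp [oscS]
    rw [h1]; simpa [oscC] using hasDerivAt_id' x
  · have hs : √a ≠ 0 := (Real.sqrt_pos.2 h).ne'
    have h1 : oscS a = fun x => Real.sin (√a * x) / √a := by
      ext; simp [oscS, h.ne', h.le]
    rw [h1]
    simp only [oscC, h.le, if_true]
    have := ((hlin (√a)).sin).div_const (√a)
    rwa [mul_div_assoc, div_self hs, mul_one] at this

lemma hasDerivAt_oscC (a x : ℝ) : HasDerivAt (oscC a) (-(a * oscS a x)) x := by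
  have hlin : ∀ c : ℝ, HasDerivAt (fun x : ℝ => c * x) c x := fun c => by
    simpa using (hasDerivAt_id x).const_mul c
  rcases lt_trichotomy a 0 with h | h | h
  · have hs : √(-a) ≠ 0 := (Real.sqrt_pos.2 (by linarith)).ne'
    have h1 : oscC a = fun x => Real.cosh (√(-a) * x) := by
      ext; simp [oscC, not_le.2 h]
    rw [h1]
    simp only [oscS, h.ne, not_le.2 h, if_false]
    convert (hlin (√(-a))).cosh using 1
    have h2 := Real.mul_self_sqrt (show 0 ≤ -a by linarith)
    field_simp
    linear_combination -Real.sinh (√(-a) * x) * h2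
  · subst h
    have h1 : oscC 0 = fun x => 1 := by ext; simp [oscC]
    rw [h1]; simpa using hasDerivAt_const x (1 : ℝ)
  · have hs : √a ≠ 0 := (Real.sqrt_pos.2 h).ne'
    have h1 : oscC a = fun x => Real.cos (√a * x) := by
      ext; simp [oscC, h.le]
    rw [h1]
    simp only [oscS, h.ne', h.le, if_false, if_true]
    convert (hlin (√a)).cos using 1
    have h2 := Real.mul_self_sqrt h.le
    field_simp
    linear_combination Real.sin (√a * x) * h2

@[simp] lemma oscC_zero (a : ℝ) : oscC a 0 = 1 := by simp [oscC]

@[simp] lemma oscS_zero (a : ℝ) : oscS a 0 = 0 := by simp [oscS]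

/-- Since S' = C and C' = -aS, each function gains a derivative from the other, so the induction
must treat both at once. -/
lemma contDiff_oscC_oscS (a : ℝ) (n : ℕ) : ContDiff ℝ n (oscC a) ∧ ContDiff ℝ n (oscS a) := by
  induction n with
  | zero =>
    simp only [Nat.cast_zero, contDiff_zero]
    exact ⟨continuous_iff_continuousAt.2 fun x => (hasDerivAt_oscC a x).continuousAt,
      continuous_iff_continuousAt.2 fun x => (hasDerivAt_oscS a x).continuousAt⟩
  | succ n ih =>
    have hC : deriv (oscC a) = fun x => -(a * oscS a x) :=
      funext fun x => (hasDerivAt_oscC a x).deriv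
    have hS : deriv (oscS a) = oscC a := funext fun x => (hasDerivAt_oscS a x).deriv
    push_cast
    constructor
    · refine contDiff_succ_iff_deriv.2
        ⟨fun x => (hasDerivAt_oscC a x).differentiableAt, by simp, ?_⟩
      rw [hC]; exact (contDiff_const.mul ih.2).neg
    · refine contDiff_succ_iff_deriv.2
        ⟨fun x => (hasDerivAt_oscS a x).differentiableAt, by simp, ?_⟩
      rw [hS]; exact ih.1

lemma contDiff_oscC (a : ℝ) : ContDiff ℝ ∞ (oscC a) :=
  contDiff_infty.2 fun n => (contDiff_oscC_oscS a n).1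

lemma contDiff_oscS (a : ℝ) : ContDiff ℝ ∞ (oscS a) :=
  contDiff_infty.2 fun n => (contDiff_oscC_oscS a n).2

lemma continuous_oscC (a : ℝ) : Continuous (oscC a) := (contDiff_oscC a).continuous

lemma continuous_oscS (a : ℝ) : Continuous (oscS a) := (contDiff_oscS a).continuous

/-- The conserved energy of the equation, valid for every sign of a. It is what eliminates C² from
the formulas for |E|², |E'|² and |D_n|². -/
lemma oscC_sq_add (a x : ℝ) : oscC a x ^ 2 + a * oscS a x ^ 2 = 1 := by
  have h : ∀ x, HasDerivAt (fun x => oscC a x ^ 2 + a * oscS a x ^ 2) 0 x := fun x => by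
    refine (((hasDerivAt_oscC a x).fun_pow 2).fun_add
      (((hasDerivAt_oscS a x).fun_pow 2).const_mul a)).congr_deriv ?_
    push_cast; ring
  have := is_const_of_deriv_eq_zero (fun x => (h x).differentiableAt) (fun x => (h x).deriv) x 0
  simpa using this

lemma oscS_sq_le_one {a x : ℝ} (ha : 0 ≤ a) (hx0 : 0 ≤ x) (hx1 : x ≤ 1) : oscS a x ^ 2 ≤ 1 := by
  have hx2 : x ^ 2 ≤ 1 := pow_le_one₀ hx0 hx1
  rcases ha.eq_or_lt with h | h
  · subst h; simpa [oscS] using hx2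
  · simp only [oscS, h.ne', h.le, if_false, if_true]
    rw [div_pow, Real.sq_sqrt h.le, div_le_one h]
    have h1 : |Real.sin (√a * x)| ≤ |√a * x| := Real.abs_sin_le_abs
    have h2 := sq_le_sq.2 h1
    rw [mul_pow, Real.sq_sqrt h.le] at h2
    nlinarith

/-! ### The evanescent range a < 0. -/

section hyperbolic

variable {a : ℝ}

lemma oscS_eq_sinh (ha : a < 0) (x : ℝ) : oscS a x = Real.sinh (√(-a) * x) / √(-a) := by
  simp [oscS, ha.ne, not_le.2 ha]

lemma oscC_eq_cosh (ha : a < 0) (x : ℝ) : oscC a x = Real.cosh (√(-a) * x) := by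
  simp [oscC, not_le.2 ha]

lemma oscS_nonneg (ha : a < 0) {x : ℝ} (hx : 0 ≤ x) : 0 ≤ oscS a x := by
  rw [oscS_eq_sinh ha]
  have : 0 ≤ Real.sinh (√(-a) * x) := Real.sinh_nonneg_iff.2 (by positivity)
  positivity

lemma oscS_mono (ha : a < 0) {x y : ℝ} (hxy : x ≤ y) : oscS a x ≤ oscS a y := by
  rw [oscS_eq_sinh ha, oscS_eq_sinh ha]
  gcongr
  exact Real.sinh_le_sinh.2 (by gcongr)

lemma sqrt_mul_oscS_le (ha : a < 0) (x : ℝ) : √(-a) * oscS a x ≤ oscC a x := by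
  have hs : √(-a) ≠ 0 := (Real.sqrt_pos.2 (by linarith)).ne'
  rw [oscS_eq_sinh ha, oscC_eq_cosh ha, mul_div_cancel₀ _ hs]
  exact (Real.sinh_lt_cosh _).le

lemma one_le_oscS (ha : a < 0) : 1 ≤ oscS a 1 := by
  have hs : 0 < √(-a) := Real.sqrt_pos.2 (by linarith)
  rw [oscS_eq_sinh ha, mul_one, one_le_div hs]
  exact Real.self_le_sinh_iff.2 hs.le

/-- By the mean value theorem S(1) = C(c) for some c in (0,1), and cosh is increasing. -/
lemma oscS_le_oscC (ha : a < 0) : oscS a 1 ≤ oscC a 1 := by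
  obtain ⟨c, hc, h⟩ := exists_hasDerivAt_eq_slope (oscS a) (oscC a) zero_lt_one
    (continuous_oscS a).continuousOn fun x _ => hasDerivAt_oscS a x
  simp only [oscS_zero, sub_zero, div_one] at h
  rw [← h, oscC_eq_cosh ha, oscC_eq_cosh ha, Real.cosh_le_cosh, abs_of_nonneg, abs_of_nonneg]
  · have := hc.2; gcongr
  · positivity
  · have := hc.1; positivity

end hyperbolic

/-! ### Integrals over (0,1), and bounds of J = ∫S². -/

/-- `∫₀¹ S²`. -/
noncomputable def oscJ (a : ℝ) : ℝ := ∫ x in Set.Ioo (0 : ℝ) 1, oscS a x ^ 2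

lemma setIntegral_Ioo_eq {E : Type*} [NormedAddCommGroup E] [NormedSpace ℝ E] (f : ℝ → E) :
    ∫ x in Set.Ioo (0 : ℝ) 1, f x = ∫ x in (0 : ℝ)..1, f x := by
  rw [intervalIntegral.integral_of_le zero_le_one, integral_Ioc_eq_integral_Ioo]

lemma integrableOn_Ioo_of_continuous {E : Type*} [NormedAddCommGroup E] {f : ℝ → E}
    (hf : Continuous f) : IntegrableOn f (Set.Ioo (0 : ℝ) 1) :=
  (hf.integrableOn_Icc (a := 0) (b := 1)).mono_set Set.Ioo_subset_Icc_self

lemma setIntegral_Ioo_deriv_eq {f f' : ℝ → ℝ} (h : ∀ x, HasDerivAt f (f' x) x)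
    (hc : Continuous f') : ∫ x in Set.Ioo (0 : ℝ) 1, f' x = f 1 - f 0 := by
  rw [setIntegral_Ioo_eq]
  exact intervalIntegral.integral_eq_sub_of_hasDerivAt (fun x _ => h x) (hc.intervalIntegrable _ _)

lemma oscJ_nonneg (a : ℝ) : 0 ≤ oscJ a := integral_nonneg fun _ => sq_nonneg _

lemma setIntegral_Ioo_mono {f g : ℝ → ℝ} (hf : Continuous f) (hg : Continuous g)
    (h : ∀ x, 0 < x → x < 1 → f x ≤ g x) :
    ∫ x in Set.Ioo (0 : ℝ) 1, f x ≤ ∫ x in Set.Ioo (0 : ℝ) 1, g x :=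
  setIntegral_mono_on (integrableOn_Ioo_of_continuous hf) (integrableOn_Ioo_of_continuous hg)
    measurableSet_Ioo fun x hx => h x hx.1 hx.2

lemma setIntegral_Ioo_const (c : ℝ) : ∫ _x in Set.Ioo (0 : ℝ) 1, c = c := by
  simp

lemma oscJ_le_one {a : ℝ} (ha : 0 ≤ a) : oscJ a ≤ 1 := by
  calc oscJ a ≤ ∫ _ in Set.Ioo (0 : ℝ) 1, (1 : ℝ) :=
        setIntegral_Ioo_mono ((continuous_oscS a).pow 2) continuous_const
          fun x h0 h1 => oscS_sq_le_one ha h0.le h1.le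
    _ = 1 := setIntegral_Ioo_const 1

lemma oscJ_le_sq {a : ℝ} (ha : a < 0) : oscJ a ≤ oscS a 1 ^ 2 := by
  calc oscJ a ≤ ∫ _ in Set.Ioo (0 : ℝ) 1, oscS a 1 ^ 2 :=
        setIntegral_Ioo_mono ((continuous_oscS a).pow 2) continuous_const
          fun x h0 h1 => pow_le_pow_left₀ (oscS_nonneg ha h0.le) (oscS_mono ha h1.le) 2
    _ = _ := setIntegral_Ioo_const _

lemma oscS_sq_eq (a : ℝ) :
    oscS a 1 ^ 2 = ∫ x in Set.Ioo (0 : ℝ) 1, 2 * oscS a x * oscC a x := by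
  rw [setIntegral_Ioo_deriv_eq (f := fun x => oscS a x ^ 2)]
  · simp
  · intro x
    simpa using (hasDerivAt_oscS a x).fun_pow 2
  · exact (continuous_const.mul (continuous_oscS a)).mul (continuous_oscC a)

/-- S(1)² = ∫ 2SC and C ≥ √(-a) S. Compared with `oscJ_le_sq` this gains a factor √(-a), which for m
large against k is comparable to m; the Dirichlet bound needs this gain. -/
lemma sqrt_mul_oscJ_le {a : ℝ} (ha : a < 0) : 2 * √(-a) * oscJ a ≤ oscS a 1 ^ 2 := by
  rw [oscS_sq_eq, oscJ, ← integral_const_mul]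
  refine setIntegral_Ioo_mono (continuous_const.mul ((continuous_oscS a).pow 2))
    ((continuous_const.mul (continuous_oscS a)).mul (continuous_oscC a)) fun x h0 _ => ?_
  have h1 := sqrt_mul_oscS_le ha x
  have h2 := oscS_nonneg ha h0.le
  nlinarith

lemma integral_add_mul_oscS_sq (a p q : ℝ) :
    ∫ x in Set.Ioo (0 : ℝ) 1, (p + q * oscS a x ^ 2) = p + q * oscJ a := by
  have hc : Continuous fun x => q * oscS a x ^ 2 := continuous_const.mul ((continuous_oscS a).pow 2)
  rw [integral_add (integrableOn_Ioo_of_continuous continuous_const)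
    (integrableOn_Ioo_of_continuous hc), integral_const_mul, setIntegral_Ioo_const, oscJ]

/-- From (SC)' = C² - aS² = 1 - 2aS². -/
lemma oscJ_eq (a : ℝ) : 2 * a * oscJ a = 1 - oscS a 1 * oscC a 1 := by
  have h1 : ∫ x in Set.Ioo (0 : ℝ) 1, (1 - 2 * a * oscS a x ^ 2) = oscS a 1 * oscC a 1 := by
    rw [setIntegral_Ioo_deriv_eq (f := fun x => oscS a x * oscC a x)]
    · simp
    · intro x
      refine ((hasDerivAt_oscS a x).fun_mul (hasDerivAt_oscC a x)).congr_deriv ?_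
      linear_combination oscC_sq_add a x
    · exact continuous_const.sub (continuous_const.mul ((continuous_oscS a).pow 2))
  have h2 := integral_add_mul_oscS_sq a 1 (-(2 * a))
  simp only [neg_mul, ← sub_eq_add_neg] at h2
  linarith

/-- `S(1)² ≤ 1 + (1 + m²) J` for `a = k² - m²`. -/
lemma oscS_one_sq_le (k m : ℝ) :
    oscS (k ^ 2 - m ^ 2) 1 ^ 2 ≤
      1 + (1 + m ^ 2) * oscJ (k ^ 2 - m ^ 2) := by
  set a := k ^ 2 - m ^ 2
  have hc : Continuous fun x => (1 + m ^ 2) * oscS a x ^ 2 :=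
    continuous_const.mul ((continuous_oscS a).pow 2)
  have h : 1 + (1 + m ^ 2) * oscJ a =
      ∫ x in Set.Ioo (0 : ℝ) 1, (1 + (1 + m ^ 2) * oscS a x ^ 2) :=
    (integral_add_mul_oscS_sq _ _ _).symm
  rw [h, oscS_sq_eq]
  refine setIntegral_Ioo_mono ((continuous_const.mul (continuous_oscS a)).mul (continuous_oscC a))
    (continuous_const.add hc) fun x _ _ => ?_
  have h1 := oscC_sq_add a x
  have h2 : a * oscS a x ^ 2 = k ^ 2 * oscS a x ^ 2 - m ^ 2 * oscS a x ^ 2 := by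
    simp only [a]; ring
  nlinarith [sq_nonneg (oscS a x - oscC a x), mul_nonneg (sq_nonneg k) (sq_nonneg (oscS a x))]

/-! ### The impedance mode `C - i k S` -/

/-- The solution `E` of `E'' + a E = 0` with `E 0 = 1`, `E' 0 = -i k`. -/
noncomputable def osc (k a : ℝ) (x : ℝ) : ℂ := oscC a x - Complex.I * k * oscS a x

/-- The derivative of `osc k a`. -/
noncomputable def oscD (k a : ℝ) (x : ℝ) : ℂ := -(a * oscS a x : ℝ) - Complex.I * k * oscC a x

lemma contDiff_ofReal_comp {f : ℝ → ℝ} (hf : ContDiff ℝ ∞ f) :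
    ContDiff ℝ ∞ fun x => (f x : ℂ) := Complex.ofRealCLM.contDiff.comp hf

lemma contDiff_osc (k a : ℝ) : ContDiff ℝ ∞ (osc k a) :=
  (contDiff_ofReal_comp (contDiff_oscC a)).sub
    (contDiff_const.mul (contDiff_ofReal_comp (contDiff_oscS a)))

lemma hasDerivAt_osc (k a x : ℝ) : HasDerivAt (osc k a) (oscD k a x) x := by
  have h1 := (hasDerivAt_oscC a x).ofReal_comp
  have h2 := ((hasDerivAt_oscS a x).ofReal_comp).const_mul (Complex.I * k)
  refine (h1.fun_sub h2).congr_deriv ?_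
  simp [oscD]

lemma hasDerivAt_oscD (k a x : ℝ) : HasDerivAt (oscD k a) (-a * osc k a x) x := by
  have h1 := (((hasDerivAt_oscS a x).const_mul a).ofReal_comp).fun_neg
  have h2 := ((hasDerivAt_oscC a x).ofReal_comp).const_mul (Complex.I * k)
  refine (h1.fun_sub h2).congr_deriv ?_
  simp only [osc]; push_cast; ring

lemma osc_zero (k a : ℝ) : osc k a 0 = 1 := by simp [osc]

lemma oscD_zero (k a : ℝ) : oscD k a 0 = -(Complex.I * k) := by simp [oscD]

lemma norm_sq_sub_I_mul (p q : ℝ) : ‖(p : ℂ) - Complex.I * q‖ ^ 2 = p ^ 2 + q ^ 2 := by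
  rw [← Complex.normSq_eq_norm_sq, Complex.normSq_apply]; simp; ring

lemma norm_osc_sq (k a x : ℝ) : ‖osc k a x‖ ^ 2 = oscC a x ^ 2 + k ^ 2 * oscS a x ^ 2 := by
  have : osc k a x = (oscC a x : ℂ) - Complex.I * (k * oscS a x : ℝ) := by simp [osc]; ring
  rw [this, norm_sq_sub_I_mul]; ring

lemma norm_oscD_sq (k a x : ℝ) :
    ‖oscD k a x‖ ^ 2 = a ^ 2 * oscS a x ^ 2 + k ^ 2 * oscC a x ^ 2 := by
  have : oscD k a x = ((-(a * oscS a x) : ℝ) : ℂ) - Complex.I * (k * oscC a x : ℝ) := by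
    simp [oscD]; ring
  rw [this, norm_sq_sub_I_mul]; ring

lemma integral_norm_osc_sq (k a : ℝ) :
    ∫ x in Set.Ioo (0 : ℝ) 1, ‖osc k a x‖ ^ 2 = 1 + (k ^ 2 - a) * oscJ a := by
  have : ∀ x, ‖osc k a x‖ ^ 2 = 1 + (k ^ 2 - a) * oscS a x ^ 2 := fun x => by
    rw [norm_osc_sq]; linear_combination oscC_sq_add a x
  simp_rw [this]
  exact integral_add_mul_oscS_sq _ _ _

lemma integral_norm_oscD_sq (k a : ℝ) :
    ∫ x in Set.Ioo (0 : ℝ) 1, ‖oscD k a x‖ ^ 2 = k ^ 2 + (a ^ 2 - k ^ 2 * a) * oscJ a := by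
  have : ∀ x, ‖oscD k a x‖ ^ 2 = k ^ 2 + (a ^ 2 - k ^ 2 * a) * oscS a x ^ 2 := fun x => by
    rw [norm_oscD_sq]; linear_combination k ^ 2 * oscC_sq_add a x
  simp_rw [this]
  exact integral_add_mul_oscS_sq _ _ _

/-- The energy `∫ |E'|² + (m² + k²) |E|²` of the mode of vertical frequency `m`. -/
noncomputable def modeEnergy (k m : ℝ) : ℝ :=
  2 * k ^ 2 + m ^ 2 + 2 * m ^ 4 * oscJ (k ^ 2 - m ^ 2)

lemma modeEnergy_eq (k m : ℝ) :
    modeEnergy k m = (∫ x in Set.Ioo (0 : ℝ) 1, ‖oscD k (k ^ 2 - m ^ 2) x‖ ^ 2) +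
      (m ^ 2 + k ^ 2) * ∫ x in Set.Ioo (0 : ℝ) 1, ‖osc k (k ^ 2 - m ^ 2) x‖ ^ 2 := by
  rw [integral_norm_osc_sq, integral_norm_oscD_sq, modeEnergy]; ring

lemma two_mul_sq_le_modeEnergy (k m : ℝ) : 2 * k ^ 2 ≤ modeEnergy k m := by
  have := oscJ_nonneg (k ^ 2 - m ^ 2)
  rw [modeEnergy]
  have : 0 ≤ 2 * m ^ 4 * oscJ (k ^ 2 - m ^ 2) := by positivity
  nlinarith [sq_nonneg m]

/-- Makes the right traces of the modes square summable once their energies are summable. With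
|E(1)|² = 1 + m²S(1)², the term m²(1 + m²)J is absorbed by 2m⁴J because m² ≤ m⁴. -/
lemma norm_osc_one_sq_le {k m : ℝ} (hm : m = 0 ∨ 1 ≤ m) :
    ‖osc k (k ^ 2 - m ^ 2) 1‖ ^ 2 ≤ 1 + modeEnergy k m := by
  have h : ‖osc k (k ^ 2 - m ^ 2) 1‖ ^ 2 = 1 + m ^ 2 * oscS (k ^ 2 - m ^ 2) 1 ^ 2 := by
    rw [norm_osc_sq]; linear_combination oscC_sq_add (k ^ 2 - m ^ 2) 1
  rw [h]
  have hJ := oscJ_nonneg (k ^ 2 - m ^ 2)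
  rcases hm with rfl | hm
  · have := two_mul_sq_le_modeEnergy k 0
    nlinarith [sq_nonneg k]
  · have h1 := oscS_one_sq_le k m
    have h2 : m ^ 2 ≤ m ^ 4 := pow_le_pow_right₀ hm (by norm_num)
    have h3 := mul_le_mul_of_nonneg_left h1 (sq_nonneg m)
    have h4 := mul_le_mul_of_nonneg_right h2 hJ
    rw [modeEnergy]
    nlinarith [sq_nonneg k]

/-! ### The boundary operators at the right end -/

/-- The coefficient of the normal derivative in a boundary operator. -/
def bcP : BC → ℂ
  | BC.dirichlet => 0
  | _ => 1

/-- The coefficient of the function in a boundary operator. -/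
noncomputable def bcQ (k : ℝ) : BC → ℂ
  | BC.dirichlet => 1
  | BC.neumann => 0
  | BC.impedance => -(Complex.I * k)

/-- The boundary operator at the right end, applied to the mode of vertical frequency `m`. -/
noncomputable def modeBC (k : ℝ) (B : BC) (m : ℝ) : ℂ :=
  bcP B * oscD k (k ^ 2 - m ^ 2) 1 + bcQ k B * osc k (k ^ 2 - m ^ 2) 1

/-- D = -(2k² - m²)S - 2ikC at x = 1. After eliminating C² the two terms cannot cancel: |D| ≥ 2k for
every m. -/
lemma norm_modeBC_impedance (k m : ℝ) : ‖modeBC k BC.impedance m‖ ^ 2 =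
    m ^ 4 * oscS (k ^ 2 - m ^ 2) 1 ^ 2 + 4 * k ^ 2 := by
  have h : modeBC k BC.impedance m =
      ((-((2 * k ^ 2 - m ^ 2) * oscS (k ^ 2 - m ^ 2) 1) : ℝ) : ℂ) -
        Complex.I * ((2 * k * oscC (k ^ 2 - m ^ 2) 1 : ℝ) : ℂ) := by
    simp only [modeBC, bcP, bcQ, osc, oscD]
    push_cast
    linear_combination (k : ℂ) ^ 2 * oscS (k ^ 2 - m ^ 2) 1 * Complex.I_sq
  rw [h, norm_sq_sub_I_mul]
  linear_combination 4 * k ^ 2 * oscC_sq_add (k ^ 2 - m ^ 2) 1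

/-- For a > 0 the two terms compete: at C(1) = 0 one has aS(1)² = 1, and the value drops to k² - m²
= a. This near-resonance costs a power of k. -/
lemma norm_modeBC_neumann (k m : ℝ) : ‖modeBC k BC.neumann m‖ ^ 2 =
    k ^ 2 - (k ^ 2 - m ^ 2) * m ^ 2 * oscS (k ^ 2 - m ^ 2) 1 ^ 2 := by
  simp only [modeBC, bcP, bcQ, one_mul, zero_mul, add_zero]
  rw [norm_oscD_sq]
  linear_combination k ^ 2 * oscC_sq_add (k ^ 2 - m ^ 2) 1

lemma norm_modeBC_dirichlet (k m : ℝ) : ‖modeBC k BC.dirichlet m‖ ^ 2 =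
    1 + m ^ 2 * oscS (k ^ 2 - m ^ 2) 1 ^ 2 := by
  simp only [modeBC, bcP, bcQ, one_mul, zero_mul, zero_add]
  rw [norm_osc_sq]
  linear_combination oscC_sq_add (k ^ 2 - m ^ 2) 1

/-! ### The mode energy against the boundary value. -/

lemma max_sq_one_pow (k : ℝ) : k ^ 4 ≤ max (k ^ 2) 1 ^ 2 := by
  have := le_max_left (k ^ 2) 1
  nlinarith [sq_nonneg k]

/-- For a ≥ 0, m⁴J ≤ k⁴ is paid by the factor max{k,1}² times the term 4k². For a < 0, J ≤ S(1)² and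
S(1) ≥ 1 bound m² and m⁴J by the term m⁴S(1)². -/
lemma modeEnergy_le_impedance {k m : ℝ} (hk : 0 < k) (hm : m = 0 ∨ 3 / 2 ≤ m) :
    modeEnergy k m ≤ 6 * max k 1 ^ 2 * ‖modeBC k BC.impedance m‖ ^ 2 := by
  rw [norm_modeBC_impedance, modeEnergy]
  set a := k ^ 2 - m ^ 2 with ha
  have hM1 : 1 ≤ max k 1 ^ 2 := one_le_pow₀ (le_max_right _ _)
  have hMk : k ^ 2 ≤ max k 1 ^ 2 := pow_le_pow_left₀ hk.le (le_max_left _ _) 2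
  generalize max k 1 ^ 2 = M at hM1 hMk
  have hm0 : 0 ≤ m := by rcases hm with rfl | h <;> linarith
  have hmS : 0 ≤ m ^ 4 * oscS a 1 ^ 2 := by positivity
  have h4 : 0 ≤ m ^ 4 := by positivity
  have hk2 : 0 < k ^ 2 := by positivity
  rcases le_or_gt 0 a with h | h
  · have hJ := oscJ_le_one h
    have hmk : m ^ 2 ≤ k ^ 2 := by linarith
    have h1 : m ^ 4 * oscJ a ≤ m ^ 4 := mul_le_of_le_one_right h4 hJ
    have h2 : m ^ 4 ≤ k ^ 2 * k ^ 2 := by nlinarith [sq_nonneg m]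
    have h3 : k ^ 2 * k ^ 2 ≤ M * k ^ 2 := by nlinarith
    have h5 : k ^ 2 ≤ M * k ^ 2 := by nlinarith
    nlinarith [mul_nonneg (zero_le_one.trans hM1) hmS]
  · have hm1 : 3 / 2 ≤ m := by
      rcases hm with rfl | h'
      · nlinarith
      · exact h'
    have hJ := oscJ_le_sq h
    have h1 : m ^ 4 * oscJ a ≤ m ^ 4 * oscS a 1 ^ 2 := by gcongr
    have hS : 1 ≤ oscS a 1 ^ 2 := one_le_pow₀ (one_le_oscS h)
    have h2 : m ^ 2 ≤ m ^ 4 := pow_le_pow_right₀ (by linarith) (by norm_num)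
    have h3 : m ^ 4 ≤ m ^ 4 * oscS a 1 ^ 2 := le_mul_of_one_le_right h4 hS
    nlinarith [mul_nonneg (sub_nonneg.2 hM1) hmS, mul_nonneg (sub_nonneg.2 hM1) hk2.le]

/-- For a ≥ 0 the energy is of order k⁴ + k² and |D| ≥ 1. For a < 0 the term m⁴J is absorbed either
by the weight max{k,1}·m or by max{k²,1}², depending on how far m lies above k. -/
lemma modeEnergy_le_dirichlet {k m : ℝ} (hm : m = 0 ∨ 3 / 2 ≤ m) :
    modeEnergy k m ≤
      7 * (max (k ^ 2) 1 ^ 2 + max k 1 * m) * ‖modeBC k BC.dirichlet m‖ ^ 2 := by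
  rw [norm_modeBC_dirichlet, modeEnergy]
  set a := k ^ 2 - m ^ 2 with ha
  have hM1 : 1 ≤ max (k ^ 2) 1 ^ 2 := one_le_pow₀ (le_max_right _ _)
  have hM4 : k ^ 4 ≤ max (k ^ 2) 1 ^ 2 := max_sq_one_pow k
  have hMk : k ^ 2 ≤ max (k ^ 2) 1 ^ 2 :=
    (le_max_left _ _).trans (le_self_pow₀ (le_max_right _ _) two_ne_zero)
  have hl : 1 ≤ max k 1 := le_max_right _ _
  generalize max (k ^ 2) 1 ^ 2 = M at hM1 hMk hM4
  generalize max k 1 = l at hl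
  have hm0 : 0 ≤ m := by rcases hm with rfl | h <;> linarith
  have h4 : 0 ≤ m ^ 4 := by positivity
  have hmS : 0 ≤ m ^ 2 * oscS a 1 ^ 2 := by positivity
  have hlm : m ≤ l * m := le_mul_of_one_le_left hm0 hl
  rcases le_or_gt 0 a with h | h
  · have hJ := oscJ_le_one h
    have hmk : m ^ 2 ≤ k ^ 2 := by linarith
    have h1 : m ^ 4 * oscJ a ≤ m ^ 4 := mul_le_of_le_one_right h4 hJ
    have h2 : m ^ 4 ≤ k ^ 4 := by nlinarith [sq_nonneg m, sq_nonneg k]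
    have h3 : M ≤ (M + l * m) * (1 + m ^ 2 * oscS a 1 ^ 2) := by
      have : 0 ≤ l * m := by positivity
      nlinarith
    nlinarith
  · have hm1 : 3 / 2 ≤ m := by
      rcases hm with rfl | h'
      · nlinarith
      · exact h'
    have hJ := oscJ_le_sq h
    have hJ2 := sqrt_mul_oscJ_le h
    have hJ0 := oscJ_nonneg a
    have hS : 1 ≤ oscS a 1 ^ 2 := one_le_pow₀ (one_le_oscS h)
    have hsq : √(-a) ^ 2 = m ^ 2 - k ^ 2 := by rw [Real.sq_sqrt (by linarith)]; linarith
    have hs0 := Real.sqrt_nonneg (-a)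
    generalize √(-a) = α at hsq hs0 hJ2
    generalize oscJ a = J at hJ hJ2 hJ0 ⊢
    generalize oscS a 1 ^ 2 = s at hS hJ hJ2 hmS ⊢
    have e1 : m ^ 2 ≤ m * (m ^ 2 * s) := by
      have : m ^ 2 ≤ m ^ 2 * s := le_mul_of_one_le_right (sq_nonneg m) hS
      nlinarith
    have e2 : m * (m ^ 2 * s) ≤ l * m * (m ^ 2 * s) := by gcongr
    have e3 : (M + l * m) * (1 + m ^ 2 * s) =
      M + l * m + M * (m ^ 2 * s) + l * m * (m ^ 2 * s) := by ring
    have e4 : 0 ≤ M * (m ^ 2 * s) := by positivity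
    have e5 : 0 ≤ l * m := by positivity
    -- If √(-a) ≥ m/2, the integral bound 2√(-a) J ≤ S(1)² gives mJ ≤ S(1)². Otherwise m² - k² <
    -- m²/4, so m² is at most (4/3)k² and the weight max{k²,1}² pays for it.
    rcases le_or_gt (m / 2) α with h' | h'
    · have e6 : m * J ≤ s := by nlinarith
      have e7 : m ^ 4 * J ≤ m * (m ^ 2 * s) := by
        calc m ^ 4 * J = m ^ 3 * (m * J) := by ring
          _ ≤ m ^ 3 * s := by gcongr
          _ = _ := by ring
      nlinarith
    · have e6 : 3 * m ^ 2 ≤ 4 * k ^ 2 := by nlinarith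
      have e7 : 3 * (m ^ 4 * J) ≤ 4 * (M * (m ^ 2 * s)) := by
        calc 3 * (m ^ 4 * J) = (3 * m ^ 2) * (m ^ 2 * J) := by ring
          _ ≤ (4 * M) * (m ^ 2 * s) :=
            mul_le_mul (by linarith) (mul_le_mul_of_nonneg_left hJ (sq_nonneg m)) (by positivity)
              (by linarith)
          _ = _ := by ring
      nlinarith

lemma modeEnergy_le_neumann {k m : ℝ} (hk : 0 < k) (hm : m = 0 ∨ 3 / 2 ≤ m) :
    modeEnergy k m ≤ 10 * max (k ^ 2) 1 ^ 2 * ‖modeBC k BC.neumann m‖ ^ 2 := by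
  rw [norm_modeBC_neumann, modeEnergy]
  set a := k ^ 2 - m ^ 2 with ha
  have hM1 : 1 ≤ max (k ^ 2) 1 ^ 2 := one_le_pow₀ (le_max_right _ _)
  have hM4 : k ^ 4 ≤ max (k ^ 2) 1 ^ 2 := max_sq_one_pow k
  have hMk : k ^ 2 ≤ max (k ^ 2) 1 ^ 2 :=
    (le_max_left _ _).trans (le_self_pow₀ (le_max_right _ _) two_ne_zero)
  generalize max (k ^ 2) 1 ^ 2 = M at hM1 hMk hM4
  have hm0 : 0 ≤ m := by rcases hm with rfl | h <;> linarith
  have hk2 : 0 < k ^ 2 := by positivity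
  rcases hm with rfl | hm
  · norm_num
    nlinarith
  have hm2 : 9 / 4 ≤ m ^ 2 := by nlinarith
  have hJ0 := oscJ_nonneg a
  have e0 : k ^ 4 = k ^ 2 * k ^ 2 := by ring
  have e0' : m ^ 4 = m ^ 2 * m ^ 2 := by ring
  rw [e0] at hM4
  rw [e0']
  rcases le_or_gt 0 a with h | h
  · have hJ := oscJ_le_one h
    have hS := oscS_sq_le_one h zero_le_one le_rfl
    have hC := oscC_sq_add a 1
    have hC0 := sq_nonneg (oscC a 1)
    generalize oscJ a = J at hJ hJ0 ⊢
    generalize oscC a 1 ^ 2 = c at hC hC0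
    have hS0 := sq_nonneg (oscS a 1)
    generalize oscS a 1 ^ 2 = s at hS hC hS0 ⊢
    have hmk : m ^ 2 ≤ k ^ 2 := by linarith
    generalize m ^ 2 = p at *
    generalize k ^ 2 = q at *
    -- Here q = k² and p = m² ≤ q. Since q ≥ 9/4, the lower order part 3q is at most (4/3)q².
    have hQ : 2 * q + p + 2 * (p * p) * J ≤ 10 / 3 * (q * q) := by
      have : p * p * J ≤ q * q := (mul_le_of_le_one_right (by positivity) hJ).trans (by nlinarith)
      nlinarith
    -- For a ≥ 1/2, aS² ≤ 1 leaves at least q - p = a. For a < 1/2, S² ≤ 1 leaves at least q/2,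
    -- which exceeds 1/2 because q ≥ 9/4.
    have hD : 1 / 2 ≤ q - a * p * s := by
      rcases le_or_gt (1 / 2) a with h' | h'
      · have : a * s * p ≤ 1 * p := by gcongr; linarith
        nlinarith
      · have : a * s * p ≤ 1 / 2 * p := by
          gcongr
          nlinarith
        nlinarith
    nlinarith
  · have hJ := oscJ_le_sq h
    have hS : 1 ≤ oscS a 1 ^ 2 := one_le_pow₀ (one_le_oscS h)
    have hSC : oscS a 1 ^ 2 ≤ oscC a 1 ^ 2 :=
      pow_le_pow_left₀ (oscS_nonneg h zero_le_one) (oscS_le_oscC h) 2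
    have hC := oscC_sq_add a 1
    generalize oscJ a = J at hJ hJ0 ⊢
    generalize oscC a 1 ^ 2 = c at hC hSC
    generalize oscS a 1 ^ 2 = s at hS hC hSC hJ ⊢
    obtain ⟨b, hb⟩ : ∃ b, b = -a := ⟨_, rfl⟩
    have hab : a = -b := by linarith
    rw [hab] at *
    generalize m ^ 2 = p at *
    generalize k ^ 2 = q at *
    have hb0 : 0 < b := by linarith
    have hp : p = q + b := by linarith
    have hJs : p * p * J ≤ p * p * s := by gcongr
    have hbps : 0 ≤ b * p * s := by positivity
    rcases le_or_gt (1 / 2) b with h' | h'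
    -- p = q + b with q ≤ M ≤ 2Mb. This turns 2p²s into 8Mbps, and b ≤ 2bps supplies the remaining 2
    -- of the constant 10.
    · have f1 : p ≤ 4 * M * b := by nlinarith
      have f2 : p * (p * s) ≤ 4 * M * b * (p * s) := by gcongr
      have f3 : b ≤ 2 * (b * p * s) := by
        have : b * (1 / 2) * 1 ≤ b * p * s := by gcongr; linarith
        linarith
      have f4 : b * p * s ≤ M * (b * p * s) := le_mul_of_one_le_left hbps hM1
      have f5 : q ≤ M * q := le_mul_of_one_le_left hk2.le hM1
      nlinarith
    -- Close to cut-off, S(1) ≤ C(1) and C(1)² = 1 + bS(1)² give (1 - b)S(1)² ≤ 1. Here k² and m²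
    -- are comparable, so the term k² of |D|² suffices.
    · have f1 : s ≤ 2 := by nlinarith
      have f2 : 7 / 4 ≤ q := by linarith
      have f3 : p ≤ 9 / 7 * q := by linarith
      have f4 : p * p * s ≤ (9 / 7 * q) * (9 / 7 * q) * 2 := by gcongr
      have f5 : q * q * q ≤ M * q := by gcongr
      have f6 : 7 / 4 * (q * q) ≤ q * (q * q) := by gcongr
      have f7 : 0 ≤ M * (b * p * s) := by positivity
      nlinarith

/-- The energy is at least 2k² > 0 and is bounded by a multiple of |D|². -/
lemma modeBC_ne_zero {k m : ℝ} (hk : 0 < k) (hm : m = 0 ∨ 3 / 2 ≤ m) (B : BC) :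
    modeBC k B m ≠ 0 := by
  have hQ : 0 < modeEnergy k m := by
    have := two_mul_sq_le_modeEnergy k m
    have : 0 < k ^ 2 := by positivity
    linarith
  intro h
  cases B
  · have := modeEnergy_le_dirichlet (k := k) hm
    simp [h] at this; linarith
  · have := modeEnergy_le_neumann hk hm
    simp [h] at this; linarith
  · have := modeEnergy_le_impedance hk hm
    simp [h] at this; linarith

/-! ### The inhomogeneous problem in one variable -/

lemma exists_contDiff_primitive {f : ℝ → ℝ} (hf : ContDiff ℝ ∞ f) :
    ∃ F : ℝ → ℝ, ContDiff ℝ ∞ F ∧ F 0 = 0 ∧ ∀ x, HasDerivAt F (f x) x := by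
  have h : ∀ x, HasDerivAt (fun x => ∫ t in (0 : ℝ)..x, f t) (f x) x := fun x =>
    intervalIntegral.integral_hasDerivAt_right (hf.continuous.intervalIntegrable _ _)
      hf.continuous.aestronglyMeasurable.stronglyMeasurableAtFilter hf.continuous.continuousAt
  refine ⟨_, contDiff_infty_iff_deriv.2 ⟨fun x => (h x).differentiableAt, ?_⟩, by simp, h⟩
  rwa [funext fun x => (h x).deriv]

/-- Variation of constants: P = S∫Cw - C∫Sw, with zero Cauchy data at 0. -/
lemma exists_osc_inhomogeneous (a : ℝ) {w : ℝ → ℝ} (hw : ContDiff ℝ ∞ w) :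
    ∃ P P' : ℝ → ℝ, ContDiff ℝ ∞ P ∧ P 0 = 0 ∧ P' 0 = 0 ∧ (∀ x, HasDerivAt P (P' x) x) ∧
      ∀ x, HasDerivAt P' (w x - a * P x) x := by
  obtain ⟨F, hF, hF0, hF'⟩ := exists_contDiff_primitive ((contDiff_oscC a).mul hw)
  obtain ⟨G, hG, hG0, hG'⟩ := exists_contDiff_primitive ((contDiff_oscS a).mul hw)
  refine ⟨fun x => oscS a x * F x - oscC a x * G x,
    fun x => oscC a x * F x + a * oscS a x * G x,
    ((contDiff_oscS a).mul hF).sub ((contDiff_oscC a).mul hG), by simp [hG0], by simp [hF0],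
    fun x => ?_, fun x => ?_⟩
  · refine (((hasDerivAt_oscS a x).fun_mul (hF' x)).fun_sub
      ((hasDerivAt_oscC a x).fun_mul (hG' x))).congr_deriv ?_
    ring
  · refine (((hasDerivAt_oscC a x).fun_mul (hF' x)).fun_add
      (((hasDerivAt_oscS a x).const_mul a).fun_mul (hG' x))).congr_deriv ?_
    linear_combination w x * oscC_sq_add a x

/-- A multiple of E is added to the solution with zero Cauchy data: E preserves the left condition,
and D ≠ 0 allows the right one to be corrected. -/
lemma exists_mode_inhomogeneous {k m : ℝ} (hk : 0 < k) (hm : m = 0 ∨ 3 / 2 ≤ m) (B : BC)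
    {w : ℝ → ℝ} (hw : ContDiff ℝ ∞ w) :
    ∃ z z' : ℝ → ℂ, ContDiff ℝ ∞ z ∧ (∀ x, HasDerivAt z (z' x) x) ∧
      (∀ x, HasDerivAt z' (w x - (k ^ 2 - m ^ 2) * z x) x) ∧ z' 0 = -(Complex.I * k) * z 0 ∧
      bcP B * z' 1 + bcQ k B * z 1 = 0 := by
  obtain ⟨P, P', hP, hP0, hP0', hd, hd'⟩ := exists_osc_inhomogeneous (k ^ 2 - m ^ 2) hw
  have hD := modeBC_ne_zero hk hm B
  set c : ℂ := -(bcP B * P' 1 + bcQ k B * P 1) / modeBC k B m with hc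
  refine ⟨fun x => P x + c * osc k (k ^ 2 - m ^ 2) x, fun x => P' x + c * oscD k (k ^ 2 - m ^ 2) x,
    (contDiff_ofReal_comp hP).add (contDiff_const.mul (contDiff_osc _ _)),
    fun x => (hd x).ofReal_comp.fun_add ((hasDerivAt_osc _ _ x).const_mul c), fun x => ?_, ?_, ?_⟩
  · refine ((hd' x).ofReal_comp.fun_add ((hasDerivAt_oscD _ _ x).const_mul c)).congr_deriv ?_
    push_cast; ring
  · simp only [hP0, hP0', osc_zero, oscD_zero]; push_cast; ring
  · have h1 : c * modeBC k B m = -(bcP B * P' 1 + bcQ k B * P 1) := by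
      rw [hc, div_mul_cancel₀ _ hD]
    rw [modeBC] at h1
    linear_combination h1

/-! ### The vertical eigenfunctions -/

/-- `Y` is a vertical mode of frequency `m`, with derivative `Y'`: `Y'' = -m² Y`, with the Dirichlet
condition or the Neumann condition at `0` and `1`. -/
structure IsVerticalMode (B₁ B₃ : BC) (m : ℝ) (Y Y' : ℝ → ℝ) : Prop where
  contDiff : ContDiff ℝ ∞ Y
  contDiff_deriv : ContDiff ℝ ∞ Y'
  hasDerivAt : ∀ y, HasDerivAt Y (Y' y) y
  hasDerivAt_deriv : ∀ y, HasDerivAt Y' (-m ^ 2 * Y y) y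
  bottom_dirichlet : B₁ = BC.dirichlet → Y 0 = 0
  bottom_neumann : B₁ ≠ BC.dirichlet → Y' 0 = 0
  top_dirichlet : B₃ = BC.dirichlet → Y 1 = 0
  top_neumann : B₃ ≠ BC.dirichlet → Y' 1 = 0

section

variable {B₁ B₃ : BC} {m l : ℝ} {Y Y' Z Z' : ℝ → ℝ}

lemma IsVerticalMode.mul_zero (hY : IsVerticalMode B₁ B₃ m Y Y') (hZ : IsVerticalMode B₁ B₃ l Z Z') :
    Y 0 * Z' 0 = 0 := by
  by_cases h : B₁ = BC.dirichlet
  · rw [hY.bottom_dirichlet h, zero_mul]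
  · rw [hZ.bottom_neumann h, MulZeroClass.mul_zero]

lemma IsVerticalMode.mul_one (hY : IsVerticalMode B₁ B₃ m Y Y') (hZ : IsVerticalMode B₁ B₃ l Z Z') :
    Y 1 * Z' 1 = 0 := by
  by_cases h : B₃ = BC.dirichlet
  · rw [hY.top_dirichlet h, zero_mul]
  · rw [hZ.top_neumann h, MulZeroClass.mul_zero]

/-- Integration by parts of (YZ')'. At each end Y or Z' vanishes, since both modes obey the same
kind of condition. -/
lemma IsVerticalMode.integral_deriv_mul (hY : IsVerticalMode B₁ B₃ m Y Y')
    (hZ : IsVerticalMode B₁ B₃ l Z Z') :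
    ∫ y in Set.Ioo (0 : ℝ) 1, Y' y * Z' y = l ^ 2 * ∫ y in Set.Ioo (0 : ℝ) 1, Y y * Z y := by
  have h1 := hY.contDiff.continuous
  have h2 := hZ.contDiff.continuous
  have h3 := hY.contDiff_deriv.continuous
  have h4 := hZ.contDiff_deriv.continuous
  have h : ∫ y in Set.Ioo (0 : ℝ) 1, (Y' y * Z' y - l ^ 2 * (Y y * Z y)) = 0 := by
    rw [setIntegral_Ioo_deriv_eq (f := fun y => Y y * Z' y), hY.mul_one hZ, hY.mul_zero hZ, sub_zero]
    · intro y
      refine ((hY.hasDerivAt y).fun_mul (hZ.hasDerivAt_deriv y)).congr_deriv (by ring)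
    · fun_prop
  rw [integral_sub (integrableOn_Ioo_of_continuous (by fun_prop))
    (integrableOn_Ioo_of_continuous (by fun_prop)), integral_const_mul] at h
  linarith

/-- ∫Y'Z' equals l²∫YZ and, by symmetry, m²∫YZ. -/
lemma IsVerticalMode.integral_mul_eq_zero (hY : IsVerticalMode B₁ B₃ m Y Y')
    (hZ : IsVerticalMode B₁ B₃ l Z Z') (hml : m ^ 2 ≠ l ^ 2) :
    ∫ y in Set.Ioo (0 : ℝ) 1, Y y * Z y = 0 := by
  have h1 := hY.integral_deriv_mul hZ
  have h2 := hZ.integral_deriv_mul hY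
  simp only [mul_comm (Z' _), mul_comm (Z _)] at h2
  have h3 : (m ^ 2 - l ^ 2) * ∫ y in Set.Ioo (0 : ℝ) 1, Y y * Z y = 0 := by linarith
  exact (mul_eq_zero.1 h3).resolve_left (sub_ne_zero.2 hml)

end

/-- The two kinds of boundary conditions at the top and the bottom. -/
def IsDN (B : BC) : Prop := B = BC.dirichlet ∨ B = BC.neumann

lemma freq_nonneg (B₁ B₃ : BC) (n : ℕ) : 0 ≤ freq B₁ B₃ n := by
  rw [freq]; split_ifs <;> positivity

lemma mul_pi_le_freq (B₁ B₃ : BC) (n : ℕ) : n * Real.pi ≤ freq B₁ B₃ n := by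
  rw [freq]; split_ifs
  · exact le_rfl
  · nlinarith [Real.pi_pos]

lemma pi_le_freq (B₁ B₃ : BC) {n : ℕ} (hn : 1 ≤ n) : Real.pi ≤ freq B₁ B₃ n := by
  refine le_trans ?_ (mul_pi_le_freq B₁ B₃ n)
  have : (1 : ℝ) ≤ n := by exact_mod_cast hn
  nlinarith [Real.pi_pos]

lemma freq_eq_zero_or (B₁ B₃ : BC) (n : ℕ) : freq B₁ B₃ n = 0 ∨ 3 / 2 ≤ freq B₁ B₃ n := by
  have hpi := Real.pi_gt_three
  rcases Nat.eq_zero_or_pos n with rfl | hn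
  · rw [freq]; split_ifs
    · left; simp
    · right; push_cast; linarith
  · right; linarith [pi_le_freq B₁ B₃ hn]

lemma freq_sq_ne (B₁ B₃ : BC) {n p : ℕ} (h : n ≠ p) : freq B₁ B₃ n ^ 2 ≠ freq B₁ B₃ p ^ 2 := by
  intro h'
  have h1 := (pow_left_inj₀ (freq_nonneg B₁ B₃ n) (freq_nonneg B₁ B₃ p) two_ne_zero).1 h'
  apply h
  have hpi := Real.pi_ne_zero
  unfold freq at h1
  split_ifs at h1
  · exact_mod_cast mul_right_cancel₀ hpi h1
  · have := mul_right_cancel₀ hpi h1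
    exact_mod_cast (add_right_cancel this)

/-- The amplitude of the eigenfunctions. -/
noncomputable def amp (B₁ B₃ : BC) (n : ℕ) : ℝ :=
  if B₁ = BC.neumann ∧ B₃ = BC.neumann ∧ n = 0 then 1 else √2

lemma eigenfun_dirichlet {B₃ : BC} (h : IsDN B₃) (n : ℕ) :
    eigenfun BC.dirichlet B₃ n =
      fun y => amp BC.dirichlet B₃ n * Real.sin (freq BC.dirichlet B₃ n * y) := by
  rcases h with rfl | rfl <;> ext y <;> simp [eigenfun, freq, amp]

lemma eigenfun_neumann {B₃ : BC} (h : IsDN B₃) (n : ℕ) :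
    eigenfun BC.neumann B₃ n =
      fun y => amp BC.neumann B₃ n * Real.cos (freq BC.neumann B₃ n * y) := by
  rcases h with rfl | rfl <;> ext y <;> simp [eigenfun, freq, amp]
  split_ifs with h <;> simp [h]

/-- The derivative of the eigenfunction. -/
noncomputable def eigenfunD (B₁ B₃ : BC) (n : ℕ) : ℝ → ℝ := deriv (eigenfun B₁ B₃ n)

lemma hasDerivAt_sin_mul (A m y : ℝ) :
    HasDerivAt (fun y => A * Real.sin (m * y)) (A * m * Real.cos (m * y)) y := by
  have h : HasDerivAt (fun y : ℝ => m * y) m y := by simpa using (hasDerivAt_id' y).const_mul m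
  exact (h.sin.const_mul A).congr_deriv (by ring)

lemma hasDerivAt_cos_mul (A m y : ℝ) :
    HasDerivAt (fun y => A * Real.cos (m * y)) (-(A * m) * Real.sin (m * y)) y := by
  have h : HasDerivAt (fun y : ℝ => m * y) m y := by simpa using (hasDerivAt_id' y).const_mul m
  exact (h.cos.const_mul A).congr_deriv (by ring)

lemma cos_nat_add_half_mul_pi (n : ℕ) : Real.cos ((n + 1 / 2) * Real.pi) = 0 := by
  rw [Real.cos_eq_zero_iff]; exact ⟨n, by push_cast; ring⟩

lemma isVerticalMode_eigenfun {B₁ B₃ : BC} (h₁ : IsDN B₁) (h₃ : IsDN B₃) (n : ℕ) :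
    IsVerticalMode B₁ B₃ (freq B₁ B₃ n) (eigenfun B₁ B₃ n) (eigenfunD B₁ B₃ n) := by
  rcases h₁ with rfl | rfl
  · have h2 : eigenfunD BC.dirichlet B₃ n = fun y => amp BC.dirichlet B₃ n *
        freq BC.dirichlet B₃ n * Real.cos (freq BC.dirichlet B₃ n * y) := by
      rw [eigenfunD, eigenfun_dirichlet h₃]
      exact funext fun y => (hasDerivAt_sin_mul _ _ y).deriv
    rw [h2, eigenfun_dirichlet h₃]
    refine ⟨by fun_prop, by fun_prop, hasDerivAt_sin_mul _ _, fun y => ?_, by simp, by simp, ?_, ?_⟩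
    · exact (hasDerivAt_cos_mul _ _ y).congr_deriv (by ring)
    · rintro rfl; simp [freq]
    · intro h
      rw [mul_one, freq, if_neg (Ne.symm h), cos_nat_add_half_mul_pi, mul_zero]
  · have h2 : eigenfunD BC.neumann B₃ n = fun y => -(amp BC.neumann B₃ n *
        freq BC.neumann B₃ n) * Real.sin (freq BC.neumann B₃ n * y) := by
      rw [eigenfunD, eigenfun_neumann h₃]
      exact funext fun y => (hasDerivAt_cos_mul _ _ y).deriv
    rw [h2, eigenfun_neumann h₃]
    refine ⟨by fun_prop, by fun_prop, hasDerivAt_cos_mul _ _, fun y => ?_, by simp, by simp, ?_, ?_⟩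
    · exact (hasDerivAt_sin_mul _ _ y).congr_deriv (by ring)
    · rintro rfl
      rw [mul_one, freq, if_neg (by simp), cos_nat_add_half_mul_pi, mul_zero]
    · intro h
      obtain rfl : B₃ = BC.neumann := h₃.resolve_left h
      simp [freq]

lemma amp_sq_le_two (B₁ B₃ : BC) (n : ℕ) : amp B₁ B₃ n ^ 2 ≤ 2 := by
  rw [amp]; split_ifs <;> norm_num

lemma eigenfun_sq_add {B₁ B₃ : BC} (h₁ : IsDN B₁) (h₃ : IsDN B₃) (n : ℕ) (y : ℝ) :
    eigenfunD B₁ B₃ n y ^ 2 + freq B₁ B₃ n ^ 2 * eigenfun B₁ B₃ n y ^ 2 =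
      amp B₁ B₃ n ^ 2 * freq B₁ B₃ n ^ 2 := by
  have h := isVerticalMode_eigenfun h₁ h₃ n
  rw [← (h.hasDerivAt y).deriv]
  rcases h₁ with rfl | rfl
  · rw [eigenfun_dirichlet h₃, (hasDerivAt_sin_mul _ _ y).deriv]
    linear_combination amp BC.dirichlet B₃ n ^ 2 * freq BC.dirichlet B₃ n ^ 2 *
      Real.sin_sq_add_cos_sq (freq BC.dirichlet B₃ n * y)
  · rw [eigenfun_neumann h₃, (hasDerivAt_cos_mul _ _ y).deriv]
    linear_combination amp BC.neumann B₃ n ^ 2 * freq BC.neumann B₃ n ^ 2 *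
      Real.sin_sq_add_cos_sq (freq BC.neumann B₃ n * y)

lemma eigenfun_sq_le_two {B₁ B₃ : BC} (h₁ : IsDN B₁) (h₃ : IsDN B₃) (n : ℕ) (y : ℝ) :
    eigenfun B₁ B₃ n y ^ 2 ≤ 2 := by
  rcases h₁ with rfl | rfl
  · rw [eigenfun_dirichlet h₃, mul_pow]
    exact (mul_le_of_le_one_right (sq_nonneg _) (Real.sin_sq_le_one _)).trans (amp_sq_le_two _ _ _)
  · rw [eigenfun_neumann h₃, mul_pow]
    exact (mul_le_of_le_one_right (sq_nonneg _) (Real.cos_sq_le_one _)).trans (amp_sq_le_two _ _ _)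

/-- For positive frequency, Y'² + m²Y² is the constant 2m², and ∫Y'² = m²∫Y². The second alternative
covers the Dirichlet-Dirichlet case, where Y_0 = 0. -/
lemma integral_eigenfun_sq {B₁ B₃ : BC} (h₁ : IsDN B₁) (h₃ : IsDN B₃) (n : ℕ) :
    ∫ y in Set.Ioo (0 : ℝ) 1, eigenfun B₁ B₃ n y ^ 2 = 1 ∨
      (n = 0 ∧ eigenfun B₁ B₃ n = 0) := by
  have h := isVerticalMode_eigenfun h₁ h₃ n
  have hc1 := h.contDiff.continuous
  have hc2 := h.contDiff_deriv.continuous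
  rcases freq_eq_zero_or B₁ B₃ n with h0 | h0
  · have hn : n = 0 := by
      have := mul_pi_le_freq B₁ B₃ n
      rw [h0] at this
      have : (n : ℝ) ≤ 0 := by nlinarith [Real.pi_pos]
      exact_mod_cast le_antisymm this (Nat.cast_nonneg n)
    subst hn
    rcases h₁ with rfl | rfl
    · right; rw [eigenfun_dirichlet h₃, h0]; exact ⟨rfl, by ext; simp⟩
    · left
      rcases h₃ with rfl | rfl
      · have := Real.pi_ne_zero
        simp [freq] at h0
      · simp [eigenfun]
  · left
    have h1 := h.integral_deriv_mul h
    have h2 : ∫ y in Set.Ioo (0 : ℝ) 1, (eigenfunD B₁ B₃ n y ^ 2 +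
        freq B₁ B₃ n ^ 2 * eigenfun B₁ B₃ n y ^ 2) = amp B₁ B₃ n ^ 2 * freq B₁ B₃ n ^ 2 := by
      simp_rw [eigenfun_sq_add h₁ h₃]; exact setIntegral_Ioo_const _
    rw [integral_add (integrableOn_Ioo_of_continuous (by fun_prop))
      (integrableOn_Ioo_of_continuous (by fun_prop)), integral_const_mul] at h2
    simp_rw [← pow_two] at h1
    rw [h1] at h2
    have ha : amp B₁ B₃ n ^ 2 = 2 := by
      rw [amp, if_neg, Real.sq_sqrt (by norm_num)]
      rintro ⟨rfl, rfl, rfl⟩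
      simp [freq] at h0; linarith
    rw [ha] at h2
    have hf : freq B₁ B₃ n ^ 2 ≠ 0 := by positivity
    refine mul_left_cancel₀ (mul_ne_zero two_ne_zero hf) ?_
    linarith

/-! ### Completeness -/

/-- The span of the ψ_n is stable under multiplication by cos(πy), so orthogonality to the family
passes to its products with powers of cos(πy). -/
lemma integral_mul_cos_pow_eq_zero {f : ℝ → ℂ} (hf : IntegrableOn f (Set.Ioo (0 : ℝ) 1))
    {ψ : ℕ → ℝ → ℝ} (hψ : ∀ n, Continuous (ψ n))
    (hrec : ∀ n, ∃ (c d : ℝ) (i j : ℕ), ∀ y, Real.cos (Real.pi * y) * ψ n y =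
      c * ψ i y + d * ψ j y)
    (h0 : ∀ n, ∫ y in Set.Ioo (0 : ℝ) 1, f y * ψ n y = 0) (p n : ℕ) :
    ∫ y in Set.Ioo (0 : ℝ) 1, f y * ((ψ n y * Real.cos (Real.pi * y) ^ p : ℝ) : ℂ) = 0 := by
  induction p generalizing n with
  | zero => simpa using h0 n
  | succ p ih =>
    obtain ⟨c, d, i, j, h⟩ := hrec n
    have hint : ∀ n, IntegrableOn
        (fun y => f y * ((ψ n y * Real.cos (Real.pi * y) ^ p : ℝ) : ℂ)) (Set.Ioo (0 : ℝ) 1) := by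
      intro n
      have := hψ n
      exact (((integrableOn_Icc_iff_integrableOn_Ioo (a := (0 : ℝ)) (b := 1)).2 hf).mul_continuousOn
        (by fun_prop) isCompact_Icc).mono_set Set.Ioo_subset_Icc_self
    have : ∀ y, f y * ((ψ n y * Real.cos (Real.pi * y) ^ (p + 1) : ℝ) : ℂ) =
        c * (f y * ((ψ i y * Real.cos (Real.pi * y) ^ p : ℝ) : ℂ)) +
          d * (f y * ((ψ j y * Real.cos (Real.pi * y) ^ p : ℝ) : ℂ)) := by
      intro y
      have h' : ψ n y * Real.cos (Real.pi * y) ^ (p + 1) =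
          c * (ψ i y * Real.cos (Real.pi * y) ^ p) + d * (ψ j y * Real.cos (Real.pi * y) ^ p) := by
        linear_combination Real.cos (Real.pi * y) ^ p * h y
      rw [h', Complex.ofReal_add, Complex.ofReal_mul c, Complex.ofReal_mul d]; ring
    simp_rw [this]
    rw [integral_add ((hint i).const_mul _) ((hint j).const_mul _), integral_const_mul,
      integral_const_mul, ih, ih]
    simp

/-- Polynomials in cos(πy) are uniformly dense in C[0,1], because y ↦ cos(πy) is a homeomorphism of
[0,1] onto [-1,1]. -/
lemma ae_eq_zero_of_integral_mul_cos_pow {F : ℝ → ℂ} (hF : IntegrableOn F (Set.Ioo (0 : ℝ) 1))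
    (h : ∀ p : ℕ, ∫ y in Set.Ioo (0 : ℝ) 1, F y * ((Real.cos (Real.pi * y) ^ p : ℝ) : ℂ) = 0) :
    ∀ᵐ y ∂volume.restrict (Set.Ioo (0 : ℝ) 1), F y = 0 := by
  have hF' := (integrableOn_Icc_iff_integrableOn_Ioo (a := (0 : ℝ)) (b := 1)).2 hF
  have hint : ∀ {g : ℝ → ℝ}, Continuous g →
      IntegrableOn (fun y => F y * (g y : ℂ)) (Set.Ioo (0 : ℝ) 1) := fun hg =>
    (hF'.mul_continuousOn (by fun_prop) isCompact_Icc).mono_set Set.Ioo_subset_Icc_self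
  have hpoly : ∀ q : Polynomial ℝ,
      ∫ y in Set.Ioo (0 : ℝ) 1, F y * ((q.eval (Real.cos (Real.pi * y)) : ℝ) : ℂ) = 0 := by
    intro q
    simp_rw [Polynomial.eval_eq_sum_range, Complex.ofReal_sum, Finset.mul_sum]
    rw [integral_finsetSum]
    · refine Finset.sum_eq_zero fun i _ => ?_
      have := h i
      simp_rw [Complex.ofReal_mul, mul_left_comm (F _)]
      rw [integral_const_mul, this, mul_zero]
    · intro i _
      exact hint (by fun_prop)
  have hcont : ∀ g : ℝ → ℝ, Continuous g → ∫ y in Set.Ioo (0 : ℝ) 1, F y * (g y : ℂ) = 0 := by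
    intro g hg
    rw [← norm_le_zero_iff]
    refine le_of_forall_pos_le_add fun ε hε => ?_
    set I := ∫ y in Set.Ioo (0 : ℝ) 1, ‖F y‖ with hI
    have hI0 : 0 ≤ I := integral_nonneg fun y => norm_nonneg _
    -- g is transported to [-1,1] through y = arccos(t)/π. The denominator I + 1 avoids dividing by
    -- a vanishing L¹ norm.
    obtain ⟨q, hq⟩ := exists_polynomial_near_of_continuousOn (-1) 1
      (fun t => g (Real.arccos t / Real.pi))
      (hg.comp (Real.continuous_arccos.div_const _)).continuousOn (ε / (I + 1)) (by positivity)
    have hsub : ∫ y in Set.Ioo (0 : ℝ) 1, F y * (g y : ℂ) =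
        ∫ y in Set.Ioo (0 : ℝ) 1, F y * ((g y - q.eval (Real.cos (Real.pi * y)) : ℝ) : ℂ) := by
      simp_rw [Complex.ofReal_sub, mul_sub]
      rw [integral_sub (hint hg) (hint (by fun_prop)), hpoly, sub_zero]
    rw [hsub, zero_add]
    calc _ ≤ ∫ y in Set.Ioo (0 : ℝ) 1, ‖F y‖ * (ε / (I + 1)) := by
          refine norm_integral_le_of_norm_le (hF.norm.mul_const _) ?_
          refine (ae_restrict_iff' measurableSet_Ioo).2 (Filter.Eventually.of_forall fun y hy => ?_)
          rw [norm_mul]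
          gcongr
          rw [Complex.norm_real, Real.norm_eq_abs, abs_sub_comm]
          have h1 := hq (Real.cos (Real.pi * y)) ⟨Real.neg_one_le_cos _, Real.cos_le_one _⟩
          rw [Real.arccos_cos (by have := hy.1; positivity) (by nlinarith [hy.2, Real.pi_pos]),
            mul_div_cancel_left₀ _ Real.pi_ne_zero] at h1
          exact h1.le
      _ = I * (ε / (I + 1)) := integral_mul_const _ _
      _ ≤ ε := by
          rw [mul_div_assoc', div_le_iff₀ (by positivity)]
          nlinarith
  have := isOpen_Ioo.ae_eq_zero_of_integral_contDiff_smul_eq_zero hF.locallyIntegrableOn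
    (μ := volume) (fun g hg _ hs => ?_)
  · exact (ae_restrict_iff' measurableSet_Ioo).2 this
  · rw [← hcont g hg.continuous, ← setIntegral_eq_integral_of_forall_compl_eq_zero
      (s := Set.Ioo (0 : ℝ) 1)]
    · exact integral_congr_ae (Filter.Eventually.of_forall fun y => by
        simp [Complex.real_smul, mul_comm])
    · intro y hy
      rw [image_eq_zero_of_notMem_tsupport fun h' => hy (hs h'), zero_smul]

lemma cos_pi_mul_sin (m y : ℝ) : Real.cos (Real.pi * y) * Real.sin (m * y) =
    1 / 2 * Real.sin ((m + Real.pi) * y) + 1 / 2 * Real.sin ((m - Real.pi) * y) := by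
  rw [add_mul, sub_mul, Real.sin_add, Real.sin_sub]; ring

lemma cos_pi_mul_cos (m y : ℝ) : Real.cos (Real.pi * y) * Real.cos (m * y) =
    1 / 2 * Real.cos ((m + Real.pi) * y) + 1 / 2 * Real.cos ((m - Real.pi) * y) := by
  rw [add_mul, sub_mul, Real.cos_add, Real.cos_sub]; ring

lemma freq_succ (B₁ B₃ : BC) (n : ℕ) : freq B₁ B₃ (n + 1) = freq B₁ B₃ n + Real.pi := by
  unfold freq; split_ifs <;> push_cast <;> ring

/-- The frequencies form a lattice of step π symmetric about 0, up to sign; hence μ_n - π is again a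
frequency after reflection, also for n = 0. -/
lemma exists_abs_freq_eq (B₁ B₃ : BC) (n : ℕ) :
    ∃ j, |freq B₁ B₃ n - Real.pi| = freq B₁ B₃ j := by
  rcases n with _ | n
  · have hpi := Real.pi_pos
    by_cases h : B₁ = B₃
    · exact ⟨1, by simp [freq, h, abs_of_pos hpi]⟩
    · refine ⟨0, ?_⟩
      simp only [freq, h, if_false]
      rw [abs_of_nonpos (by push_cast; linarith)]; push_cast; ring
  · exact ⟨n, by rw [freq_succ, add_sub_cancel_right, abs_of_nonneg (freq_nonneg _ _ _)]⟩

lemma ae_eq_zero_of_integral_mul_trig {f : ℝ → ℂ} (hf : IntegrableOn f (Set.Ioo (0 : ℝ) 1))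
    {ψ : ℕ → ℝ → ℝ} (hψ : ∀ n, Continuous (ψ n))
    (hrec : ∀ n, ∃ (c d : ℝ) (i j : ℕ), ∀ y, Real.cos (Real.pi * y) * ψ n y =
      c * ψ i y + d * ψ j y)
    (h0 : ∀ n, ∫ y in Set.Ioo (0 : ℝ) 1, f y * ψ n y = 0)
    {l : ℕ} (hl : ∀ y ∈ Set.Ioo (0 : ℝ) 1, ψ l y ≠ 0) :
    ∀ᵐ y ∂volume.restrict (Set.Ioo (0 : ℝ) 1), f y = 0 := by
  have hF : IntegrableOn (fun y => f y * (ψ l y : ℂ)) (Set.Ioo (0 : ℝ) 1) := by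
    have := hψ l
    exact (((integrableOn_Icc_iff_integrableOn_Ioo (a := (0 : ℝ)) (b := 1)).2 hf).mul_continuousOn
        (by fun_prop) isCompact_Icc).mono_set Set.Ioo_subset_Icc_self
  have h := ae_eq_zero_of_integral_mul_cos_pow hF fun p => by
    simpa [mul_assoc] using integral_mul_cos_pow_eq_zero hf hψ hrec h0 p l
  filter_upwards [h, ae_restrict_mem measurableSet_Ioo] with y hy hy'
  exact (mul_eq_zero.1 hy).resolve_right (by exact_mod_cast hl y hy')

lemma amp_ne_zero (B₁ B₃ : BC) (n : ℕ) : amp B₁ B₃ n ≠ 0 := by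
  rw [amp]; split_ifs <;> simp

/-- An integrable function all of whose coefficients vanish is zero. -/
lemma ae_eq_zero_of_integral_mul_eigenfun {B₁ B₃ : BC} (h₁ : IsDN B₁) (h₃ : IsDN B₃) {f : ℝ → ℂ}
    (hf : IntegrableOn f (Set.Ioo (0 : ℝ) 1))
    (h : ∀ n, ∫ y in Set.Ioo (0 : ℝ) 1, f y * (eigenfun B₁ B₃ n y : ℂ) = 0) :
    ∀ᵐ y ∂volume.restrict (Set.Ioo (0 : ℝ) 1), f y = 0 := by
  have hpi := Real.pi_pos
  rcases h₁ with rfl | rfl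
  · simp only [eigenfun_dirichlet h₃] at h
    -- The lowest positive frequency: sin(μ_l y) has no zero in (0,1) when 0 < μ_l ≤ π. In the
    -- Dirichlet-Dirichlet case l = 1, as the mode 0 vanishes.
    obtain ⟨l, hl, hl'⟩ : ∃ l, 0 < freq BC.dirichlet B₃ l ∧ freq BC.dirichlet B₃ l ≤ Real.pi := by
      rcases h₃ with rfl | rfl
      · exact ⟨1, by simp [freq, hpi]⟩
      · exact ⟨0, by simp [freq]; constructor <;> linarith⟩
    refine ae_eq_zero_of_integral_mul_trig hf
      (ψ := fun n y => Real.sin (freq BC.dirichlet B₃ n * y)) (l := l) (fun n => by fun_prop)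
      (fun n => ?_) (fun n => ?_) fun y hy => ?_
    · obtain ⟨j, hj⟩ := exists_abs_freq_eq BC.dirichlet B₃ n
      rcases abs_choice (freq BC.dirichlet B₃ n - Real.pi) with h' | h'
      · refine ⟨1 / 2, 1 / 2, n + 1, j, fun y => ?_⟩
        rw [cos_pi_mul_sin, freq_succ, ← hj, h']
      -- A reflected frequency changes the sign of the sine.
      · refine ⟨1 / 2, -1 / 2, n + 1, j, fun y => ?_⟩
        rw [cos_pi_mul_sin, freq_succ, ← hj, h', neg_mul, Real.sin_neg]; ring
    · have := h n
      simp_rw [Complex.ofReal_mul, mul_left_comm (f _)] at this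
      rw [integral_const_mul] at this
      exact (mul_eq_zero.1 this).resolve_left (by exact_mod_cast amp_ne_zero _ _ _)
    · refine (Real.sin_pos_of_pos_of_lt_pi (mul_pos hl hy.1) ?_).ne'
      nlinarith [hy.2]
  · simp only [eigenfun_neumann h₃] at h
    have hl : freq BC.neumann B₃ 0 ≤ Real.pi / 2 := by
      rcases h₃ with rfl | rfl
      · simp [freq]; linarith
      · simp [freq]; linarith
    refine ae_eq_zero_of_integral_mul_trig hf
      (ψ := fun n y => Real.cos (freq BC.neumann B₃ n * y)) (l := 0) (fun n => by fun_prop)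
      (fun n => ?_) (fun n => ?_) fun y hy => ?_
    · obtain ⟨j, hj⟩ := exists_abs_freq_eq BC.neumann B₃ n
      refine ⟨1 / 2, 1 / 2, n + 1, j, fun y => ?_⟩
      rw [cos_pi_mul_cos, freq_succ, ← hj]
      congr 2
      rcases abs_choice (freq BC.neumann B₃ n - Real.pi) with h' | h'
      · rw [h']
      · rw [h', neg_mul, Real.cos_neg]
    · have := h n
      simp_rw [Complex.ofReal_mul, mul_left_comm (f _)] at this
      rw [integral_const_mul] at this
      exact (mul_eq_zero.1 this).resolve_left (by exact_mod_cast amp_ne_zero _ _ _)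
    · have h0 := freq_nonneg BC.neumann B₃ 0
      refine (Real.cos_pos_of_mem_Ioo ⟨?_, ?_⟩).ne'
      · nlinarith [mul_nonneg h0 hy.1.le]
      · nlinarith [hy.1, hy.2]

/-! ### Continuous functions as elements of `L²` -/

open Classical in
/-- The class in `L²(Ω)` of a function on the plane. -/
noncomputable def sqLp (f : ℝ × ℝ → ℂ) : L2Square :=
  -- The default value 0 lets bare functions be used; the lemmas on this class assume continuity,
  -- where the default does not occur.
  if h : MemLp f 2 (volume.restrict unitSquare) then h.toLp f else 0

open Classical in
/-- The class in `L²(0,1)` of a function on the line. -/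
noncomputable def sideLp (f : ℝ → ℂ) : L2Side :=
  if h : MemLp f 2 (volume.restrict (Set.Ioo (0 : ℝ) 1)) then h.toLp f else 0

instance : IsFiniteMeasure (volume.restrict unitSquare : Measure (ℝ × ℝ)) := by
  refine ⟨?_⟩
  rw [Measure.restrict_apply_univ, unitSquare, Measure.volume_eq_prod, Measure.prod_prod]
  simp

lemma measurableSet_unitSquare : MeasurableSet unitSquare := measurableSet_Ioo.prod measurableSet_Ioo

lemma restrict_unitSquare : (volume.restrict unitSquare : Measure (ℝ × ℝ)) =
    (volume.restrict (Set.Ioo (0 : ℝ) 1)).prod (volume.restrict (Set.Ioo (0 : ℝ) 1)) := by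
  rw [Measure.prod_restrict, unitSquare, Measure.volume_eq_prod]

lemma unitSquare_subset : unitSquare ⊆ Set.Icc (0 : ℝ × ℝ) 1 := fun _ hz =>
  ⟨⟨hz.1.1.le, hz.2.1.le⟩, ⟨hz.1.2.le, hz.2.2.le⟩⟩

lemma memLp_of_continuous {X : Type*} [TopologicalSpace X] [MeasurableSpace X]
    [OpensMeasurableSpace X] [SecondCountableTopology X] {μ : Measure X} {s K : Set X}
    [IsFiniteMeasure (μ.restrict s)] (hs : MeasurableSet s) (hK : IsCompact K) (hsK : s ⊆ K)
    {f : X → ℂ} (hf : Continuous f) : MemLp f 2 (μ.restrict s) := by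
  obtain ⟨C, hC⟩ := hK.exists_bound_of_continuousOn hf.continuousOn
  exact MemLp.of_bound hf.aestronglyMeasurable C
    ((ae_restrict_iff' hs).2 (Filter.Eventually.of_forall fun x hx => hC x (hsK hx)))

lemma memLp_unitSquare {f : ℝ × ℝ → ℂ} (hf : Continuous f) :
    MemLp f 2 (volume.restrict unitSquare) :=
  memLp_of_continuous measurableSet_unitSquare isCompact_Icc unitSquare_subset hf

lemma memLp_Ioo {f : ℝ → ℂ} (hf : Continuous f) :
    MemLp f 2 (volume.restrict (Set.Ioo (0 : ℝ) 1)) :=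
  memLp_of_continuous measurableSet_Ioo isCompact_Icc Set.Ioo_subset_Icc_self hf

lemma coeFn_sqLp {f : ℝ × ℝ → ℂ} (hf : Continuous f) :
    sqLp f =ᵐ[volume.restrict unitSquare] f := by
  rw [sqLp, dif_pos (memLp_unitSquare hf)]; exact MemLp.coeFn_toLp _

lemma coeFn_sideLp {f : ℝ → ℂ} (hf : Continuous f) :
    sideLp f =ᵐ[volume.restrict (Set.Ioo (0 : ℝ) 1)] f := by
  rw [sideLp, dif_pos (memLp_Ioo hf)]; exact MemLp.coeFn_toLp _

lemma inner_sqLp {f : ℝ × ℝ → ℂ} (hf : Continuous f) (u : L2Square) :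
    inner ℂ (sqLp f) u = ∫ z in unitSquare, u z * conj (f z) := by
  rw [L2.inner_def]
  refine integral_congr_ae ?_
  filter_upwards [coeFn_sqLp hf] with z hz
  rw [hz, RCLike.inner_apply]

lemma inner_sideLp {f : ℝ → ℂ} (hf : Continuous f) (g : L2Side) :
    inner ℂ (sideLp f) g = ∫ y in Set.Ioo (0 : ℝ) 1, g y * conj (f y) := by
  rw [L2.inner_def]
  refine integral_congr_ae ?_
  filter_upwards [coeFn_sideLp hf] with z hz
  rw [hz, RCLike.inner_apply]

lemma inner_sideLp_sideLp {f g : ℝ → ℂ} (hf : Continuous f) (hg : Continuous g) :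
    inner ℂ (sideLp f) (sideLp g) = ∫ y in Set.Ioo (0 : ℝ) 1, g y * conj (f y) := by
  rw [inner_sideLp hf]
  refine integral_congr_ae ?_
  filter_upwards [coeFn_sideLp hg] with z hz
  rw [hz]

lemma inner_sqLp_sqLp {f g : ℝ × ℝ → ℂ} (hf : Continuous f) (hg : Continuous g) :
    inner ℂ (sqLp f) (sqLp g) = ∫ z in unitSquare, g z * conj (f z) := by
  rw [inner_sqLp hf]
  refine integral_congr_ae ?_
  filter_upwards [coeFn_sqLp hg] with z hz
  rw [hz]

lemma sideLp_const_mul (c : ℂ) {f : ℝ → ℂ} (hf : Continuous f) :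
    sideLp (fun x => c * f x) = c • sideLp f := by
  have hcf : Continuous fun x => c * f x := continuous_const.mul hf
  refine Lp.ext ?_
  filter_upwards [coeFn_sideLp hf, coeFn_sideLp hcf, Lp.coeFn_smul c (sideLp f)] with x h1 h2 h3
  rw [h2, h3, Pi.smul_apply, h1, smul_eq_mul]

lemma sqLp_const_mul (c : ℂ) {f : ℝ × ℝ → ℂ} (hf : Continuous f) :
    sqLp (fun x => c * f x) = c • sqLp f := by
  have hcf : Continuous fun x => c * f x := continuous_const.mul hf
  refine Lp.ext ?_
  filter_upwards [coeFn_sqLp hf, coeFn_sqLp hcf, Lp.coeFn_smul c (sqLp f)] with x h1 h2 h3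
  rw [h2, h3, Pi.smul_apply, h1, smul_eq_mul]

/-! ### Green's formula for smooth functions -/

lemma continuous_partialX {φ : ℝ × ℝ → ℂ} (hφ : ContDiff ℝ ∞ φ) : Continuous (partialX φ) :=
  (hφ.continuous_fderiv (by simp)).clm_apply continuous_const

lemma continuous_partialY {φ : ℝ × ℝ → ℂ} (hφ : ContDiff ℝ ∞ φ) : Continuous (partialY φ) :=
  (hφ.continuous_fderiv (by simp)).clm_apply continuous_const

lemma unitSquare_ae_eq : unitSquare =ᵐ[volume] Set.Icc (0 : ℝ × ℝ) 1 := by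
  have := Measure.set_prod_ae_eq (μ := (volume : Measure ℝ)) (ν := (volume : Measure ℝ))
    (Ioo_ae_eq_Icc (a := (0 : ℝ)) (b := 1)) (Ioo_ae_eq_Icc (a := (0 : ℝ)) (b := 1))
  rw [Set.Icc_prod_Icc] at this
  exact this

lemma integral_partialX {φ : ℝ × ℝ → ℂ} (hφ : ContDiff ℝ ∞ φ) :
    ∫ z in unitSquare, partialX φ z =
      (∫ y in Set.Ioo (0 : ℝ) 1, φ (1, y)) - ∫ y in Set.Ioo (0 : ℝ) 1, φ (0, y) := by
  have h := integral_divergence_prod_Icc_of_hasFDerivAt_of_le φ (fun _ => 0) (fderiv ℝ φ)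
    (fun _ => 0) 0 1 zero_le_one hφ.continuous.continuousOn continuousOn_const
    (fun z _ => (hφ.differentiable (by simp) z).hasFDerivAt) (fun z _ => hasFDerivAt_const _ _)
    (by
      simp only [zero_apply, add_zero]
      exact (continuous_partialX hφ).integrableOn_Icc)
  rw [setIntegral_congr_set unitSquare_ae_eq, setIntegral_Ioo_eq, setIntegral_Ioo_eq]
  simpa [partialX] using h

lemma integral_partialY {φ : ℝ × ℝ → ℂ} (hφ : ContDiff ℝ ∞ φ) :
    ∫ z in unitSquare, partialY φ z =
      (∫ x in Set.Ioo (0 : ℝ) 1, φ (x, 1)) - ∫ x in Set.Ioo (0 : ℝ) 1, φ (x, 0) := by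
  have h := integral_divergence_prod_Icc_of_hasFDerivAt_of_le (fun _ => 0) φ (fun _ => 0)
    (fderiv ℝ φ) 0 1 zero_le_one continuousOn_const hφ.continuous.continuousOn
    (fun z _ => hasFDerivAt_const _ _) (fun z _ => (hφ.differentiable (by simp) z).hasFDerivAt)
    (by
      simp only [zero_apply, zero_add]
      exact (continuous_partialY hφ).integrableOn_Icc)
  rw [setIntegral_congr_set unitSquare_ae_eq, setIntegral_Ioo_eq, setIntegral_Ioo_eq]
  simpa [partialY] using h

lemma partialX_mul {φ ψ : ℝ × ℝ → ℂ} (hφ : ContDiff ℝ ∞ φ) (hψ : ContDiff ℝ ∞ ψ) (z : ℝ × ℝ) :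
    partialX (fun z => φ z * ψ z) z = φ z * partialX ψ z + partialX φ z * ψ z := by
  have := fderiv_fun_mul (hφ.differentiable (by simp) z) (hψ.differentiable (by simp) z)
  simp only [partialX, this]
  simp [mul_comm]

lemma partialY_mul {φ ψ : ℝ × ℝ → ℂ} (hφ : ContDiff ℝ ∞ φ) (hψ : ContDiff ℝ ∞ ψ) (z : ℝ × ℝ) :
    partialY (fun z => φ z * ψ z) z = φ z * partialY ψ z + partialY φ z * ψ z := by
  have := fderiv_fun_mul (hφ.differentiable (by simp) z) (hψ.differentiable (by simp) z)
  simp only [partialY, this]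
  simp [mul_comm]

lemma integrableOn_unitSquare {f : ℝ × ℝ → ℂ} (hf : Continuous f) : IntegrableOn f unitSquare :=
  (hf.integrableOn_Icc (a := 0) (b := 1)).mono_set unitSquare_subset

lemma setIntegral_sqLp_mul {f g : ℝ × ℝ → ℂ} (hf : Continuous f) :
    ∫ z in unitSquare, sqLp f z * g z = ∫ z in unitSquare, f z * g z := by
  refine integral_congr_ae ?_
  filter_upwards [coeFn_sqLp hf] with z hz
  rw [hz]

lemma setIntegral_sideLp_mul {f g : ℝ → ℂ} (hf : Continuous f) :
    ∫ y in Set.Ioo (0 : ℝ) 1, sideLp f y * g y = ∫ y in Set.Ioo (0 : ℝ) 1, f y * g y := by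
  refine integral_congr_ae ?_
  filter_upwards [coeFn_sideLp hf] with z hz
  rw [hz]

lemma green_partialX {Φ φ : ℝ × ℝ → ℂ} (hΦ : ContDiff ℝ ∞ Φ) (hφ : ContDiff ℝ ∞ φ) :
    (∫ z in unitSquare, Φ z * partialX φ z) + (∫ z in unitSquare, partialX Φ z * φ z) =
      (∫ y in Set.Ioo (0 : ℝ) 1, Φ (1, y) * φ (1, y)) -
        ∫ y in Set.Ioo (0 : ℝ) 1, Φ (0, y) * φ (0, y) := by
  have h1 : Continuous fun z => Φ z * partialX φ z :=
    hΦ.continuous.mul (continuous_partialX hφ)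
  have h2 : Continuous fun z => partialX Φ z * φ z :=
    (continuous_partialX hΦ).mul hφ.continuous
  rw [← integral_partialX (hΦ.mul hφ), ← integral_add (integrableOn_unitSquare h1)
    (integrableOn_unitSquare h2)]
  simp_rw [partialX_mul hΦ hφ]

lemma green_partialY {Φ φ : ℝ × ℝ → ℂ} (hΦ : ContDiff ℝ ∞ Φ) (hφ : ContDiff ℝ ∞ φ) :
    (∫ z in unitSquare, Φ z * partialY φ z) + (∫ z in unitSquare, partialY Φ z * φ z) =
      (∫ x in Set.Ioo (0 : ℝ) 1, Φ (x, 1) * φ (x, 1)) -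
        ∫ x in Set.Ioo (0 : ℝ) 1, Φ (x, 0) * φ (x, 0) := by
  have h1 : Continuous fun z => Φ z * partialY φ z :=
    hΦ.continuous.mul (continuous_partialY hφ)
  have h2 : Continuous fun z => partialY Φ z * φ z :=
    (continuous_partialY hΦ).mul hφ.continuous
  rw [← integral_partialY (hΦ.mul hφ), ← integral_add (integrableOn_unitSquare h1)
    (integrableOn_unitSquare h2)]
  simp_rw [partialY_mul hΦ hφ]

lemma IsTestFunction.eq_zero {φ : ℝ × ℝ → ℂ} (hφ : IsTestFunction φ) {z : ℝ × ℝ}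
    (hz : z ∉ unitSquare) : φ z = 0 :=
  image_eq_zero_of_notMem_tsupport fun h => hz (hφ.2.2 h)

/-- A smooth function on the plane as an element of `H¹(Ω)`. -/
noncomputable def H1.ofSmooth (Φ : ℝ × ℝ → ℂ) (hΦ : ContDiff ℝ ∞ Φ) : H1 where
  val := sqLp Φ
  dx := sqLp (partialX Φ)
  dy := sqLp (partialY Φ)
  weak_dx φ hφ := by
    rw [setIntegral_sqLp_mul hΦ.continuous, setIntegral_sqLp_mul (continuous_partialX hΦ)]
    have h := green_partialX hΦ hφ.1
    have h1 : ∀ y, φ (1, y) = 0 := fun y => hφ.eq_zero fun h => lt_irrefl _ h.1.2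
    have h0 : ∀ y, φ (0, y) = 0 := fun y => hφ.eq_zero fun h => lt_irrefl _ h.1.1
    simp only [h1, h0, mul_zero, integral_zero, sub_zero] at h
    exact eq_neg_of_add_eq_zero_left h
  weak_dy φ hφ := by
    rw [setIntegral_sqLp_mul hΦ.continuous, setIntegral_sqLp_mul (continuous_partialY hΦ)]
    have h := green_partialY hΦ hφ.1
    have h1 : ∀ x, φ (x, 1) = 0 := fun x => hφ.eq_zero fun h => lt_irrefl _ h.2.2
    have h0 : ∀ x, φ (x, 0) = 0 := fun x => hφ.eq_zero fun h => lt_irrefl _ h.2.1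
    simp only [h1, h0, mul_zero, integral_zero, sub_zero] at h
    exact eq_neg_of_add_eq_zero_left h

/-- The traces of a continuous function on the plane. -/
noncomputable def smoothTrace (Φ : ℝ × ℝ → ℂ) : Side → L2Side
  | Side.bottom => sideLp fun x => Φ (x, 0)
  | Side.right => sideLp fun y => Φ (1, y)
  | Side.top => sideLp fun x => Φ (x, 1)
  | Side.left => sideLp fun y => Φ (0, y)

lemma hasTrace_ofSmooth {Φ : ℝ × ℝ → ℂ} (hΦ : ContDiff ℝ ∞ Φ) :
    HasTrace (H1.ofSmooth Φ hΦ) (smoothTrace Φ) := by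
  have hc := hΦ.continuous
  intro φ hφ
  simp only [H1.ofSmooth, smoothTrace]
  rw [setIntegral_sqLp_mul hΦ.continuous, setIntegral_sqLp_mul (continuous_partialX hΦ),
    setIntegral_sqLp_mul hΦ.continuous, setIntegral_sqLp_mul (continuous_partialY hΦ),
    setIntegral_sideLp_mul (by fun_prop), setIntegral_sideLp_mul (by fun_prop),
    setIntegral_sideLp_mul (by fun_prop), setIntegral_sideLp_mul (by fun_prop)]
  exact ⟨green_partialX hΦ hφ, green_partialY hΦ hφ⟩

/-! ### Traces and weak derivatives through inner products -/

lemma contDiff_conj {φ : ℝ × ℝ → ℂ} (hφ : ContDiff ℝ ∞ φ) : ContDiff ℝ ∞ fun z => conj (φ z) :=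
  Complex.conjCLE.contDiff.comp hφ

lemma fderiv_conj {φ : ℝ × ℝ → ℂ} (hφ : ContDiff ℝ ∞ φ) (z v : ℝ × ℝ) :
    fderiv ℝ (fun z => conj (φ z)) z v = conj (fderiv ℝ φ z v) := by
  have := (Complex.conjCLE : ℂ ≃L[ℝ] ℂ).hasFDerivAt.comp z
    (hφ.differentiable (by simp) z).hasFDerivAt
  have h2 : fderiv ℝ (fun z => conj (φ z)) z = _ := this.fderiv
  rw [h2]; simp

lemma inner_sqLp_partialX {φ : ℝ × ℝ → ℂ} (hφ : ContDiff ℝ ∞ φ) (u : L2Square) :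
    inner ℂ (sqLp (partialX φ)) u =
      ∫ z in unitSquare, u z * partialX (fun z => conj (φ z)) z := by
  rw [inner_sqLp (continuous_partialX hφ)]
  simp only [partialX, fderiv_conj hφ]

lemma inner_sqLp_partialY {φ : ℝ × ℝ → ℂ} (hφ : ContDiff ℝ ∞ φ) (u : L2Square) :
    inner ℂ (sqLp (partialY φ)) u =
      ∫ z in unitSquare, u z * partialY (fun z => conj (φ z)) z := by
  rw [inner_sqLp (continuous_partialY hφ)]
  simp only [partialY, fderiv_conj hφ]

/-- Each side pairs u, its derivatives or its traces with fixed vectors, so the condition survives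
limits of series. Test functions are conjugated because the inner product is conjugate linear in its
first slot. -/
lemma hasTrace_iff {u : H1} {τ : Side → L2Side} : HasTrace u τ ↔
    ∀ φ : ℝ × ℝ → ℂ, ContDiff ℝ ∞ φ →
      (inner ℂ (sqLp (partialX φ)) u.val + inner ℂ (sqLp φ) u.dx =
        inner ℂ (sideLp fun y => φ (1, y)) (τ Side.right) -
          inner ℂ (sideLp fun y => φ (0, y)) (τ Side.left)) ∧
      (inner ℂ (sqLp (partialY φ)) u.val + inner ℂ (sqLp φ) u.dy =
        inner ℂ (sideLp fun x => φ (x, 1)) (τ Side.top) -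
          inner ℂ (sideLp fun x => φ (x, 0)) (τ Side.bottom)) := by
  have key : ∀ φ : ℝ × ℝ → ℂ, ContDiff ℝ ∞ φ → ∀ u : L2Square, ∀ τ : L2Side, ∀ t : ℝ,
      inner ℂ (sqLp φ) u = ∫ z in unitSquare, u z * conj (φ z) ∧
      inner ℂ (sideLp fun y => φ (t, y)) τ = ∫ y in Set.Ioo (0 : ℝ) 1, τ y * conj (φ (t, y)) ∧
      inner ℂ (sideLp fun x => φ (x, t)) τ = ∫ x in Set.Ioo (0 : ℝ) 1, τ x * conj (φ (x, t)) := by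
    intro φ hφ u τ t
    have hc := hφ.continuous
    exact ⟨inner_sqLp hc u, inner_sideLp (by fun_prop) τ, inner_sideLp (by fun_prop) τ⟩
  constructor
  · intro h φ hφ
    have := h _ (contDiff_conj hφ)
    rw [inner_sqLp_partialX hφ, inner_sqLp_partialY hφ, (key φ hφ _ (τ Side.right) 1).1,
      (key φ hφ _ (τ Side.right) 1).1, (key φ hφ 0 _ _).2.1, (key φ hφ 0 _ _).2.1,
      (key φ hφ 0 _ _).2.2, (key φ hφ 0 _ _).2.2]
    exact this
  · intro h φ hφ
    have := h _ (contDiff_conj hφ)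
    have hφ' := contDiff_conj hφ
    rw [inner_sqLp_partialX hφ', inner_sqLp_partialY hφ', (key _ hφ' _ (τ Side.right) 1).1,
      (key _ hφ' _ (τ Side.right) 1).1, (key _ hφ' 0 _ _).2.1, (key _ hφ' 0 _ _).2.1,
      (key _ hφ' 0 _ _).2.2, (key _ hφ' 0 _ _).2.2] at this
    simpa only [Complex.conj_conj] using this

lemma hasSum_inner {ι H : Type*} [NormedAddCommGroup H] [InnerProductSpace ℂ H] {f : ι → H} {x : H}
    (h : HasSum f x) (v : H) : HasSum (fun n => inner ℂ v (f n)) (inner ℂ v x) :=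
  h.mapL (innerSL ℂ v)

lemma IsTestFunction.conj {φ : ℝ × ℝ → ℂ} (hφ : IsTestFunction φ) :
    IsTestFunction fun z => conj (φ z) := by
  have : tsupport (fun z => (starRingEnd ℂ) (φ z)) ⊆ tsupport φ :=
    closure_mono fun z hz h => hz (by simp [h])
  exact ⟨contDiff_conj hφ.1, hφ.2.1.of_isClosed_subset (isClosed_tsupport _) this,
    this.trans hφ.2.2⟩

/-- A convergent series in `H¹(Ω)` with convergent traces. -/
lemma exists_H1_hasSum {ι : Type*} {u : ι → H1} {τ : ι → Side → L2Side}
    (hτ : ∀ n, HasTrace (u n) (τ n)) {U X Y : L2Square} {T : Side → L2Side}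
    (hU : HasSum (fun n => (u n).val) U) (hX : HasSum (fun n => (u n).dx) X)
    (hY : HasSum (fun n => (u n).dy) Y) (hT : ∀ s, HasSum (fun n => τ n s) (T s)) :
    ∃ v : H1, v.val = U ∧ v.dx = X ∧ v.dy = Y ∧ HasTrace v T := by
  refine ⟨⟨U, X, Y, fun φ hφ => ?_, fun φ hφ => ?_⟩, rfl, rfl, rfl, ?_⟩
  · have h1 := hasSum_inner hU (sqLp (partialX fun z => conj (φ z)))
    have h2 := (hasSum_inner hX (sqLp fun z => conj (φ z))).neg
    have hc := hφ.conj.1.continuous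
    simp only [inner_sqLp_partialX hφ.conj.1, inner_sqLp hc, Complex.conj_conj,
      (u _).weak_dx φ hφ] at h1 h2
    exact h1.unique h2
  · have h1 := hasSum_inner hU (sqLp (partialY fun z => conj (φ z)))
    have h2 := (hasSum_inner hY (sqLp fun z => conj (φ z))).neg
    have hc := hφ.conj.1.continuous
    simp only [inner_sqLp_partialY hφ.conj.1, inner_sqLp hc, Complex.conj_conj,
      (u _).weak_dy φ hφ] at h1 h2
    exact h1.unique h2
  · rw [hasTrace_iff]
    intro φ hφ
    have h := fun n => (hasTrace_iff.1 (hτ n)) φ hφ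
    constructor
    · refine ((hasSum_inner hU _).add (hasSum_inner hX _)).unique ?_
      simp only [(h _).1]
      exact (hasSum_inner (hT _) _).sub (hasSum_inner (hT _) _)
    · refine ((hasSum_inner hU _).add (hasSum_inner hY _)).unique ?_
      simp only [(h _).2]
      exact (hasSum_inner (hT _) _).sub (hasSum_inner (hT _) _)

/-- An element of `H¹(Ω)` is determined by the function. -/
lemma H1.ext_val {u v : H1} (h : u.val = v.val) : u = v := by
  have hint : ∀ w : L2Square, IntegrableOn w unitSquare := fun w =>
    (Lp.memLp w).integrable (by norm_num)
  -- The fundamental lemma of the calculus of variations, giving uniqueness of weak derivatives.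
  have key : ∀ w w' : L2Square, (∀ φ, IsTestFunction φ →
      ∫ z in unitSquare, w z * φ z = ∫ z in unitSquare, w' z * φ z) → w = w' := by
    intro w w' hw
    have hopen : IsOpen unitSquare := isOpen_Ioo.prod isOpen_Ioo
    have h0 := hopen.ae_eq_zero_of_integral_contDiff_smul_eq_zero
      ((hint w).sub (hint w')).locallyIntegrableOn (μ := volume) fun g hg hgc hgs => ?_
    · refine Lp.ext ((ae_restrict_iff' measurableSet_unitSquare).2 ?_)
      filter_upwards [h0] with z hz hz'
      exact sub_eq_zero.1 (hz hz')
    · have hsub : tsupport (fun z => (g z : ℂ)) ⊆ tsupport g :=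
        closure_mono fun z hz h => hz (by simp [h])
      have htest : IsTestFunction fun z => (g z : ℂ) :=
        ⟨Complex.ofRealCLM.contDiff.comp hg,
          hgc.of_isClosed_subset (isClosed_tsupport _) hsub, hsub.trans hgs⟩
      rw [← setIntegral_eq_integral_of_forall_compl_eq_zero (s := unitSquare)]
      · have hcont : Continuous fun z => (g z : ℂ) := htest.1.continuous
        obtain ⟨C, hC⟩ := (isCompact_Icc (a := (0 : ℝ × ℝ)) (b := 1)).exists_bound_of_continuousOn
          hcont.continuousOn
        have hi : ∀ w : L2Square, IntegrableOn (fun z => w z * (g z : ℂ)) unitSquare := fun w =>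
          (hint w).mul_bdd hcont.aestronglyMeasurable ((ae_restrict_iff'
            measurableSet_unitSquare).2 (Filter.Eventually.of_forall fun z hz =>
              hC z (unitSquare_subset hz)))
        have : ∀ z, g z • ((w : ℝ × ℝ → ℂ) - w') z = w z * (g z : ℂ) - w' z * (g z : ℂ) := by
          intro z; simp only [Pi.sub_apply, Complex.real_smul]; ring
        simp_rw [this]
        rw [integral_sub (hi w) (hi w'), hw _ htest, sub_self]
      · intro z hz
        rw [image_eq_zero_of_notMem_tsupport fun h' => hz (hgs h'), zero_smul]
  refine H1.ext h (key _ _ fun φ hφ => ?_) (key _ _ fun φ hφ => ?_)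
  · rw [← neg_inj, ← u.weak_dx φ hφ, ← v.weak_dx φ hφ, h]
  · rw [← neg_inj, ← u.weak_dy φ hφ, ← v.weak_dy φ hφ, h]

/-! ### Separated functions -/

/-- The function `z(x) Y(y)`. -/
noncomputable def tensor (z : ℝ → ℂ) (Y : ℝ → ℝ) (p : ℝ × ℝ) : ℂ := z p.1 * (Y p.2 : ℂ)

section tensor

variable {z z' w : ℝ → ℂ} {Y Y' Z : ℝ → ℝ}

lemma contDiff_tensor (hz : ContDiff ℝ ∞ z) (hY : ContDiff ℝ ∞ Y) : ContDiff ℝ ∞ (tensor z Y) :=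
  (hz.comp contDiff_fst).mul ((contDiff_ofReal_comp hY).comp contDiff_snd)

lemma continuous_tensor (hz : Continuous z) (hY : Continuous Y) : Continuous (tensor z Y) := by
  unfold tensor; fun_prop

lemma hasFDerivAt_tensor {p : ℝ × ℝ} {a : ℂ} {b : ℝ} (hz : HasDerivAt z a p.1)
    (hY : HasDerivAt Y b p.2) : ∃ L : ℝ × ℝ →L[ℝ] ℂ, HasFDerivAt (tensor z Y) L p ∧
      L (1, 0) = a * Y p.2 ∧ L (0, 1) = z p.1 * b := by
  have h1 := hz.hasFDerivAt.comp p (hasFDerivAt_fst (𝕜 := ℝ) (p := p))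
  have h2 := hY.ofReal_comp.hasFDerivAt.comp p (hasFDerivAt_snd (𝕜 := ℝ) (p := p))
  exact ⟨_, h1.mul h2, by simp [mul_comm], by simp⟩

lemma partialX_tensor (hz : ∀ x, HasDerivAt z (z' x) x) (hY : ∀ y, HasDerivAt Y (Y' y) y) :
    partialX (tensor z Y) = tensor z' Y := by
  ext p
  obtain ⟨L, hL, h1, -⟩ := hasFDerivAt_tensor (hz p.1) (hY p.2)
  rw [partialX, hL.fderiv, h1, tensor]

lemma partialY_tensor (hz : ∀ x, HasDerivAt z (z' x) x) (hY : ∀ y, HasDerivAt Y (Y' y) y) :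
    partialY (tensor z Y) = tensor z Y' := by
  ext p
  obtain ⟨L, hL, -, h1⟩ := hasFDerivAt_tensor (hz p.1) (hY p.2)
  rw [partialY, hL.fderiv, h1, tensor]

lemma inner_tensor (hz : Continuous z) (hY : Continuous Y) (hw : Continuous w) (hZ : Continuous Z) :
    inner ℂ (sqLp (tensor z Y)) (sqLp (tensor w Z)) =
      (∫ x in Set.Ioo (0 : ℝ) 1, w x * conj (z x)) *
        ((∫ y in Set.Ioo (0 : ℝ) 1, Y y * Z y : ℝ) : ℂ) := by
  rw [inner_sqLp_sqLp (continuous_tensor hz hY) (continuous_tensor hw hZ), restrict_unitSquare,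
    ← integral_complex_ofReal, ← integral_prod_mul]
  refine integral_congr_ae (Filter.Eventually.of_forall fun p => ?_)
  simp only [tensor, map_mul, Complex.conj_ofReal, Complex.ofReal_mul]
  ring

lemma norm_sq_sqLp_tensor (hz : Continuous z) (hY : Continuous Y) :
    ‖sqLp (tensor z Y)‖ ^ 2 = (∫ x in Set.Ioo (0 : ℝ) 1, ‖z x‖ ^ 2) *
      ∫ y in Set.Ioo (0 : ℝ) 1, Y y ^ 2 := by
  have h := inner_tensor hz hY hz hY
  rw [inner_self_eq_norm_sq_to_K] at h
  have h2 : ∫ x in Set.Ioo (0 : ℝ) 1, z x * conj (z x) =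
      ((∫ x in Set.Ioo (0 : ℝ) 1, ‖z x‖ ^ 2 : ℝ) : ℂ) := by
    rw [← integral_complex_ofReal]
    refine integral_congr_ae (Filter.Eventually.of_forall fun x => ?_)
    simp [Complex.mul_conj, Complex.normSq_eq_norm_sq]
  rw [h2] at h
  simp_rw [← pow_two] at h
  exact Complex.ofReal_injective (by push_cast; exact h)

lemma norm_sq_sideLp (hz : Continuous z) :
    ‖sideLp z‖ ^ 2 = ∫ x in Set.Ioo (0 : ℝ) 1, ‖z x‖ ^ 2 := by
  have h := inner_sideLp_sideLp hz hz
  rw [inner_self_eq_norm_sq_to_K] at h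
  have h2 : ∫ x in Set.Ioo (0 : ℝ) 1, z x * conj (z x) =
      ((∫ x in Set.Ioo (0 : ℝ) 1, ‖z x‖ ^ 2 : ℝ) : ℂ) := by
    rw [← integral_complex_ofReal]
    refine integral_congr_ae (Filter.Eventually.of_forall fun x => ?_)
    simp [Complex.mul_conj, Complex.normSq_eq_norm_sq]
  rw [h2] at h
  exact Complex.ofReal_injective (by push_cast; exact h)

/-- The separated function `z(x) Y(y)` in `H¹(Ω)`. -/
noncomputable def H1.mode (z : ℝ → ℂ) (Y : ℝ → ℝ) (hz : ContDiff ℝ ∞ z) (hY : ContDiff ℝ ∞ Y) :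
    H1 := H1.ofSmooth (tensor z Y) (contDiff_tensor hz hY)

/-- The class of a real function in `L²(0,1)`. -/
noncomputable def realLp (Y : ℝ → ℝ) : L2Side := sideLp fun y => (Y y : ℂ)

lemma smoothTrace_tensor_right (hY : Continuous Y) :
    smoothTrace (tensor z Y) Side.right = z 1 • realLp Y :=
  sideLp_const_mul (z 1) (f := fun y => (Y y : ℂ)) (by fun_prop)

lemma smoothTrace_tensor_left (hY : Continuous Y) :
    smoothTrace (tensor z Y) Side.left = z 0 • realLp Y :=
  sideLp_const_mul (z 0) (f := fun y => (Y y : ℂ)) (by fun_prop)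

lemma smoothTrace_tensor_top (hz : Continuous z) :
    smoothTrace (tensor z Y) Side.top = (Y 1 : ℂ) • sideLp z := by
  rw [← sideLp_const_mul _ hz]
  simp only [smoothTrace, tensor, mul_comm]

lemma smoothTrace_tensor_bottom (hz : Continuous z) :
    smoothTrace (tensor z Y) Side.bottom = (Y 0 : ℂ) • sideLp z := by
  rw [← sideLp_const_mul _ hz]
  simp only [smoothTrace, tensor, mul_comm]

end tensor

/-- Green's formula against a separated function that satisfies the vertical conditions. -/
lemma mode_green {B₁ B₃ : BC} {m : ℝ} {z z' z'' : ℝ → ℂ} {Y Y' : ℝ → ℝ}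
    (hY : IsVerticalMode B₁ B₃ m Y Y') (hz : ContDiff ℝ ∞ z)
    (hd : ∀ x, HasDerivAt z (z' x) x) (hd' : ∀ x, HasDerivAt z' (z'' x) x) {u : H1}
    {τ : Side → L2Side} (hτ : HasTrace u τ) (h₁ : B₁ = BC.dirichlet → τ Side.bottom = 0)
    (h₃ : B₃ = BC.dirichlet → τ Side.top = 0) :
    inner ℂ (sqLp (tensor z' Y)) u.dx + inner ℂ (sqLp (tensor z Y')) u.dy =
      -inner ℂ (sqLp (tensor (fun x => z'' x - m ^ 2 * z x) Y)) u.val +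
        conj (z' 1) * inner ℂ (realLp Y) (τ Side.right) -
          conj (z' 0) * inner ℂ (realLp Y) (τ Side.left) := by
  have hzc := hz.continuous
  have hYc := hY.contDiff.continuous
  have hYc' := hY.contDiff_deriv.continuous
  have hz' : ContDiff ℝ ∞ z' := by
    have := (contDiff_infty_iff_deriv.1 hz).2
    rwa [funext fun x => (hd x).deriv] at this
  have hzc' := hz'.continuous
  have hz'' : Continuous z'' := by
    have := (contDiff_infty_iff_deriv.1 hz').2.continuous
    rwa [funext fun x => (hd' x).deriv] at this
  -- Green in x is tested with z'Y, Green in y with zY'; their sum is the gradient pairing with zY.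
  have hx := (hasTrace_iff.1 hτ _ (contDiff_tensor hz' hY.contDiff)).1
  have hy := (hasTrace_iff.1 hτ _ (contDiff_tensor hz hY.contDiff_deriv)).2
  rw [partialX_tensor hd' hY.hasDerivAt] at hx
  rw [partialY_tensor hd hY.hasDerivAt_deriv] at hy
  have e1 := smoothTrace_tensor_right (z := z') hYc
  have e2 := smoothTrace_tensor_left (z := z') hYc
  have e3 := smoothTrace_tensor_top (Y := Y') hzc
  have e4 := smoothTrace_tensor_bottom (Y := Y') hzc
  simp only [smoothTrace] at e1 e2 e3 e4
  rw [e1, e2, inner_smul_left, inner_smul_left] at hx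
  rw [e3, e4, inner_smul_left, inner_smul_left] at hy
  -- On horizontal sides either the trace of u vanishes (Dirichlet) or Y' does (Neumann).
  have ht : conj ((Y' 1 : ℝ) : ℂ) * inner ℂ (sideLp z) (τ Side.top) = 0 := by
    by_cases h : B₃ = BC.dirichlet
    · rw [h₃ h, inner_zero_right, mul_zero]
    · rw [hY.top_neumann h]; simp
  have hb : conj ((Y' 0 : ℝ) : ℂ) * inner ℂ (sideLp z) (τ Side.bottom) = 0 := by
    by_cases h : B₁ = BC.dirichlet
    · rw [h₁ h, inner_zero_right, mul_zero]
    · rw [hY.bottom_neumann h]; simp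
  rw [ht, hb] at hy
  have hsum : inner ℂ (sqLp (tensor (fun x => z'' x - m ^ 2 * z x) Y)) u.val =
      inner ℂ (sqLp (tensor z'' Y)) u.val +
        inner ℂ (sqLp (tensor z fun y => -m ^ 2 * Y y)) u.val := by
    rw [← inner_add_left]
    congr 1
    have c1 : Continuous (tensor z'' Y) := continuous_tensor hz'' hYc
    have c2 : Continuous (tensor z fun y => -m ^ 2 * Y y) := continuous_tensor hzc (by fun_prop)
    have c3 : Continuous (tensor (fun x => z'' x - m ^ 2 * z x) Y) :=
      continuous_tensor (by fun_prop) hYc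
    refine Lp.ext ?_
    filter_upwards [coeFn_sqLp c1, coeFn_sqLp c2, coeFn_sqLp c3, Lp.coeFn_add (sqLp (tensor z'' Y))
      (sqLp (tensor z fun y => -m ^ 2 * Y y))] with p h1 h2 h3 h4
    rw [h3, h4, Pi.add_apply, h1, h2]
    simp only [tensor]; push_cast; ring
  rw [hsum]
  linear_combination hx + hy

/-! ### Weak solutions -/

/-- The weak equation, for a function with value `U`, derivatives `X`, `Y` and traces `Tr`, `Tl` on
the right and the left side. -/
def WeakEq (k : ℝ) (B₁ B₂ B₃ : BC) (g : L2Side) (U X Y : L2Square) (Tr Tl : L2Side) : Prop :=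
  ∀ (v : H1) (σ : Side → L2Side), HasTrace v σ → (B₁ = BC.dirichlet → σ Side.bottom = 0) →
    (B₂ = BC.dirichlet → σ Side.right = 0) → (B₃ = BC.dirichlet → σ Side.top = 0) →
      inner ℂ v.dx X + inner ℂ v.dy Y - (k : ℂ) ^ 2 * inner ℂ v.val U
          - Complex.I * (k : ℂ) * ((if B₂ = BC.impedance then inner ℂ (σ Side.right) Tr else 0) +
            inner ℂ (σ Side.left) Tl) =
        if B₂ = BC.dirichlet then 0 else inner ℂ (σ Side.right) g

lemma sum_side (f : Side → ℂ) :
    ∑ s, f s = f Side.bottom + f Side.right + f Side.top + f Side.left := by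
  have : (Finset.univ : Finset Side) = {Side.bottom, Side.right, Side.top, Side.left} := rfl
  rw [this]
  simp [Finset.sum_insert, add_assoc]

lemma forall_side {p : Side → Prop} :
    (∀ s, p s) ↔ p Side.bottom ∧ p Side.right ∧ p Side.top ∧ p Side.left :=
  ⟨fun h => ⟨h _, h _, h _, h _⟩, fun h s => by cases s <;> tauto⟩

/-- The horizontal sides carry no integrals: their data are zero and they are never impedance sides.
Only the traces on the right and on the left enter the equation. -/
lemma isSolution_iff {k : ℝ} {B₁ B₂ B₃ : BC} (h₁ : IsDN B₁) (h₃ : IsDN B₃) {g : L2Side} {u : H1} :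
    IsSolution k B₁ B₂ B₃ g u ↔ ∃ τ : Side → L2Side, HasTrace u τ ∧
      (B₁ = BC.dirichlet → τ Side.bottom = 0) ∧ (B₂ = BC.dirichlet → τ Side.right = g) ∧
      (B₃ = BC.dirichlet → τ Side.top = 0) ∧
      WeakEq k B₁ B₂ B₃ g u.val u.dx u.dy (τ Side.right) (τ Side.left) := by
  have i₁ : B₁ ≠ BC.impedance := by rcases h₁ with rfl | rfl <;> simp
  have i₃ : B₃ ≠ BC.impedance := by rcases h₃ with rfl | rfl <;> simp
  have p1 : (Pi.single Side.right g : Side → L2Side) Side.bottom = 0 :=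
    Pi.single_eq_of_ne (by simp) _
  have p2 : (Pi.single Side.right g : Side → L2Side) Side.right = g := Pi.single_eq_same _ _
  have p3 : (Pi.single Side.right g : Side → L2Side) Side.top = 0 :=
    Pi.single_eq_of_ne (by simp) _
  have p4 : (Pi.single Side.right g : Side → L2Side) Side.left = 0 :=
    Pi.single_eq_of_ne (by simp) _
  simp only [IsSolution, IsWeakSolution, WeakEq, sum_side, forall_side, boundaryOps, p1, p2, p3, p4,
    i₁, i₃, if_false, if_true, inner_zero_right, ite_self, zero_add, add_zero, reduceCtorEq,
    false_imp_iff, and_true, and_imp, and_assoc]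
  exact Iff.rfl

lemma WeakEq.hasSum {ι : Type*} {k : ℝ} {B₁ B₂ B₃ : BC} {g Tr Tl : ι → L2Side}
    {U X Y : ι → L2Square} (h : ∀ n, WeakEq k B₁ B₂ B₃ (g n) (U n) (X n) (Y n) (Tr n) (Tl n))
    {g' Tr' Tl' : L2Side} {U' X' Y' : L2Square} (hg : HasSum g g') (hU : HasSum U U')
    (hX : HasSum X X') (hY : HasSum Y Y') (hr : HasSum Tr Tr') (hl : HasSum Tl Tl') :
    WeakEq k B₁ B₂ B₃ g' U' X' Y' Tr' Tl' := by
  intro v σ hσ s1 s2 s3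
  have hs : HasSum (fun n => if B₂ = BC.dirichlet then 0 else inner ℂ (σ Side.right) (g n))
      (if B₂ = BC.dirichlet then 0 else inner ℂ (σ Side.right) g') := by
    split_ifs
    · exact hasSum_zero
    · exact hasSum_inner hg _
  refine HasSum.unique ?_ hs
  simp only [← fun n => h n v σ hσ s1 s2 s3]
  refine (((hasSum_inner hX _).add (hasSum_inner hY _)).sub ((hasSum_inner hU _).mul_left _)).sub
    (HasSum.mul_left _ (HasSum.add ?_ (hasSum_inner hl _)))
  split_ifs
  · exact hasSum_inner hr _
  · exact hasSum_zero

/-- The separated solutions `c E(x) Y(y)`. -/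
lemma weakEq_mode {k m : ℝ} {B₁ B₂ B₃ : BC} {Y Y' : ℝ → ℝ} (hY : IsVerticalMode B₁ B₃ m Y Y')
    (c : ℂ) (hz : ContDiff ℝ ∞ fun x => c * osc k (k ^ 2 - m ^ 2) x) :
    WeakEq k B₁ B₂ B₃ ((c * modeBC k B₂ m) • realLp Y) (H1.mode _ Y hz hY.contDiff).val
      (H1.mode _ Y hz hY.contDiff).dx (H1.mode _ Y hz hY.contDiff).dy
      ((c * osc k (k ^ 2 - m ^ 2) 1) • realLp Y) (c • realLp Y) := by
  intro v σ hσ s1 s2 s3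
  have hd := fun x => (hasDerivAt_osc k (k ^ 2 - m ^ 2) x).const_mul c
  have hd' := fun x => (hasDerivAt_oscD k (k ^ 2 - m ^ 2) x).const_mul c
  have h := mode_green hY hz hd hd' hσ s1 s3
  -- E'' - m²E = -k²E, which is the Helmholtz equation for E(x)Y(y).
  have e : tensor (fun x => c * (-((k ^ 2 - m ^ 2 : ℝ) : ℂ) * osc k (k ^ 2 - m ^ 2) x) -
      (m : ℂ) ^ 2 * (c * osc k (k ^ 2 - m ^ 2) x)) Y = fun p => (-(k : ℂ) ^ 2) *
        tensor (fun x => c * osc k (k ^ 2 - m ^ 2) x) Y p := by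
    ext p; simp only [tensor]; push_cast; ring
  rw [e, sqLp_const_mul _ (continuous_tensor hz.continuous hY.contDiff.continuous)] at h
  -- Green's formula was applied with the mode in the first slot; conjugating puts the test function
  -- v there instead.
  have h' := congrArg conj h
  simp only [map_add, map_sub, map_neg, map_mul, Complex.conj_conj, inner_conj_symm,
    inner_smul_left, map_pow, Complex.conj_ofReal, oscD_zero] at h'
  simp only [H1.mode, H1.ofSmooth, partialX_tensor hd hY.hasDerivAt,
    partialY_tensor hd hY.hasDerivAt, inner_smul_right]
  rw [h']
  cases B₂
  · simp only [reduceCtorEq, if_true, if_false, s2 rfl, inner_zero_left]; ring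
  · simp only [reduceCtorEq, if_false, modeBC, bcP, bcQ]; ring
  · simp only [reduceCtorEq, if_true, if_false, modeBC, bcP, bcQ]; ring

lemma hasTrace_mode {z : ℝ → ℂ} {Y : ℝ → ℝ} (hz : ContDiff ℝ ∞ z) (hY : ContDiff ℝ ∞ Y) :
    HasTrace (H1.mode z Y hz hY) (smoothTrace (tensor z Y)) := hasTrace_ofSmooth _

/-! ### Uniqueness -/

/-- Duality. Let ζ solve ζ'' + (k² - m²)ζ = w with the left condition and the homogeneous right one.
The conjugate of ζ times Y is an admissible test function, and integrating by parts leaves the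
moment of u against wY and a boundary term in g alone. -/
lemma exists_inner_eq {k m : ℝ} {B₁ B₂ B₃ : BC} (h₁ : IsDN B₁) (h₃ : IsDN B₃) (hk : 0 < k)
    (hm : m = 0 ∨ 3 / 2 ≤ m) {Y Y' : ℝ → ℝ} (hY : IsVerticalMode B₁ B₃ m Y Y') (g : L2Side)
    {w : ℝ → ℝ} (hw : ContDiff ℝ ∞ w) :
    ∃ F : ℂ, ∀ u, IsSolution k B₁ B₂ B₃ g u →
      inner ℂ (sqLp (tensor (fun x => (w x : ℂ)) Y)) u.val = F := by
  obtain ⟨ζ, ζ', hζ, hd, hd', h0, h1⟩ := exists_mode_inhomogeneous hk hm B₂ hw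
  refine ⟨if B₂ = BC.dirichlet then ζ' 1 * inner ℂ (realLp Y) g else -ζ 1 * inner ℂ (realLp Y) g,
    fun u hu => ?_⟩
  obtain ⟨τ, hτ, t1, t2, t3, hweak⟩ := (isSolution_iff h₁ h₃).1 hu
  have hconj : ∀ {f : ℝ → ℂ} {f' : ℂ} {x : ℝ}, HasDerivAt f f' x →
      HasDerivAt (fun x => conj (f x)) (conj f') x := fun h => h.star
  have hz : ContDiff ℝ ∞ fun x => conj (ζ x) := Complex.conjCLE.contDiff.comp hζ
  have hg := mode_green hY hz (fun x => hconj (hd x)) (fun x => hconj (hd' x)) hτ t1 t3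
  have hYc := hY.contDiff.continuous
  have hwc := hw.continuous
  have e : sqLp (tensor (fun x => conj ((w x : ℂ) - ((k : ℂ) ^ 2 - (m : ℂ) ^ 2) * ζ x) -
      (m : ℂ) ^ 2 * conj (ζ x)) Y) = sqLp (tensor (fun x => (w x : ℂ)) Y) +
        (-(k : ℂ) ^ 2) • sqLp (tensor (fun x => conj (ζ x)) Y) := by
    have c1 : Continuous (tensor (fun x => (w x : ℂ)) Y) := continuous_tensor (by fun_prop) hYc
    have c2 : Continuous (tensor (fun x => conj (ζ x)) Y) := continuous_tensor hz.continuous hYc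
    have c3 : Continuous (tensor (fun x => conj ((w x : ℂ) - ((k : ℂ) ^ 2 - (m : ℂ) ^ 2) * ζ x) -
      (m : ℂ) ^ 2 * conj (ζ x)) Y) := by
      have := hζ.continuous
      exact continuous_tensor (by fun_prop) hYc
    rw [← sqLp_const_mul _ c2]
    have c4 : Continuous fun p => (-(k : ℂ) ^ 2) * tensor (fun x => conj (ζ x)) Y p :=
      continuous_const.mul c2
    refine Lp.ext ?_
    filter_upwards [coeFn_sqLp c1, coeFn_sqLp c4, coeFn_sqLp c3,
      Lp.coeFn_add (sqLp (tensor (fun x => (w x : ℂ)) Y))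
        (sqLp fun p => (-(k : ℂ) ^ 2) * tensor (fun x => conj (ζ x)) Y p)] with p q1 q2 q3 q4
    rw [q3, q4, Pi.add_apply, q1, q2]
    simp only [tensor, map_sub, map_mul, map_pow, Complex.conj_ofReal]
    ring
  rw [e, inner_add_left, inner_smul_left] at hg
  have hW := hweak _ _ (hasTrace_mode hz hY.contDiff)
    (fun h => by rw [smoothTrace_tensor_bottom hz.continuous, hY.bottom_dirichlet h]; simp)
    (fun h => by
      rw [smoothTrace_tensor_right hYc]
      subst h
      simp only [bcP, bcQ, zero_mul, one_mul, zero_add] at h1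
      simp [h1])
    (fun h => by rw [smoothTrace_tensor_top hz.continuous, hY.top_dirichlet h]; simp)
  rw [smoothTrace_tensor_right hYc, smoothTrace_tensor_left hYc] at hW
  simp only [H1.mode, H1.ofSmooth, partialX_tensor (fun x => hconj (hd x)) hY.hasDerivAt,
    partialY_tensor (fun x => hconj (hd x)) hY.hasDerivAt, inner_smul_left, hg] at hW
  simp only [map_neg, map_pow, Complex.conj_ofReal, Complex.conj_conj, h0] at hW
  cases B₂
  · simp only [reduceCtorEq, if_true, if_false, t2 rfl] at hW ⊢
    linear_combination -hW
  · simp only [reduceCtorEq, if_false, bcP, bcQ, zero_mul, one_mul, add_zero] at hW h1 ⊢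
    linear_combination -hW + h1 * inner ℂ (realLp Y) (τ Side.right)
  · simp only [reduceCtorEq, if_true, if_false, bcP, bcQ, one_mul] at hW h1 ⊢
    linear_combination -hW + h1 * inner ℂ (realLp Y) (τ Side.right)

/-- By Fubini, arbitrary w forces the n-th vertical coefficient of d(x, ·) to vanish for almost
every x. There are countably many n, so almost every slice has all coefficients zero, and
completeness in y applies. -/
lemma eq_zero_of_inner_tensor {B₁ B₃ : BC} (h₁ : IsDN B₁) (h₃ : IsDN B₃) {d : L2Square}
    (h : ∀ (n : ℕ) (w : ℝ → ℝ), ContDiff ℝ ∞ w →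
      inner ℂ (sqLp (tensor (fun x => (w x : ℂ)) (eigenfun B₁ B₃ n))) d = 0) : d = 0 := by
  set μ : Measure ℝ := volume.restrict (Set.Ioo (0 : ℝ) 1) with hμ
  have hcY : ∀ n, Continuous (eigenfun B₁ B₃ n) := fun n =>
    (isVerticalMode_eigenfun h₁ h₃ n).contDiff.continuous
  have hdi : Integrable (d : ℝ × ℝ → ℂ) (μ.prod μ) := by
    rw [← restrict_unitSquare]; exact (Lp.memLp d).integrable (by norm_num)
  have hconv : ∀ f : ℝ × ℝ → ℂ, ∫ z in unitSquare, f z = ∫ p, f p ∂μ.prod μ := fun f => by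
    rw [restrict_unitSquare]
  have hmul : ∀ {f : ℝ × ℝ → ℂ}, Continuous f → Integrable (fun p => d p * f p) (μ.prod μ) := by
    intro f hf
    obtain ⟨C, hC⟩ := (isCompact_Icc (a := (0 : ℝ × ℝ)) (b := 1)).exists_bound_of_continuousOn
      hf.continuousOn
    refine hdi.mul_bdd (c := C) hf.aestronglyMeasurable ?_
    rw [← restrict_unitSquare]
    exact (ae_restrict_iff' measurableSet_unitSquare).2
      (Filter.Eventually.of_forall fun z hz => hC z (unitSquare_subset hz))
  have hF : ∀ n, ∀ᵐ x ∂μ, ∫ y, d (x, y) * (eigenfun B₁ B₃ n y : ℂ) ∂μ = 0 := by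
    intro n
    have hc := hcY n
    have hi : Integrable (fun x => ∫ y, d (x, y) * (eigenfun B₁ B₃ n y : ℂ) ∂μ) μ :=
      (hmul (f := fun p => (eigenfun B₁ B₃ n p.2 : ℂ)) (by fun_prop)).integral_prod_left
    have h0 := isOpen_Ioo.ae_eq_zero_of_integral_contDiff_smul_eq_zero
      (IntegrableOn.locallyIntegrableOn hi) (μ := volume) fun g hg _ hgs => ?_
    · exact (ae_restrict_iff' measurableSet_Ioo).2 h0
    · rw [← setIntegral_eq_integral_of_forall_compl_eq_zero (s := Set.Ioo (0 : ℝ) 1)]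
      · have h2 := h n g hg
        have hgc := hg.continuous
        rw [inner_sqLp (continuous_tensor (by fun_prop) hc), hconv] at h2
        have hi2 : Integrable (fun p => d p * conj (tensor (fun x => (g x : ℂ))
            (eigenfun B₁ B₃ n) p)) (μ.prod μ) := by
          have := continuous_tensor (z := fun x => (g x : ℂ)) (by fun_prop) hc
          exact hmul (by fun_prop)
        rw [integral_prod _ hi2] at h2
        rw [← h2]
        refine integral_congr_ae (Filter.Eventually.of_forall fun x => ?_)
        simp only [Complex.real_smul]
        rw [← integral_const_mul]
        refine integral_congr_ae (Filter.Eventually.of_forall fun y => ?_)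
        simp only [tensor, map_mul, Complex.conj_ofReal]; ring
      · intro y hy
        rw [image_eq_zero_of_notMem_tsupport fun h' => hy (hgs h'), zero_smul]
  have hae : ∀ᵐ p ∂μ.prod μ, d p = 0 := by
    have hmeas : MeasurableSet {p | (d : ℝ × ℝ → ℂ) p = 0} :=
      (Lp.stronglyMeasurable d).measurable (measurableSet_singleton 0)
    rw [Measure.ae_prod_iff_ae_ae hmeas]
    filter_upwards [hdi.prod_right_ae, ae_all_iff.2 hF] with x hx hx'
    exact ae_eq_zero_of_integral_mul_eigenfun h₁ h₃ hx hx'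
  refine Lp.ext ?_
  rw [← restrict_unitSquare] at hae
  filter_upwards [hae, Lp.coeFn_zero ℂ 2 (volume.restrict unitSquare)] with p h1 h2
  rw [h1, h2, Pi.zero_apply]

lemma IsSolution.unique {k : ℝ} {B₁ B₂ B₃ : BC} (h₁ : IsDN B₁) (h₃ : IsDN B₃) (hk : 0 < k)
    {g : L2Side} {u v : H1} (hu : IsSolution k B₁ B₂ B₃ g u) (hv : IsSolution k B₁ B₂ B₃ g v) :
    u = v := by
  refine H1.ext_val (sub_eq_zero.1 (eq_zero_of_inner_tensor h₁ h₃ fun n w hw => ?_))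
  obtain ⟨F, hF⟩ := exists_inner_eq h₁ h₃ hk (freq_eq_zero_or B₁ B₃ n)
    (isVerticalMode_eigenfun h₁ h₃ n) (B₂ := B₂) g hw
  rw [inner_sub_right, hF u hu, hF v hv, sub_self]

/-! ### Orthogonal series -/

section orthogonal

variable {H : Type*} [NormedAddCommGroup H] [InnerProductSpace ℂ H] {v : ℕ → H}

lemma norm_sq_sum_of_orthogonal (hv : ∀ i j, i ≠ j → inner ℂ (v i) (v j) = 0) (s : Finset ℕ) :
    ‖∑ i ∈ s, v i‖ ^ 2 = ∑ i ∈ s, ‖v i‖ ^ 2 := by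
  induction s using Finset.induction_on with
  | empty => simp
  | insert a s ha ih =>
    rw [Finset.sum_insert ha, Finset.sum_insert ha, norm_add_sq (𝕜 := ℂ), ih, inner_sum,
      Finset.sum_eq_zero fun i hi => hv a i fun h => ha (h ▸ hi)]
    simp

lemma hasSum_norm_sq_of_orthogonal (hv : ∀ i j, i ≠ j → inner ℂ (v i) (v j) = 0) {x : H}
    (h : HasSum v x) : HasSum (fun i => ‖v i‖ ^ 2) (‖x‖ ^ 2) := by
  have h2 := (Filter.Tendsto.norm h).pow 2
  simp only [norm_sq_sum_of_orthogonal hv] at h2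
  exact h2

/-- Pythagoras turns the Cauchy criterion for the squared norms into that for the series. -/
lemma summable_of_orthogonal [CompleteSpace H] (hv : ∀ i j, i ≠ j → inner ℂ (v i) (v j) = 0)
    (h : Summable fun i => ‖v i‖ ^ 2) : Summable v := by
  rw [summable_iff_vanishing_norm] at h ⊢
  intro ε hε
  obtain ⟨s, hs⟩ := h (ε ^ 2) (by positivity)
  refine ⟨s, fun t ht => ?_⟩
  have := hs t ht
  rw [← norm_sq_sum_of_orthogonal hv, Real.norm_of_nonneg (sq_nonneg _)] at this
  exact lt_of_pow_lt_pow_left₀ 2 hε.le this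

end orthogonal

/-! ### Expansion in the eigenfunctions -/

section expansion

variable {B₁ B₃ : BC}

lemma inner_realLp_realLp {Y Z : ℝ → ℝ} (hY : Continuous Y) (hZ : Continuous Z) :
    inner ℂ (realLp Y) (realLp Z) = ((∫ y in Set.Ioo (0 : ℝ) 1, Y y * Z y : ℝ) : ℂ) := by
  rw [realLp, realLp, inner_sideLp_sideLp (by fun_prop) (by fun_prop), ← integral_complex_ofReal]
  refine integral_congr_ae (Filter.Eventually.of_forall fun y => ?_)
  simp only [Complex.conj_ofReal, Complex.ofReal_mul, mul_comm]

lemma norm_sq_realLp {Y : ℝ → ℝ} (hY : Continuous Y) :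
    ‖realLp Y‖ ^ 2 = ∫ y in Set.Ioo (0 : ℝ) 1, Y y ^ 2 := by
  rw [realLp, norm_sq_sideLp (by fun_prop)]
  simp [Complex.norm_real]

lemma inner_realLp_eigenfun (h₁ : IsDN B₁) (h₃ : IsDN B₃) {i j : ℕ} (hij : i ≠ j) :
    inner ℂ (realLp (eigenfun B₁ B₃ i)) (realLp (eigenfun B₁ B₃ j)) = 0 := by
  have hi := isVerticalMode_eigenfun h₁ h₃ i
  have hj := isVerticalMode_eigenfun h₁ h₃ j
  rw [inner_realLp_realLp hi.contDiff.continuous hj.contDiff.continuous,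
    hi.integral_mul_eq_zero hj (freq_sq_ne B₁ B₃ hij), Complex.ofReal_zero]

lemma coeff_eq_inner (h₁ : IsDN B₁) (h₃ : IsDN B₃) (g : L2Side) (n : ℕ) :
    coeff B₁ B₃ g n = inner ℂ (realLp (eigenfun B₁ B₃ n)) g := by
  have hc := (isVerticalMode_eigenfun h₁ h₃ n).contDiff.continuous
  rw [realLp, inner_sideLp (by fun_prop), coeff]
  simp only [Complex.conj_ofReal]

lemma norm_realLp_eigenfun (h₁ : IsDN B₁) (h₃ : IsDN B₃) (n : ℕ) :
    ‖realLp (eigenfun B₁ B₃ n)‖ = 1 ∨ n = 0 ∧ realLp (eigenfun B₁ B₃ n) = 0 := by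
  have hc := (isVerticalMode_eigenfun h₁ h₃ n).contDiff.continuous
  have hn := norm_sq_realLp hc
  rcases integral_eigenfun_sq h₁ h₃ n with h | ⟨h, h'⟩
  · left
    rw [h] at hn
    exact (pow_eq_one_iff_of_nonneg (norm_nonneg _) two_ne_zero).1 hn
  · right
    refine ⟨h, ?_⟩
    rw [h'] at hn ⊢
    simpa using hn

lemma integral_eigenfun_sq_le_one (h₁ : IsDN B₁) (h₃ : IsDN B₃) (n : ℕ) :
    ∫ y in Set.Ioo (0 : ℝ) 1, eigenfun B₁ B₃ n y ^ 2 ≤ 1 := by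
  rcases integral_eigenfun_sq h₁ h₃ n with h | ⟨-, h⟩
  · exact h.le
  · simp [h]

/-- The modes form a Hilbert basis: orthonormality comes from the eigenvalue equation, density from
`ae_eq_zero_of_integral_mul_eigenfun`. -/
lemma hasSum_coeff_smul (h₁ : IsDN B₁) (h₃ : IsDN B₃) (g : L2Side) :
    HasSum (fun n => coeff B₁ B₃ g n • realLp (eigenfun B₁ B₃ n)) g := by
  -- Restricting to indices of norm 1 discards the zero mode of the Dirichlet-Dirichlet case, which
  -- contributes nothing to the sum.
  set s : Set ℕ := {n | ‖realLp (eigenfun B₁ B₃ n)‖ = 1} with hs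
  have hon : Orthonormal ℂ fun i : s => realLp (eigenfun B₁ B₃ i) :=
    ⟨fun i => i.2, fun i j hij => inner_realLp_eigenfun h₁ h₃ (Subtype.coe_injective.ne hij)⟩
  have hbot : (Submodule.span ℂ (Set.range fun i : s => realLp (eigenfun B₁ B₃ i)))ᗮ = ⊥ := by
    rw [Submodule.eq_bot_iff]
    intro f hf
    rw [Submodule.mem_orthogonal] at hf
    have hcoeff : ∀ n, coeff B₁ B₃ f n = 0 := by
      intro n
      rw [coeff_eq_inner h₁ h₃]
      rcases norm_realLp_eigenfun h₁ h₃ n with h | ⟨-, h⟩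
      · exact hf _ (Submodule.subset_span ⟨⟨n, h⟩, rfl⟩)
      · rw [h, inner_zero_left]
    have hae := ae_eq_zero_of_integral_mul_eigenfun h₁ h₃ (f := f)
      ((Lp.memLp f).integrable (by norm_num)) hcoeff
    refine Lp.ext ?_
    filter_upwards [hae, Lp.coeFn_zero ℂ 2 (volume.restrict (Set.Ioo (0 : ℝ) 1))] with y e1 e2
    rw [e1, e2, Pi.zero_apply]
  have h := (HilbertBasis.mkOfOrthogonalEqBot hon hbot).hasSum_repr g
  rw [← hasSum_subtype_iff_of_support_subset (s := s)]
  · convert h using 2 with i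
    simp [HilbertBasis.repr_apply_apply, coeff_eq_inner h₁ h₃]
  · intro n hn
    rcases norm_realLp_eigenfun h₁ h₃ n with h | ⟨-, h⟩
    · exact h
    · exact absurd (by simp [h]) hn

lemma hasSum_norm_coeff_sq (h₁ : IsDN B₁) (h₃ : IsDN B₃) (g : L2Side) :
    HasSum (fun n => ‖coeff B₁ B₃ g n‖ ^ 2) (‖g‖ ^ 2) := by
  refine (hasSum_norm_sq_of_orthogonal (fun i j hij => ?_)
    (hasSum_coeff_smul h₁ h₃ g)).congr_fun ?_
  · rw [inner_smul_left, inner_smul_right, inner_realLp_eigenfun h₁ h₃ hij]; simp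
  · intro n
    rcases norm_realLp_eigenfun h₁ h₃ n with h | ⟨-, h⟩
    · rw [norm_smul, h, mul_one]
    · rw [coeff_eq_inner h₁ h₃, h]; simp

end expansion

/-! ### Separated solutions -/

section existence

variable {B₁ B₃ : BC}

lemma contDiff_const_mul_osc (c : ℂ) (k a : ℝ) : ContDiff ℝ ∞ fun x => c * osc k a x :=
  contDiff_const.mul (contDiff_osc k a)

/-- The `n`-th separated solution. -/
noncomputable def modeSol (h₁ : IsDN B₁) (h₃ : IsDN B₃) (k : ℝ) (c : ℂ) (n : ℕ) : H1 :=
  H1.mode (fun x => c * osc k (k ^ 2 - freq B₁ B₃ n ^ 2) x) (eigenfun B₁ B₃ n)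
    (contDiff_const_mul_osc _ _ _) (isVerticalMode_eigenfun h₁ h₃ n).contDiff

/-- The traces of the `n`-th separated solution. -/
noncomputable def modeTrace (B₁ B₃ : BC) (k : ℝ) (c : ℂ) (n : ℕ) : Side → L2Side :=
  smoothTrace (tensor (fun x => c * osc k (k ^ 2 - freq B₁ B₃ n ^ 2) x) (eigenfun B₁ B₃ n))

lemma modeTrace_right (h₁ : IsDN B₁) (h₃ : IsDN B₃) (k : ℝ) (c : ℂ) (n : ℕ) :
    modeTrace B₁ B₃ k c n Side.right =
      (c * osc k (k ^ 2 - freq B₁ B₃ n ^ 2) 1) • realLp (eigenfun B₁ B₃ n) :=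
  smoothTrace_tensor_right (isVerticalMode_eigenfun h₁ h₃ n).contDiff.continuous

lemma modeTrace_left (h₁ : IsDN B₁) (h₃ : IsDN B₃) (k : ℝ) (c : ℂ) (n : ℕ) :
    modeTrace B₁ B₃ k c n Side.left = c • realLp (eigenfun B₁ B₃ n) := by
  rw [modeTrace, smoothTrace_tensor_left
    (isVerticalMode_eigenfun h₁ h₃ n).contDiff.continuous, osc_zero, mul_one]

lemma modeTrace_top (k : ℝ) (c : ℂ) (n : ℕ) : modeTrace B₁ B₃ k c n Side.top =
    (eigenfun B₁ B₃ n 1 : ℂ) • sideLp fun x => c * osc k (k ^ 2 - freq B₁ B₃ n ^ 2) x :=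
  smoothTrace_tensor_top (contDiff_const_mul_osc _ _ _).continuous

lemma modeTrace_bottom (k : ℝ) (c : ℂ) (n : ℕ) : modeTrace B₁ B₃ k c n Side.bottom =
    (eigenfun B₁ B₃ n 0 : ℂ) • sideLp fun x => c * osc k (k ^ 2 - freq B₁ B₃ n ^ 2) x :=
  smoothTrace_tensor_bottom (contDiff_const_mul_osc _ _ _).continuous

lemma hasTrace_modeSol (h₁ : IsDN B₁) (h₃ : IsDN B₃) (k : ℝ) (c : ℂ) (n : ℕ) :
    HasTrace (modeSol h₁ h₃ k c n) (modeTrace B₁ B₃ k c n) := hasTrace_mode _ _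

lemma weakEq_modeSol (h₁ : IsDN B₁) (h₃ : IsDN B₃) (k : ℝ) (B₂ : BC) (c : ℂ) (n : ℕ) :
    WeakEq k B₁ B₂ B₃ ((c * modeBC k B₂ (freq B₁ B₃ n)) • realLp (eigenfun B₁ B₃ n))
      (modeSol h₁ h₃ k c n).val (modeSol h₁ h₃ k c n).dx (modeSol h₁ h₃ k c n).dy
      (modeTrace B₁ B₃ k c n Side.right) (modeTrace B₁ B₃ k c n Side.left) := by
  rw [modeTrace_right h₁ h₃, modeTrace_left h₁ h₃]
  exact weakEq_mode (isVerticalMode_eigenfun h₁ h₃ n) c _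

lemma modeTrace_bottom_eq_zero (h₁ : IsDN B₁) (h₃ : IsDN B₃) (k : ℝ) (c : ℂ) (n : ℕ)
    (h : B₁ = BC.dirichlet) : modeTrace B₁ B₃ k c n Side.bottom = 0 := by
  rw [modeTrace_bottom, (isVerticalMode_eigenfun h₁ h₃ n).bottom_dirichlet h]; simp

lemma modeTrace_top_eq_zero (h₁ : IsDN B₁) (h₃ : IsDN B₃) (k : ℝ) (c : ℂ) (n : ℕ)
    (h : B₃ = BC.dirichlet) : modeTrace B₁ B₃ k c n Side.top = 0 := by
  rw [modeTrace_top, (isVerticalMode_eigenfun h₁ h₃ n).top_dirichlet h]; simp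

lemma modeTrace_right_dirichlet (h₁ : IsDN B₁) (h₃ : IsDN B₃) (k : ℝ) (c : ℂ) (n : ℕ) :
    modeTrace B₁ B₃ k c n Side.right =
      (c * modeBC k BC.dirichlet (freq B₁ B₃ n)) • realLp (eigenfun B₁ B₃ n) := by
  rw [modeTrace_right h₁ h₃, modeBC, bcP, bcQ, zero_mul, zero_add, one_mul]

lemma isSolution_modeSol (h₁ : IsDN B₁) (h₃ : IsDN B₃) (k : ℝ) (B₂ : BC) (c : ℂ) (n : ℕ) :
    IsSolution k B₁ B₂ B₃ ((c * modeBC k B₂ (freq B₁ B₃ n)) • realLp (eigenfun B₁ B₃ n))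
      (modeSol h₁ h₃ k c n) :=
  (isSolution_iff h₁ h₃).2 ⟨_, hasTrace_modeSol h₁ h₃ k c n, modeTrace_bottom_eq_zero h₁ h₃ k c n,
    fun h => h ▸ modeTrace_right_dirichlet h₁ h₃ k c n, modeTrace_top_eq_zero h₁ h₃ k c n,
    weakEq_modeSol h₁ h₃ k B₂ c n⟩

lemma tensor_const_mul (c : ℂ) (z : ℝ → ℂ) (Y : ℝ → ℝ) :
    tensor (fun x => c * z x) Y = fun p => c * tensor z Y p :=
  funext fun _ => mul_assoc _ _ _

lemma modeSol_val (h₁ : IsDN B₁) (h₃ : IsDN B₃) (k : ℝ) (c : ℂ) (n : ℕ) :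
    (modeSol h₁ h₃ k c n).val =
      c • sqLp (tensor (osc k (k ^ 2 - freq B₁ B₃ n ^ 2)) (eigenfun B₁ B₃ n)) := by
  rw [← sqLp_const_mul _ (continuous_tensor (contDiff_osc _ _).continuous
    (isVerticalMode_eigenfun h₁ h₃ n).contDiff.continuous)]
  rw [← tensor_const_mul]; rfl

lemma continuous_oscD (k a : ℝ) : Continuous (oscD k a) :=
  continuous_iff_continuousAt.2 fun x => (hasDerivAt_oscD k a x).continuousAt

lemma modeSol_dx (h₁ : IsDN B₁) (h₃ : IsDN B₃) (k : ℝ) (c : ℂ) (n : ℕ) :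
    (modeSol h₁ h₃ k c n).dx =
      c • sqLp (tensor (oscD k (k ^ 2 - freq B₁ B₃ n ^ 2)) (eigenfun B₁ B₃ n)) := by
  rw [← sqLp_const_mul _ (continuous_tensor (continuous_oscD _ _)
    (isVerticalMode_eigenfun h₁ h₃ n).contDiff.continuous)]
  simp only [modeSol, H1.mode, H1.ofSmooth]
  rw [partialX_tensor (fun x => (hasDerivAt_osc _ _ x).const_mul c)
    (isVerticalMode_eigenfun h₁ h₃ n).hasDerivAt]
  rw [tensor_const_mul]

lemma modeSol_dy (h₁ : IsDN B₁) (h₃ : IsDN B₃) (k : ℝ) (c : ℂ) (n : ℕ) :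
    (modeSol h₁ h₃ k c n).dy =
      c • sqLp (tensor (osc k (k ^ 2 - freq B₁ B₃ n ^ 2)) (eigenfunD B₁ B₃ n)) := by
  rw [← sqLp_const_mul _ (continuous_tensor (contDiff_osc _ _).continuous
    (isVerticalMode_eigenfun h₁ h₃ n).contDiff_deriv.continuous)]
  simp only [modeSol, H1.mode, H1.ofSmooth]
  rw [partialY_tensor (fun x => (hasDerivAt_osc _ _ x).const_mul c)
    (isVerticalMode_eigenfun h₁ h₃ n).hasDerivAt]
  rw [tensor_const_mul]

lemma norm_sq_modeSol_val (h₁ : IsDN B₁) (h₃ : IsDN B₃) (k : ℝ) (c : ℂ) (n : ℕ) :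
    ‖(modeSol h₁ h₃ k c n).val‖ ^ 2 = ‖c‖ ^ 2 *
      ((∫ x in Set.Ioo (0 : ℝ) 1, ‖osc k (k ^ 2 - freq B₁ B₃ n ^ 2) x‖ ^ 2) *
        ∫ y in Set.Ioo (0 : ℝ) 1, eigenfun B₁ B₃ n y ^ 2) := by
  rw [modeSol_val, norm_smul, mul_pow, norm_sq_sqLp_tensor (contDiff_osc _ _).continuous
    (isVerticalMode_eigenfun h₁ h₃ n).contDiff.continuous]

lemma norm_sq_modeSol_dx (h₁ : IsDN B₁) (h₃ : IsDN B₃) (k : ℝ) (c : ℂ) (n : ℕ) :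
    ‖(modeSol h₁ h₃ k c n).dx‖ ^ 2 = ‖c‖ ^ 2 *
      ((∫ x in Set.Ioo (0 : ℝ) 1, ‖oscD k (k ^ 2 - freq B₁ B₃ n ^ 2) x‖ ^ 2) *
        ∫ y in Set.Ioo (0 : ℝ) 1, eigenfun B₁ B₃ n y ^ 2) := by
  rw [modeSol_dx, norm_smul, mul_pow, norm_sq_sqLp_tensor (continuous_oscD _ _)
    (isVerticalMode_eigenfun h₁ h₃ n).contDiff.continuous]

lemma norm_sq_modeSol_dy (h₁ : IsDN B₁) (h₃ : IsDN B₃) (k : ℝ) (c : ℂ) (n : ℕ) :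
    ‖(modeSol h₁ h₃ k c n).dy‖ ^ 2 = freq B₁ B₃ n ^ 2 * ‖(modeSol h₁ h₃ k c n).val‖ ^ 2 := by
  have hY := isVerticalMode_eigenfun h₁ h₃ n
  have h := hY.integral_deriv_mul hY
  simp_rw [← pow_two] at h
  rw [modeSol_dy, norm_smul, mul_pow, norm_sq_sqLp_tensor (contDiff_osc _ _).continuous
    hY.contDiff_deriv.continuous, h, norm_sq_modeSol_val]
  ring

/-- The left side is the stated energy times ∫Y_n² ≤ 1, a factor that is 0 for the vanishing mode.
-/
lemma norm_sq_modeSol_le (h₁ : IsDN B₁) (h₃ : IsDN B₃) (k : ℝ) (c : ℂ) (n : ℕ) :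
    ‖(modeSol h₁ h₃ k c n).dx‖ ^ 2 + ‖(modeSol h₁ h₃ k c n).dy‖ ^ 2 +
      k ^ 2 * ‖(modeSol h₁ h₃ k c n).val‖ ^ 2 ≤ ‖c‖ ^ 2 * modeEnergy k (freq B₁ B₃ n) := by
  have hN := integral_eigenfun_sq_le_one h₁ h₃ n
  have hE : 0 ≤ ‖c‖ ^ 2 * modeEnergy k (freq B₁ B₃ n) := by
    have := two_mul_sq_le_modeEnergy k (freq B₁ B₃ n)
    have : 0 ≤ modeEnergy k (freq B₁ B₃ n) := by nlinarith [sq_nonneg k]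
    positivity
  refine le_trans (le_of_eq ?_) (mul_le_of_le_one_right hE hN)
  rw [norm_sq_modeSol_dy, norm_sq_modeSol_dx, norm_sq_modeSol_val, modeEnergy_eq]
  ring

lemma inner_modeSol_val (h₁ : IsDN B₁) (h₃ : IsDN B₃) (k : ℝ) (c d : ℂ) {i j : ℕ} (hij : i ≠ j) :
    inner ℂ (modeSol h₁ h₃ k c i).val (modeSol h₁ h₃ k d j).val = 0 := by
  have hi := isVerticalMode_eigenfun h₁ h₃ i
  have hj := isVerticalMode_eigenfun h₁ h₃ j
  rw [modeSol_val, modeSol_val, inner_smul_left, inner_smul_right, inner_tensor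
    (contDiff_osc _ _).continuous hi.contDiff.continuous (contDiff_osc _ _).continuous
    hj.contDiff.continuous, hi.integral_mul_eq_zero hj (freq_sq_ne B₁ B₃ hij)]
  simp

lemma inner_modeSol_dx (h₁ : IsDN B₁) (h₃ : IsDN B₃) (k : ℝ) (c d : ℂ) {i j : ℕ} (hij : i ≠ j) :
    inner ℂ (modeSol h₁ h₃ k c i).dx (modeSol h₁ h₃ k d j).dx = 0 := by
  have hi := isVerticalMode_eigenfun h₁ h₃ i
  have hj := isVerticalMode_eigenfun h₁ h₃ j
  rw [modeSol_dx, modeSol_dx, inner_smul_left, inner_smul_right, inner_tensor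
    (continuous_oscD _ _) hi.contDiff.continuous (continuous_oscD _ _)
    hj.contDiff.continuous, hi.integral_mul_eq_zero hj (freq_sq_ne B₁ B₃ hij)]
  simp

lemma inner_modeSol_dy (h₁ : IsDN B₁) (h₃ : IsDN B₃) (k : ℝ) (c d : ℂ) {i j : ℕ} (hij : i ≠ j) :
    inner ℂ (modeSol h₁ h₃ k c i).dy (modeSol h₁ h₃ k d j).dy = 0 := by
  have hi := isVerticalMode_eigenfun h₁ h₃ i
  have hj := isVerticalMode_eigenfun h₁ h₃ j
  rw [modeSol_dy, modeSol_dy, inner_smul_left, inner_smul_right, inner_tensor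
    (contDiff_osc _ _).continuous hi.contDiff_deriv.continuous (contDiff_osc _ _).continuous
    hj.contDiff_deriv.continuous, hi.integral_deriv_mul hj,
    hi.integral_mul_eq_zero hj (freq_sq_ne B₁ B₃ hij)]
  simp

/-! ### Existence -/

lemma summable_smul_realLp (h₁ : IsDN B₁) (h₃ : IsDN B₃) {b : ℕ → ℂ}
    (hb : Summable fun n => ‖b n‖ ^ 2) : Summable fun n => b n • realLp (eigenfun B₁ B₃ n) := by
  refine summable_of_orthogonal (fun i j hij => ?_) (hb.of_nonneg_of_le (fun _ => sq_nonneg _) ?_)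
  · rw [inner_smul_left, inner_smul_right, inner_realLp_eigenfun h₁ h₃ hij]; simp
  · intro n
    rw [norm_smul, mul_pow]
    refine mul_le_of_le_one_right (sq_nonneg _) ?_
    rcases norm_realLp_eigenfun h₁ h₃ n with h | ⟨-, h⟩ <;> simp [h]

lemma one_le_integral_osc (k m : ℝ) :
    1 ≤ ∫ x in Set.Ioo (0 : ℝ) 1, ‖osc k (k ^ 2 - m ^ 2) x‖ ^ 2 := by
  rw [integral_norm_osc_sq]
  have := oscJ_nonneg (k ^ 2 - m ^ 2)
  nlinarith [mul_nonneg (sq_nonneg m) this]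

/-- For the traces on the top and the bottom, where the functions E_n(x) are not orthogonal in
general. Absolute convergence is obtained instead: the energy controls m²‖E_n‖², and m ≥ n supplies
a summable weight. -/
lemma summable_smul_sideLp {k : ℝ} (hk : 0 < k) {c : ℕ → ℂ}
    (hs : Summable fun n => ‖c n‖ ^ 2 * modeEnergy k (freq B₁ B₃ n)) {b : ℕ → ℝ}
    (hb : ∀ n, b n ^ 2 ≤ 2) : Summable fun n =>
      (b n : ℂ) • sideLp fun x => c n * osc k (k ^ 2 - freq B₁ B₃ n ^ 2) x := by
  have h1 : Summable fun n : ℕ => 1 / ((n : ℝ) + 1) ^ 2 := by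
    have := (summable_nat_add_iff 1).2 (Real.summable_one_div_nat_pow.2 (by norm_num : 1 < 2))
    simpa using this
  refine Summable.of_norm_bounded
    (g := fun n => 4 * (1 / k ^ 2 + 1) * (‖c n‖ ^ 2 * modeEnergy k (freq B₁ B₃ n)) +
      1 / ((n : ℝ) + 1) ^ 2) ((hs.mul_left _).add h1) fun n => ?_
  set m := freq B₁ B₃ n with hm
  have hnm : (n : ℝ) ≤ m := by
    refine le_trans ?_ (mul_pi_le_freq B₁ B₃ n)
    nlinarith [Real.pi_gt_three, (Nat.cast_nonneg n : (0 : ℝ) ≤ n)]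
  set I := ∫ x in Set.Ioo (0 : ℝ) 1, ‖osc k (k ^ 2 - m ^ 2) x‖ ^ 2 with hI
  have hI0 : 1 ≤ I := one_le_integral_osc k m
  have hQ : (m ^ 2 + k ^ 2) * I ≤ modeEnergy k m := by
    rw [modeEnergy_eq]
    have : 0 ≤ ∫ x in Set.Ioo (0 : ℝ) 1, ‖oscD k (k ^ 2 - m ^ 2) x‖ ^ 2 :=
      integral_nonneg fun _ => sq_nonneg _
    linarith
  set s := ‖(b n : ℂ) • sideLp fun x => c n * osc k (k ^ 2 - m ^ 2) x‖ with hsdef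
  have hs2 : s ^ 2 ≤ 2 * (‖c n‖ ^ 2 * I) := by
    rw [hsdef, norm_smul, mul_pow, norm_sq_sideLp (contDiff_const_mul_osc _ _ _).continuous]
    simp_rw [norm_mul, mul_pow]
    rw [integral_const_mul, Complex.norm_real, Real.norm_eq_abs, sq_abs]
    have := hb n
    gcongr
  have hn : ((n : ℝ) + 1) ^ 2 ≤ 2 * (m ^ 2 + 1) := by
    have h0 : (0 : ℝ) ≤ n := Nat.cast_nonneg n
    nlinarith [sq_nonneg ((n : ℝ) - 1)]
  have hI2 : (m ^ 2 + 1) * I ≤ (1 / k ^ 2 + 1) * modeEnergy k m := by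
    have hk2 : 0 < k ^ 2 := by positivity
    have e1 : I ≤ 1 / k ^ 2 * modeEnergy k m := by
      rw [one_div_mul_eq_div, le_div_iff₀ hk2]
      nlinarith [mul_nonneg (sq_nonneg m) (zero_le_one.trans hI0)]
    nlinarith
  -- The arithmetic-geometric mean inequality for s = s(n+1) · 1/(n+1).
  have hamgm : s ≤ s ^ 2 * ((n : ℝ) + 1) ^ 2 + 1 / ((n : ℝ) + 1) ^ 2 := by
    have hp : (0 : ℝ) < n + 1 := by positivity
    have e : s = (s * ((n : ℝ) + 1)) * (1 / ((n : ℝ) + 1)) := by field_simp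
    have e2 : 1 / ((n : ℝ) + 1) ^ 2 = (1 / ((n : ℝ) + 1)) ^ 2 := by rw [div_pow, one_pow]
    rw [e2]
    nlinarith [sq_nonneg (s * ((n : ℝ) + 1) - 1 / ((n : ℝ) + 1)),
      sq_nonneg (s * ((n : ℝ) + 1)), sq_nonneg (1 / ((n : ℝ) + 1))]
  calc s ≤ s ^ 2 * ((n : ℝ) + 1) ^ 2 + 1 / ((n : ℝ) + 1) ^ 2 := hamgm
    _ ≤ 2 * (‖c n‖ ^ 2 * I) * (2 * (m ^ 2 + 1)) + 1 / ((n : ℝ) + 1) ^ 2 := by gcongr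
    _ = 4 * ‖c n‖ ^ 2 * ((m ^ 2 + 1) * I) + 1 / ((n : ℝ) + 1) ^ 2 := by ring
    _ ≤ 4 * ‖c n‖ ^ 2 * ((1 / k ^ 2 + 1) * modeEnergy k m) + 1 / ((n : ℝ) + 1) ^ 2 := by gcongr
    _ = _ := by ring

lemma modeEnergy_nonneg (k m : ℝ) : 0 ≤ modeEnergy k m := by
  have := two_mul_sq_le_modeEnergy k m
  nlinarith [sq_nonneg k]

/-- The solution as a series of separated solutions. -/
lemma exists_isSolution (h₁ : IsDN B₁) (h₃ : IsDN B₃) {k : ℝ} (hk : 0 < k) (B₂ : BC) {c : ℕ → ℂ}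
    (hs : Summable fun n => ‖c n‖ ^ 2 * modeEnergy k (freq B₁ B₃ n)) {g : L2Side}
    (hg : HasSum (fun n => (c n * modeBC k B₂ (freq B₁ B₃ n)) • realLp (eigenfun B₁ B₃ n)) g) :
    ∃ u, IsSolution k B₁ B₂ B₃ g u ∧
      u.normGrad ^ 2 + k ^ 2 * u.normL2 ^ 2 ≤ ∑' n, ‖c n‖ ^ 2 * modeEnergy k (freq B₁ B₃ n) := by
  have hk2 : 0 < k ^ 2 := by positivity
  have hle := fun n => norm_sq_modeSol_le h₁ h₃ k (c n) n
  have ov : ∀ i j, i ≠ j → inner ℂ (modeSol h₁ h₃ k (c i) i).val (modeSol h₁ h₃ k (c j) j).val = 0 :=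
    fun i j hij => inner_modeSol_val h₁ h₃ k _ _ hij
  have ox : ∀ i j, i ≠ j → inner ℂ (modeSol h₁ h₃ k (c i) i).dx (modeSol h₁ h₃ k (c j) j).dx = 0 :=
    fun i j hij => inner_modeSol_dx h₁ h₃ k _ _ hij
  have oy : ∀ i j, i ≠ j → inner ℂ (modeSol h₁ h₃ k (c i) i).dy (modeSol h₁ h₃ k (c j) j).dy = 0 :=
    fun i j hij => inner_modeSol_dy h₁ h₃ k _ _ hij
  have hv : Summable fun n => (modeSol h₁ h₃ k (c n) n).val := by
    refine summable_of_orthogonal ov ((hs.mul_left (1 / k ^ 2)).of_nonneg_of_le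
      (fun _ => sq_nonneg _) fun n => ?_)
    rw [one_div_mul_eq_div, le_div_iff₀ hk2]
    linarith [hle n, sq_nonneg ‖(modeSol h₁ h₃ k (c n) n).dx‖,
      sq_nonneg ‖(modeSol h₁ h₃ k (c n) n).dy‖]
  have hx : Summable fun n => (modeSol h₁ h₃ k (c n) n).dx := by
    refine summable_of_orthogonal ox (hs.of_nonneg_of_le (fun _ => sq_nonneg _) fun n => ?_)
    linarith [hle n, sq_nonneg ‖(modeSol h₁ h₃ k (c n) n).dy‖,
      mul_nonneg hk2.le (sq_nonneg ‖(modeSol h₁ h₃ k (c n) n).val‖)]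
  have hy : Summable fun n => (modeSol h₁ h₃ k (c n) n).dy := by
    refine summable_of_orthogonal oy (hs.of_nonneg_of_le (fun _ => sq_nonneg _) fun n => ?_)
    linarith [hle n, sq_nonneg ‖(modeSol h₁ h₃ k (c n) n).dx‖,
      mul_nonneg hk2.le (sq_nonneg ‖(modeSol h₁ h₃ k (c n) n).val‖)]
  have hc : Summable fun n => ‖c n‖ ^ 2 := by
    refine (hs.mul_left (1 / k ^ 2)).of_nonneg_of_le (fun _ => sq_nonneg _) fun n => ?_
    rw [one_div_mul_eq_div, le_div_iff₀ hk2]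
    have := two_mul_sq_le_modeEnergy k (freq B₁ B₃ n)
    gcongr
    linarith
  have hT : ∀ s, Summable fun n => modeTrace B₁ B₃ k (c n) n s := by
    rw [forall_side]
    simp only [modeTrace_right h₁ h₃, modeTrace_left h₁ h₃, modeTrace_top, modeTrace_bottom]
    refine ⟨summable_smul_sideLp hk hs fun n => eigenfun_sq_le_two h₁ h₃ n 0,
      summable_smul_realLp h₁ h₃ ?_,
      summable_smul_sideLp hk hs fun n => eigenfun_sq_le_two h₁ h₃ n 1,
      summable_smul_realLp h₁ h₃ hc⟩
    -- The right trace has coefficients c_n E_n(1), and |E_n(1)|² is at most 1 plus the energy.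
    refine (hc.add hs).of_nonneg_of_le (fun _ => sq_nonneg _) fun n => ?_
    rw [norm_mul, mul_pow]
    have := norm_osc_one_sq_le (k := k) (m := freq B₁ B₃ n)
      ((freq_eq_zero_or B₁ B₃ n).imp_right fun h => by linarith)
    nlinarith [mul_le_mul_of_nonneg_left this (sq_nonneg ‖c n‖)]
  obtain ⟨u, u1, u2, u3, hu⟩ := exists_H1_hasSum (fun n => hasTrace_modeSol h₁ h₃ k (c n) n)
    hv.hasSum hx.hasSum hy.hasSum (fun s => (hT s).hasSum)
  refine ⟨u, (isSolution_iff h₁ h₃).2 ⟨_, hu, fun h => ?_, ?_, fun h => ?_, ?_⟩, ?_⟩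
  · simp [modeTrace_bottom_eq_zero h₁ h₃ _ _ _ h]
  · rintro rfl
    simp only [modeTrace_right_dirichlet h₁ h₃]
    exact hg.tsum_eq
  · simp [modeTrace_top_eq_zero h₁ h₃ _ _ _ h]
  · rw [u1, u2, u3]
    exact WeakEq.hasSum (fun n => weakEq_modeSol h₁ h₃ k B₂ (c n) n) hg hv.hasSum hx.hasSum
      hy.hasSum (hT _).hasSum (hT _).hasSum
  · rw [H1.normGrad, H1.normL2, Real.sq_sqrt (by positivity), u1, u2, u3]
    have n1 := hasSum_norm_sq_of_orthogonal ov hv.hasSum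
    have n2 := hasSum_norm_sq_of_orthogonal ox hx.hasSum
    have n3 := hasSum_norm_sq_of_orthogonal oy hy.hasSum
    exact hasSum_le hle ((n2.add n3).add (n1.mul_left (k ^ 2))) hs.hasSum

/-- The a priori bound, from a bound of the energies of the modes with weights `K n`. -/
lemma existsUnique_and_bound (h₁ : IsDN B₁) (h₃ : IsDN B₃) {k : ℝ} (hk : 0 < k) (B₂ : BC)
    (g : L2Side) {K : ℕ → ℝ}
    (hK : ∀ n, modeEnergy k (freq B₁ B₃ n) ≤ K n * ‖modeBC k B₂ (freq B₁ B₃ n)‖ ^ 2) {S : ℝ}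
    (hS : HasSum (fun n => ‖coeff B₁ B₃ g n‖ ^ 2 * K n) S) :
    (∃! u, IsSolution k B₁ B₂ B₃ g u) ∧ ∀ u, IsSolution k B₁ B₂ B₃ g u →
      u.normGrad + k * u.normL2 ≤ √(2 * S) := by
  have hD : ∀ n, modeBC k B₂ (freq B₁ B₃ n) ≠ 0 := fun n =>
    modeBC_ne_zero hk (freq_eq_zero_or B₁ B₃ n) B₂
  -- The amplitude for which the right boundary operator reproduces ĝ(n).
  set c : ℕ → ℂ := fun n => coeff B₁ B₃ g n / modeBC k B₂ (freq B₁ B₃ n) with hc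
  have hle : ∀ n, ‖c n‖ ^ 2 * modeEnergy k (freq B₁ B₃ n) ≤ ‖coeff B₁ B₃ g n‖ ^ 2 * K n := by
    intro n
    have hpos : 0 < ‖modeBC k B₂ (freq B₁ B₃ n)‖ ^ 2 := by
      have := norm_pos_iff.2 (hD n); positivity
    rw [hc, norm_div, div_pow, div_mul_eq_mul_div, div_le_iff₀ hpos, mul_assoc]
    exact mul_le_mul_of_nonneg_left (hK n) (sq_nonneg _)
  have hs : Summable fun n => ‖c n‖ ^ 2 * modeEnergy k (freq B₁ B₃ n) :=
    hS.summable.of_nonneg_of_le (fun n => mul_nonneg (sq_nonneg _) (modeEnergy_nonneg _ _)) hle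
  have hg : HasSum (fun n => (c n * modeBC k B₂ (freq B₁ B₃ n)) •
      realLp (eigenfun B₁ B₃ n)) g := by
    simp only [hc, div_mul_cancel₀ _ (hD _)]
    exact hasSum_coeff_smul h₁ h₃ g
  obtain ⟨u, hu, hub⟩ := exists_isSolution h₁ h₃ hk B₂ hs hg
  refine ⟨⟨u, hu, fun v hv => hv.unique h₁ h₃ hk hu⟩, fun v hv => ?_⟩
  rw [hv.unique h₁ h₃ hk hu]
  refine Real.le_sqrt_of_sq_le ?_
  have := hub.trans (hasSum_le hle hs.hasSum hS)
  -- (p + q)² ≤ 2(p² + q²) is the source of the factor 2 under the root: 12 = 2·6, 20 = 2·10, 14 =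
  -- 2·7.
  nlinarith [sq_nonneg (u.normGrad - k * u.normL2)]

end existence

/-! ### Stability -/

section stability

variable {B₁ B₃ : BC}

lemma stability_impedance (h₁ : IsDN B₁) (h₃ : IsDN B₃) {k : ℝ} (hk : 0 < k) (g : L2Side) :
    (∃! u, IsSolution k B₁ BC.impedance B₃ g u) ∧ ∀ u, IsSolution k B₁ BC.impedance B₃ g u →
      u.normGrad + k * u.normL2 ≤ √12 * max k 1 * ‖g‖ := by
  have h := existsUnique_and_bound h₁ h₃ hk BC.impedance g (K := fun _ => 6 * max k 1 ^ 2)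
    (fun n => modeEnergy_le_impedance hk (freq_eq_zero_or B₁ B₃ n))
    ((hasSum_norm_coeff_sq h₁ h₃ g).mul_right _)
  have e : √(2 * (‖g‖ ^ 2 * (6 * max k 1 ^ 2))) = √12 * max k 1 * ‖g‖ := by
    have : 2 * (‖g‖ ^ 2 * (6 * max k 1 ^ 2)) = 12 * (max k 1 * ‖g‖) ^ 2 := by ring
    rw [this, Real.sqrt_mul (by norm_num), Real.sqrt_sq (by positivity), mul_assoc]
  rwa [e] at h

lemma stability_neumann (h₁ : IsDN B₁) (h₃ : IsDN B₃) {k : ℝ} (hk : 0 < k) (g : L2Side) :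
    (∃! u, IsSolution k B₁ BC.neumann B₃ g u) ∧ ∀ u, IsSolution k B₁ BC.neumann B₃ g u →
      u.normGrad + k * u.normL2 ≤ √20 * max (k ^ 2) 1 * ‖g‖ := by
  have h := existsUnique_and_bound h₁ h₃ hk BC.neumann g (K := fun _ => 10 * max (k ^ 2) 1 ^ 2)
    (fun n => modeEnergy_le_neumann hk (freq_eq_zero_or B₁ B₃ n))
    ((hasSum_norm_coeff_sq h₁ h₃ g).mul_right _)
  have e : √(2 * (‖g‖ ^ 2 * (10 * max (k ^ 2) 1 ^ 2))) = √20 * max (k ^ 2) 1 * ‖g‖ := by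
    have : 2 * (‖g‖ ^ 2 * (10 * max (k ^ 2) 1 ^ 2)) = 20 * (max (k ^ 2) 1 * ‖g‖) ^ 2 := by ring
    rw [this, Real.sqrt_mul (by norm_num), Real.sqrt_sq (by positivity), mul_assoc]
  rwa [e] at h

lemma freq_rpow (n : ℕ) : freq B₁ B₃ n ^ (2 * (1 / 2) : ℝ) = freq B₁ B₃ n := by
  norm_num

/-- Matches the weight max{k,1} of the mode estimate with the squared factor in front of the 𝒴^{1/2}
norm. -/
lemma max_sqrt_sq {k : ℝ} (hk : 0 < k) : max (k ^ (1 / 2 : ℝ)) 1 ^ 2 = max k 1 := by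
  rw [← Real.sqrt_eq_rpow]
  rcases le_total k 1 with h | h
  · rw [max_eq_right h, max_eq_right (Real.sqrt_le_one.2 h), one_pow]
  · rw [max_eq_left h, max_eq_left (Real.one_le_sqrt.2 h), Real.sq_sqrt hk.le]

lemma stability_dirichlet (h₁ : IsDN B₁) (h₃ : IsDN B₃) {k : ℝ} (hk : 0 < k) {g : L2Side}
    (hg : MemY B₁ B₃ (1 / 2) g) :
    (∃! u, IsSolution k B₁ BC.dirichlet B₃ g u) ∧ ∀ u, IsSolution k B₁ BC.dirichlet B₃ g u →
      u.normGrad + k * u.normL2 ≤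
        √14 * (max (k ^ 2) 1 * ‖g‖ + max (k ^ (1 / 2 : ℝ)) 1 * normY B₁ B₃ (1 / 2) g) := by
  have hY2 : normY B₁ B₃ (1 / 2) g ^ 2 =
      ∑' n, ‖coeff B₁ B₃ g n‖ ^ 2 * freq B₁ B₃ n ^ (2 * (1 / 2) : ℝ) :=
    Real.sq_sqrt (tsum_nonneg fun n =>
      mul_nonneg (sq_nonneg _) (Real.rpow_nonneg (freq_nonneg _ _ _) _))
  have hsum : HasSum (fun n => ‖coeff B₁ B₃ g n‖ ^ 2 * freq B₁ B₃ n)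
      (normY B₁ B₃ (1 / 2) g ^ 2) := by
    have := Summable.hasSum hg
    rw [← hY2] at this
    simpa only [freq_rpow] using this
  have hS := ((hasSum_norm_coeff_sq h₁ h₃ g).mul_right (7 * max (k ^ 2) 1 ^ 2)).add
    (hsum.mul_right (7 * max k 1))
  have h := existsUnique_and_bound h₁ h₃ hk BC.dirichlet g
    (K := fun n => 7 * (max (k ^ 2) 1 ^ 2 + max k 1 * freq B₁ B₃ n))
    (fun n => modeEnergy_le_dirichlet (freq_eq_zero_or B₁ B₃ n))
    (hS.congr_fun fun n => by ring)
  refine ⟨h.1, fun u hu => (h.2 u hu).trans ?_⟩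
  have hN : 0 ≤ normY B₁ B₃ (1 / 2) g := Real.sqrt_nonneg _
  rw [← max_sqrt_sq hk]
  generalize hM : max (k ^ 2) 1 = M
  generalize hl : max (k ^ (1 / 2 : ℝ)) 1 = l
  have hM0 : 0 ≤ M := hM ▸ zero_le_one.trans (le_max_right _ _)
  have hl0 : 0 ≤ l := hl ▸ zero_le_one.trans (le_max_right _ _)
  refine Real.sqrt_le_iff.2 ⟨by positivity, ?_⟩
  rw [mul_pow, Real.sq_sqrt (by norm_num)]
  -- The cross term of the square, dropped in x² + y² ≤ (x + y)².
  have : 0 ≤ M * ‖g‖ * (l * normY B₁ B₃ (1 / 2) g) := by positivity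
  nlinarith

/-! ### Sharpness -/

/-- With S(1)C(1) = 0 and a = b², `oscJ_eq` gives J = 1/(2b²). Then ‖u‖² = (k² + b²)/(2b²) and ‖∇u‖²
= k²(k² + b²)/(2b²), so k‖u‖ and ‖∇u‖ are each at least k²/(√2 b). -/
lemma sqrt_two_mul_le_modeSol (h₁ : IsDN B₁) (h₃ : IsDN B₃) {n : ℕ} (hn : 1 ≤ n) {k b : ℝ}
    (hk : 0 < k) (hb : 0 < b) (hkb : k ^ 2 - freq B₁ B₃ n ^ 2 = b ^ 2)
    (hSC : oscS (b ^ 2) 1 * oscC (b ^ 2) 1 = 0) :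
    √2 * k ^ 2 / b ≤ (modeSol h₁ h₃ k 1 n).normGrad + k * (modeSol h₁ h₃ k 1 n).normL2 := by
  have hY : ∫ y in Set.Ioo (0 : ℝ) 1, eigenfun B₁ B₃ n y ^ 2 = 1 :=
    (integral_eigenfun_sq h₁ h₃ n).resolve_right fun h => by omega
  have hJ := oscJ_eq (b ^ 2)
  rw [hSC, sub_zero] at hJ
  have hb2 : 0 < b ^ 2 := by positivity
  have hJ' : oscJ (b ^ 2) = 1 / (2 * b ^ 2) := by
    rw [eq_div_iff (by positivity)]; linarith
  have hv := norm_sq_modeSol_val h₁ h₃ k 1 n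
  have hx := norm_sq_modeSol_dx h₁ h₃ k 1 n
  have hy := norm_sq_modeSol_dy h₁ h₃ k 1 n
  rw [hY, norm_one, hkb, integral_norm_osc_sq, hJ'] at hv
  rw [hY, norm_one, hkb, integral_norm_oscD_sq, hJ'] at hx
  have hm : freq B₁ B₃ n ^ 2 = k ^ 2 - b ^ 2 := by linarith
  rw [hm] at hy
  have hL : k / (√2 * b) ≤ (modeSol h₁ h₃ k 1 n).normL2 := by
    refine le_of_sq_le_sq ?_ (norm_nonneg _)
    rw [H1.normL2, hv, div_pow, mul_pow, Real.sq_sqrt (by norm_num)]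
    field_simp
    nlinarith
  have hG : k ^ 2 / (√2 * b) ≤ (modeSol h₁ h₃ k 1 n).normGrad := by
    refine Real.le_sqrt_of_sq_le ?_
    rw [hy, hx, hv, div_pow, mul_pow, Real.sq_sqrt (by norm_num)]
    field_simp
    nlinarith [mul_pos (pow_pos hk 2) hb2]
  have h2 : √2 * k ^ 2 / b = k ^ 2 / (√2 * b) + k * (k / (√2 * b)) := by
    have h3 : √2 ^ 2 = 2 := Real.sq_sqrt (by norm_num)
    field_simp
    rw [h3]; ring
  rw [h2]
  gcongr

lemma oscS_pi_sq : oscS (Real.pi ^ 2) 1 = 0 := by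
  have : (Real.pi ^ 2) ≠ 0 := by positivity
  simp [oscS, Real.sqrt_sq Real.pi_pos.le, sq_nonneg, Real.pi_ne_zero]

lemma oscC_pi_div_two_sq : oscC ((Real.pi / 2) ^ 2) 1 = 0 := by
  rw [oscC, if_pos (sq_nonneg _), Real.sqrt_sq (by positivity), mul_one, Real.cos_pi_div_two]

lemma norm_smul_realLp_eigenfun (h₁ : IsDN B₁) (h₃ : IsDN B₃) {n : ℕ} (hn : 1 ≤ n) (c : ℂ) :
    ‖c • realLp (eigenfun B₁ B₃ n)‖ = ‖c‖ := by
  rw [norm_smul, (norm_realLp_eigenfun h₁ h₃ n).resolve_right fun h => by omega, mul_one]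

lemma smul_realLp_eigenfun_ne_zero (h₁ : IsDN B₁) (h₃ : IsDN B₃) {n : ℕ} (hn : 1 ≤ n) {c : ℂ}
    (hc : c ≠ 0) : c • realLp (eigenfun B₁ B₃ n) ≠ 0 := by
  rw [← norm_ne_zero_iff, norm_smul_realLp_eigenfun h₁ h₃ hn]; exact norm_ne_zero_iff.2 hc

/-- At a = π², S(1) = 0 reduces |D| to its minimum 2k, which is the norm of the datum. -/
lemma sharp_impedance (h₁ : IsDN B₁) (h₃ : IsDN B₃) {n : ℕ} (hn : 1 ≤ n) {k : ℝ}
    (hk : k = √(freq B₁ B₃ n ^ 2 + Real.pi ^ 2)) :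
    ∃ (g : L2Side) (u : H1), g ≠ 0 ∧ IsSolution k B₁ BC.impedance B₃ g u ∧
      √2 / (2 * Real.pi) * (max k 1 * ‖g‖) ≤ u.normGrad + k * u.normL2 := by
  have hpi := Real.pi_gt_three
  have hm := pi_le_freq B₁ B₃ hn
  have hk2 : k ^ 2 = freq B₁ B₃ n ^ 2 + Real.pi ^ 2 := by rw [hk, Real.sq_sqrt (by positivity)]
  have hk0 : 0 ≤ k := hk ▸ Real.sqrt_nonneg _
  have hk3 : 3 ≤ k := by nlinarith
  have ha : k ^ 2 - freq B₁ B₃ n ^ 2 = Real.pi ^ 2 := by linarith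
  have hD : ‖modeBC k BC.impedance (freq B₁ B₃ n)‖ = 2 * k := by
    rw [← sq_eq_sq₀ (norm_nonneg _) (by positivity), norm_modeBC_impedance, ha, oscS_pi_sq]; ring
  have hs := isSolution_modeSol h₁ h₃ k BC.impedance 1 n
  rw [one_mul] at hs
  refine ⟨_, _, smul_realLp_eigenfun_ne_zero h₁ h₃ hn
    (modeBC_ne_zero (by linarith) (freq_eq_zero_or B₁ B₃ n) _), hs, le_trans (le_of_eq ?_)
    (sqrt_two_mul_le_modeSol h₁ h₃ hn (by linarith) Real.pi_pos ha (by rw [oscS_pi_sq, zero_mul]))⟩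
  rw [norm_smul_realLp_eigenfun h₁ h₃ hn, hD, max_eq_left (by linarith)]
  field_simp

/-- At a = π²/4, C(1) = 0 and the datum has norm |D| = π/2, bounded in k. -/
lemma sharp_neumann (h₁ : IsDN B₁) (h₃ : IsDN B₃) {n : ℕ} (hn : 1 ≤ n) {k : ℝ}
    (hk : k = √(freq B₁ B₃ n ^ 2 + Real.pi ^ 2 / 4)) :
    ∃ (g : L2Side) (u : H1), g ≠ 0 ∧ IsSolution k B₁ BC.neumann B₃ g u ∧
      4 * √2 / Real.pi ^ 2 * (max (k ^ 2) 1 * ‖g‖) ≤ u.normGrad + k * u.normL2 := by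
  have hpi := Real.pi_gt_three
  have hm := pi_le_freq B₁ B₃ hn
  have hk2 : k ^ 2 = freq B₁ B₃ n ^ 2 + Real.pi ^ 2 / 4 := by
    rw [hk, Real.sq_sqrt (by positivity)]
  have hk0 : 0 ≤ k := hk ▸ Real.sqrt_nonneg _
  have hk3 : 3 ≤ k := by nlinarith
  have ha : k ^ 2 - freq B₁ B₃ n ^ 2 = (Real.pi / 2) ^ 2 := by rw [hk2]; ring
  have hD : ‖modeBC k BC.neumann (freq B₁ B₃ n)‖ = Real.pi / 2 := by
    rw [← sq_eq_sq₀ (norm_nonneg _) (by positivity), norm_modeBC_neumann, ha]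
    have := oscC_sq_add ((Real.pi / 2) ^ 2) 1
    rw [oscC_pi_div_two_sq] at this
    linear_combination -freq B₁ B₃ n ^ 2 * this + ha
  have hs := isSolution_modeSol h₁ h₃ k BC.neumann 1 n
  rw [one_mul] at hs
  refine ⟨_, _, smul_realLp_eigenfun_ne_zero h₁ h₃ hn
    (modeBC_ne_zero (by linarith) (freq_eq_zero_or B₁ B₃ n) _), hs, le_trans (le_of_eq ?_)
    (sqrt_two_mul_le_modeSol h₁ h₃ hn (by linarith) (half_pos Real.pi_pos) ha
      (by rw [oscC_pi_div_two_sq, mul_zero]))⟩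
  rw [norm_smul_realLp_eigenfun h₁ h₃ hn, hD, max_eq_left (by nlinarith)]
  field_simp
  norm_num

lemma coeff_smul_realLp (h₁ : IsDN B₁) (h₃ : IsDN B₃) {n : ℕ} (hn : 1 ≤ n) (c : ℂ) (j : ℕ) :
    coeff B₁ B₃ (c • realLp (eigenfun B₁ B₃ n)) j = if j = n then c else 0 := by
  rw [coeff_eq_inner h₁ h₃, inner_smul_right]
  split_ifs with h
  · subst h
    rw [inner_self_eq_norm_sq_to_K,
      (norm_realLp_eigenfun h₁ h₃ j).resolve_right fun h => by omega]
    simp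
  · rw [inner_realLp_eigenfun h₁ h₃ h, mul_zero]

/-- At a = π², S(1) = 0 and the datum has norm |D| = 1. Its 𝒴^{1/2} norm is √μ_n ≤ √k, so the second
term of the bound is at most k. -/
lemma sharp_dirichlet (h₁ : IsDN B₁) (h₃ : IsDN B₃) {n : ℕ} (hn : 1 ≤ n) {k : ℝ}
    (hk : k = √(freq B₁ B₃ n ^ 2 + Real.pi ^ 2)) :
    ∃ (g : L2Side) (u : H1), g ≠ 0 ∧ MemY B₁ B₃ (1 / 2) g ∧ IsSolution k B₁ BC.dirichlet B₃ g u ∧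
      1 / Real.pi * (max (k ^ 2) 1 * ‖g‖ + max (k ^ (1 / 2 : ℝ)) 1 * normY B₁ B₃ (1 / 2) g) ≤
        u.normGrad + k * u.normL2 := by
  have hpi := Real.pi_gt_three
  have hm := pi_le_freq B₁ B₃ hn
  have hk2 : k ^ 2 = freq B₁ B₃ n ^ 2 + Real.pi ^ 2 := by rw [hk, Real.sq_sqrt (by positivity)]
  have hk0 : 0 ≤ k := hk ▸ Real.sqrt_nonneg _
  have hk3 : 3 ≤ k := by nlinarith
  have hmk : freq B₁ B₃ n ≤ k := by nlinarith
  have ha : k ^ 2 - freq B₁ B₃ n ^ 2 = Real.pi ^ 2 := by linarith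
  have hD : ‖modeBC k BC.dirichlet (freq B₁ B₃ n)‖ = 1 := by
    rw [← sq_eq_sq₀ (norm_nonneg _) (by positivity), norm_modeBC_dirichlet, ha, oscS_pi_sq]; ring
  have hs := isSolution_modeSol h₁ h₃ k BC.dirichlet 1 n
  rw [one_mul] at hs
  set D := modeBC k BC.dirichlet (freq B₁ B₃ n) with hDdef
  have hterm : HasSum (fun j => ‖coeff B₁ B₃ (D • realLp (eigenfun B₁ B₃ n)) j‖ ^ 2 *
      freq B₁ B₃ j ^ (2 * (1 / 2) : ℝ)) (freq B₁ B₃ n) := by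
    have := hasSum_ite_eq n (freq B₁ B₃ n)
    convert this using 2 with j
    rw [coeff_smul_realLp h₁ h₃ hn, freq_rpow]
    split_ifs with h
    · rw [hD, h]; ring
    · simp
  refine ⟨_, _, smul_realLp_eigenfun_ne_zero h₁ h₃ hn
    (modeBC_ne_zero (by linarith) (freq_eq_zero_or B₁ B₃ n) _), hterm.summable, hs, le_trans ?_
    (sqrt_two_mul_le_modeSol h₁ h₃ hn (by linarith) Real.pi_pos ha (by rw [oscS_pi_sq, zero_mul]))⟩
  have hnY : normY B₁ B₃ (1 / 2) (D • realLp (eigenfun B₁ B₃ n)) ≤ √k := by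
    rw [normY, hterm.tsum_eq]; exact Real.sqrt_le_sqrt hmk
  rw [norm_smul_realLp_eigenfun h₁ h₃ hn, hD, max_eq_left (by nlinarith), ← Real.sqrt_eq_rpow,
    max_eq_left (Real.one_le_sqrt.2 (by linarith)), one_div_mul_eq_div, mul_one]
  refine div_le_div_of_nonneg_right ?_ Real.pi_pos.le
  have h1 : √k * normY B₁ B₃ (1 / 2) (D • realLp (eigenfun B₁ B₃ n)) ≤ k := by
    calc _ ≤ √k * √k := by gcongr
      _ = k := Real.mul_self_sqrt hk0
  -- Since k ≥ 3, k ≤ 0.4 k², hence k² + k ≤ √2 k².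
  have h2 : (1.4 : ℝ) ≤ √2 := Real.le_sqrt_of_sq_le (by norm_num)
  nlinarith

end stability

end Helmholtz

/-! ### The main theorem. -/

theorem mainTheorem3 (B₁ B₃ : Helmholtz.BC)
    (hB₁ : B₁ = Helmholtz.BC.dirichlet ∨ B₁ = Helmholtz.BC.neumann)
    (hB₃ : B₃ = Helmholtz.BC.dirichlet ∨ B₃ = Helmholtz.BC.neumann) :
    -- impedance condition on the right side
    ((∀ (k : ℝ), 0 < k → ∀ g : Helmholtz.L2Side,
        (∃! u, Helmholtz.IsSolution k B₁ Helmholtz.BC.impedance B₃ g u) ∧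
        ∀ u, Helmholtz.IsSolution k B₁ Helmholtz.BC.impedance B₃ g u →
          u.normGrad + k * u.normL2 ≤ Real.sqrt 12 * max k 1 * ‖g‖) ∧
      (∀ n : ℕ, 1 ≤ n → ∀ k : ℝ, k = Real.sqrt (Helmholtz.freq B₁ B₃ n ^ 2 + Real.pi ^ 2) →
        ∃ (g : Helmholtz.L2Side) (u : Helmholtz.H1), g ≠ 0 ∧
          Helmholtz.IsSolution k B₁ Helmholtz.BC.impedance B₃ g u ∧
          Real.sqrt 2 / (2 * Real.pi) * (max k 1 * ‖g‖) ≤ u.normGrad + k * u.normL2)) ∧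
    -- Neumann condition on the right side
    ((∀ (k : ℝ), 0 < k → ∀ g : Helmholtz.L2Side,
        (∃! u, Helmholtz.IsSolution k B₁ Helmholtz.BC.neumann B₃ g u) ∧
        ∀ u, Helmholtz.IsSolution k B₁ Helmholtz.BC.neumann B₃ g u →
          u.normGrad + k * u.normL2 ≤ Real.sqrt 20 * max (k ^ 2) 1 * ‖g‖) ∧
      (∀ n : ℕ, 1 ≤ n → ∀ k : ℝ, k = Real.sqrt (Helmholtz.freq B₁ B₃ n ^ 2 + Real.pi ^ 2 / 4) →
        ∃ (g : Helmholtz.L2Side) (u : Helmholtz.H1), g ≠ 0 ∧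
          Helmholtz.IsSolution k B₁ Helmholtz.BC.neumann B₃ g u ∧
          4 * Real.sqrt 2 / Real.pi ^ 2 * (max (k ^ 2) 1 * ‖g‖) ≤
            u.normGrad + k * u.normL2)) ∧
    -- Dirichlet condition on the right side
    ((∀ (k : ℝ), 0 < k → ∀ g : Helmholtz.L2Side, Helmholtz.MemY B₁ B₃ (1 / 2) g →
        (∃! u, Helmholtz.IsSolution k B₁ Helmholtz.BC.dirichlet B₃ g u) ∧
        ∀ u, Helmholtz.IsSolution k B₁ Helmholtz.BC.dirichlet B₃ g u →
          u.normGrad + k * u.normL2 ≤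
            Real.sqrt 14 * (max (k ^ 2) 1 * ‖g‖ +
              max (k ^ (1 / 2 : ℝ)) 1 * Helmholtz.normY B₁ B₃ (1 / 2) g)) ∧
      (∀ n : ℕ, 1 ≤ n → ∀ k : ℝ, k = Real.sqrt (Helmholtz.freq B₁ B₃ n ^ 2 + Real.pi ^ 2) →
        ∃ (g : Helmholtz.L2Side) (u : Helmholtz.H1), g ≠ 0 ∧ Helmholtz.MemY B₁ B₃ (1 / 2) g ∧
          Helmholtz.IsSolution k B₁ Helmholtz.BC.dirichlet B₃ g u ∧
          1 / Real.pi * (max (k ^ 2) 1 * ‖g‖ +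
              max (k ^ (1 / 2 : ℝ)) 1 * Helmholtz.normY B₁ B₃ (1 / 2) g) ≤
            u.normGrad + k * u.normL2)) := by
  exact ⟨⟨fun _ hk g => Helmholtz.stability_impedance hB₁ hB₃ hk g,
      fun _ hn _ hk => Helmholtz.sharp_impedance hB₁ hB₃ hn hk⟩,
    ⟨fun _ hk g => Helmholtz.stability_neumann hB₁ hB₃ hk g,
      fun _ hn _ hk => Helmholtz.sharp_neumann hB₁ hB₃ hn hk⟩,
    ⟨fun _ hk _ hg => Helmholtz.stability_dirichlet hB₁ hB₃ hk hg,
      fun _ hn _ hk => Helmholtz.sharp_dirichlet hB₁ hB₃ hn hk⟩⟩
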